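/- **Theorem 3 (Preservation).** *Setting.* A program $\Pi$ of the C-like language Gradual C0 consists of struct, predicate and method declarations and an entry statement. Statements are built from $\mathtt{skip}$, assignments $x=e$ and $x.f=e$, $x=\mathtt{alloc}(S)$, calls $y=m(\bar e)$, $\mathtt{assert}\ \tilde\phi$, $\mathtt{if}$, $\mathtt{while}\ e\ \mathtt{invariant}\ \tilde\phi$, $\mathtt{fold}\ p(\bar e)$, $\mathtt{unfold}\ p(\bar e)$, and associative sequencing. Precise formulas are $\phi ::= e \mid p(\bar e)\mid \mathtt{acc}(e.f)\mid \phi*\phi\mid \mathtt{if}\ e\ \mathtt{then}\ \phi\ \mathtt{else}\ \phi$; gradual formulas $\tilde\phi$ are $\phi$ or $?*\phi$ (imprecise). $\Pi$ is *well-formed* if it is properly typed; every pre-condition, post-condition, loop invariant and predicate body is imprecise or self-framed; variables are initialised before use and the free variables of a method body are among its parameters (so $\mathtt{result}$ is not free); parameters are never assigned; pre-conditions mention only parameters and post-conditions only parameters and $\mathtt{result}$; and a method with an imprecise pre-condition has an imprecise post-condition. *Execution.* An execution state $\Gamma$ is $\mathsf{init}$, $\mathsf{final}$, or a pair of a heap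 $H$ and a stack of frames $\langle\alpha,\rho,s\rangle$ (owned permissions $\alpha\subseteq \mathrm{Loc}\times\mathrm{Field}$, environment, remaining statement). $H(\Gamma)$ is its heap and $\alpha(\Gamma)$ the permission set of its top frame (both $\emptyset$ for $\mathsf{init}$ and $\mathsf{final}$). $\Pi\vdash\Gamma\to_{\hat\alpha}\Gamma'$ is the reachable small-step transition relation with exclusion frame $\hat\alpha$: starting the program, a step from a state that is itself the target of a reachable transition, or finishing. The permissions in $\hat\alpha$ are not available to establish the pre-condition of a callee or the invariant of an entered or skipped loop, and are not handed over to the new frame; the handed-over permissions are the exact footprint of the specification if no validity derivation for it ever uses an imprecise formula (it is *completely precise*), and otherwise all permissions not in $\hat\alpha$. *Verification.* A symbolic state $\sigma=\langle \iota,g,\mathsf H,\mathcal H,\gamma\rangle$ has an imprecision flag, a path condition $g(\sigma)$, a precise heap of field and predicate chunks, an optimistic heap of field chunks, and a symbolic environment. A verification state $\Sigma$ is $\mathsf{init}$, $\mathsf{final}$ or $\langle\sigma,s,\tilde\phi\rangle$ with remaining statement $s$ and post-condition $\tilde\phi$; it is *reachable* if it is $\mathsf{init}$ or is obtained by the rules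 of modular gradual symbolic execution (evaluate, produce, consume, execute; each method body and each loop body is verified separately). The guard judgement $\Sigma\rightharpoonup\sigma',\mathcal R,\Theta$ yields, for the next step from $\Sigma$, an intermediate state $\sigma'$, a set $\mathcal R$ of run-time checks, and a set $\Theta$ of symbolic permissions: at a call or loop those remaining after the specification is consumed, if that specification is not completely precise, and $\emptyset$ otherwise. For a valuation $V$ (a map from symbolic values to run-time values) the *corresponding valuation* $V'=V[\Sigma\rightharpoonup\sigma',\mathcal R,\Theta\mid H]$ of a guard derivation extends $V$ to its fresh symbolic values: a value generated for a field read $t.f$ gets $H(V'(t),f)$, and one that replaces a loop-modified variable gets the previous value of that variable. *Valid states.* $V,\sigma$ *correspond* to $H,\alpha,\rho$ if every field chunk $\langle f,t,t'\rangle$ of $\mathsf H(\sigma)\cup\mathcal H(\sigma)$ satisfies $H(V(t),f)=V(t')$ and $(V(t),f)\in\alpha$, every predicate chunk $p(\bar t)$ of $\mathsf H(\sigma)$ holds for $V(\bar t)$ in $H,\alpha$, distinct chunks of $\mathsf H(\sigma)$ have disjoint footprints, $\rho(x)=V(\gamma(\sigma)(x))$ for all $x\in\operatorname{dom}\gamma(\sigma)$,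 and $V(g(\sigma))=\mathtt{true}$. $\Gamma$ is *validated* by $\Sigma$ and $V$ if $\Sigma$ is reachable from $\Pi$; $\Sigma$ and $\Gamma$ are both $\mathsf{init}$, or both $\mathsf{final}$, or $\Sigma=\langle\sigma,s,\tilde\phi\rangle$ and the top frame of $\Gamma$ is $\langle\alpha,\rho,s\rangle$ with $V,\sigma$ corresponding to $H,\alpha,\rho$; and the rest of the stack is *partially validated* by $\Sigma,V$. The latter means: it is empty, or its first frame $\langle\alpha_0,\rho_0,s_0\rangle$ begins with a call $y=m(\bar e)$ or a loop, and there are a reachable $\Sigma'=\langle\sigma_0,s_0,\tilde\phi_0\rangle$ and a $V'$ that partially validate the remaining frames, such that $\tilde\phi(\Sigma)$ is the post-condition of $m$, respectively the loop invariant; evaluating the arguments $\bar e$ to some $\bar t$ (for a call) and consuming the pre-condition of $m$, respectively the invariant, from $\sigma_0$ leads to a state that, with the environment $\gamma(\sigma_0)$ and $V'$, corresponds to $H,\alpha_0,\rho_0$; and, for a call, $V(\gamma(\Sigma)(x_i))=V'(t_i)$ for all parameters $x_i$ of $m$. $\Gamma$ is a *valid state* if it is validated by some $\Sigma$ and some $V$.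 *Claim.* Let $\Pi$ be a well-formed program, let $\Gamma$ be validated by $\Sigma$ and $V$, let $\Sigma\rightharpoonup\sigma',\mathcal R,\Theta$ be a guard derivation, and let $V'=V[\Sigma\rightharpoonup\sigma',\mathcal R,\Theta\mid H(\Gamma)]$ be its corresponding valuation. Suppose that $V'(g(\sigma'))=\mathtt{true}$, that every run-time check in $\mathcal R$ holds for $V'$, $H(\Gamma)$ and $\alpha(\Gamma)$, and that $$\Pi\vdash\Gamma\to_{\hat\alpha}\Gamma',\qquad \hat\alpha=\bigcup_{\theta\in\Theta}\operatorname{vfoot}_{V',H(\Gamma)}(\theta),$$ where $\operatorname{vfoot}_{V',H}(t.f)=\{(V'(t),f)\}$ and $\operatorname{vfoot}_{V',H}(p(\bar t))$ is the exact footprint in $H$ of the body of $p$ at the arguments $V'(\bar t)$. Then $\Gamma'$ is a valid state. -/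

import Mathlib

namespace GradualC0

/-! ## Programs -/

abbrev FieldName := ℕ
abbrev PredName := ℕ
abbrev MethodName := ℕ
abbrev StructName := ℕ
abbrev Loc := ℕ

/-- Program variables: the special variable `result` and ordinary identifiers. -/
inductive Var where
  | result
  | ident (i : ℕ)
  deriving DecidableEq

inductive Ty where
  | int
  | bool
  | char
  | struct (S : StructName)

inductive Lit where
  | int (n : ℤ)
  | char (c : Char)
  | bool (b : Bool)
  | null
  deriving DecidableEq

/-- Run-time values: opaque locations and literals. -/
inductive Value where
  | loc (l : Loc)
  | lit (l : Lit)
  deriving DecidableEq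

abbrev Value.bool (b : Bool) : Value := .lit (.bool b)

def Ty.default : Ty → Lit
  | .int => .int 0
  | .bool => .bool false
  | .char => .char (Char.ofNat 0)
  | .struct _ => .null

inductive BinOp where
  | add | sub | mul | div | eq | ne | lt | le | gt | ge

/-- The value of a binary operator, undefined on operands of the wrong type.
Integer division truncates, and `x / 0 = 0`. -/
def BinOp.eval : BinOp → Value → Value → Option Value
  | .eq, v, w => some (.bool (decide (v = w)))
  | .ne, v, w => some (.bool (decide (v ≠ w)))
  | .add, .lit (.int a), .lit (.int b) => some (.lit (.int (a + b)))
  | .sub, .lit (.int a), .lit (.int b) => some (.lit (.int (a - b)))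
  | .mul, .lit (.int a), .lit (.int b) => some (.lit (.int (a * b)))
  | .div, .lit (.int a), .lit (.int b) => some (.lit (.int (Int.tdiv a b)))
  | .lt, .lit (.int a), .lit (.int b) => some (.bool (decide (a < b)))
  | .le, .lit (.int a), .lit (.int b) => some (.bool (decide (a ≤ b)))
  | .gt, .lit (.int a), .lit (.int b) => some (.bool (decide (b < a)))
  | .ge, .lit (.int a), .lit (.int b) => some (.bool (decide (b ≤ a)))
  | _, _, _ => none

/-- Negation: `true` on `false`, and `false` otherwise. -/
def Value.neg (v : Value) : Value := .bool (decide (v = .bool false))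

inductive Expr where
  | lit (l : Lit)
  | var (x : Var)
  | field (e : Expr) (f : FieldName)
  | op (o : BinOp) (e₁ e₂ : Expr)
  | or (e₁ e₂ : Expr)
  | and (e₁ e₂ : Expr)
  | not (e : Expr)

/-- Precise formulas. -/
inductive Formula where
  | expr (e : Expr)
  | pred (p : PredName) (es : List Expr)
  | acc (e : Expr) (f : FieldName)
  | sep (φ₁ φ₂ : Formula)
  | ite (e : Expr) (φ₁ φ₂ : Formula)

/-- Gradual formulas: `⟨false, φ⟩` is the precise formula `φ`, and `⟨true, φ⟩` is the
imprecise formula `? * φ`. -/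
structure GFormula where
  imp : Bool
  body : Formula

inductive Stmt where
  | skip
  | assign (x : Var) (e : Expr)
  | assignField (x : Var) (f : FieldName) (e : Expr)
  | alloc (x : Var) (S : StructName)
  | call (y : Var) (m : MethodName) (es : List Expr)
  | assert (φ : GFormula)
  | ite (e : Expr) (s₁ s₂ : Stmt)
  | loop (e : Expr) (φ : GFormula) (s : Stmt)
  | foldPred (p : PredName) (es : List Expr)
  | unfoldPred (p : PredName) (es : List Expr)
  | seq (s₁ s₂ : Stmt)

/-- Sequential composition. Sequencing is associative, and the statements of execution and
verification states are kept in the form `s₁; (s₂; (s₃; ...))` where no `sᵢ` but the last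
can be a sequence. -/
def Stmt.append : Stmt → Stmt → Stmt
  | .seq s₁ s₂, s => s₁.append (s₂.append s)
  | s₁, s => .seq s₁ s

/-- Re-association of a statement to the right. -/
def Stmt.norm : Stmt → Stmt
  | .seq s₁ s₂ => s₁.append s₂.norm
  | s => s

structure PredDecl where
  params : List (Var × Ty)
  body : GFormula

structure MethodDecl where
  params : List (Var × Ty)
  ret : Ty
  pre : GFormula
  post : GFormula
  body : Stmt

abbrev PredDecl.vars (d : PredDecl) : List Var := d.params.map Prod.fst
abbrev MethodDecl.vars (d : MethodDecl) : List Var := d.params.map Prod.fst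

/-- A program: an entry statement together with the declared methods, predicates and structs. -/
structure Program where
  entry : Stmt
  methods : MethodName → Option MethodDecl
  preds : PredName → Option PredDecl
  structs : StructName → Option (List (FieldName × Ty))

/-- The partial map `[x₁ ↦ a₁, …, xₖ ↦ aₖ]`. -/
def mkEnv {A : Type} (xs : List Var) (as : List A) : Var → Option A :=
  fun x => (xs.zip as).lookup x

/-- The variables that a statement may assign. -/
def Stmt.modified : Stmt → List Var
  | .assign x _ => [x]
  | .alloc x _ => [x]
  | .call y _ _ => [y]
  | .ite _ s₁ s₂ => s₁.modified ++ s₂.modified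
  | .loop _ _ s => s.modified
  | .seq s₁ s₂ => s₁.modified ++ s₂.modified
  | _ => []

/-! ## Dynamic evaluation, footprints, framing, assertions -/

abbrev Heap := Loc → FieldName → Value
abbrev Perm := Loc × FieldName
abbrev Env := Var → Option Value

inductive Eval (H : Heap) (ρ : Env) : Expr → Value → Prop where
  | lit (l : Lit) : Eval H ρ (.lit l) (.lit l)
  | var {x v} : ρ x = some v → Eval H ρ (.var x) v
  | andA {e₁ e₂} : Eval H ρ e₁ (.bool false) → Eval H ρ (.and e₁ e₂) (.bool false)
  | andB {e₁ e₂ v₂} : Eval H ρ e₁ (.bool true) → Eval H ρ e₂ v₂ → Eval H ρ (.and e₁ e₂) v₂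
  | orA {e₁ e₂} : Eval H ρ e₁ (.bool true) → Eval H ρ (.or e₁ e₂) (.bool true)
  | orB {e₁ e₂ v₂} : Eval H ρ e₁ (.bool false) → Eval H ρ e₂ v₂ → Eval H ρ (.or e₁ e₂) v₂
  | op {o e₁ e₂ v₁ v₂ v} : Eval H ρ e₁ v₁ → Eval H ρ e₂ v₂ → o.eval v₁ v₂ = some v →
      Eval H ρ (.op o e₁ e₂) v
  | not {e v} : Eval H ρ e v → Eval H ρ (.not e) v.neg
  | field {e f l} : Eval H ρ e (.loc l) → Eval H ρ (.field e f) (H l f)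

/-- Membership of a permission in the exact footprint of an expression. -/
inductive EFootE (H : Heap) (ρ : Env) : Expr → Perm → Prop where
  | fieldSub {e f a} : EFootE H ρ e a → EFootE H ρ (.field e f) a
  | field {e f l} : Eval H ρ e (.loc l) → EFootE H ρ (.field e f) (l, f)
  | op₁ {o e₁ e₂ a} : EFootE H ρ e₁ a → EFootE H ρ (.op o e₁ e₂) a
  | op₂ {o e₁ e₂ a} : EFootE H ρ e₂ a → EFootE H ρ (.op o e₁ e₂) a
  | or₁ {e₁ e₂ a} : EFootE H ρ e₁ a → EFootE H ρ (.or e₁ e₂) a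
  | or₂ {e₁ e₂ a} : Eval H ρ e₁ (.bool false) → EFootE H ρ e₂ a → EFootE H ρ (.or e₁ e₂) a
  | and₁ {e₁ e₂ a} : EFootE H ρ e₁ a → EFootE H ρ (.and e₁ e₂) a
  | and₂ {e₁ e₂ a} : Eval H ρ e₁ (.bool true) → EFootE H ρ e₂ a → EFootE H ρ (.and e₁ e₂) a
  | not {e a} : EFootE H ρ e a → EFootE H ρ (.not e) a

/-- Membership of a permission in the exact footprint of a formula (predicates are unrolled). -/
inductive EFoot (P : Program) (H : Heap) : Env → Formula → Perm → Prop where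
  | expr {ρ e a} : EFootE H ρ e a → EFoot P H ρ (.expr e) a
  | sep₁ {ρ φ₁ φ₂ a} : EFoot P H ρ φ₁ a → EFoot P H ρ (.sep φ₁ φ₂) a
  | sep₂ {ρ φ₁ φ₂ a} : EFoot P H ρ φ₂ a → EFoot P H ρ (.sep φ₁ φ₂) a
  | predArg {ρ p es e a} : e ∈ es → EFootE H ρ e a → EFoot P H ρ (.pred p es) a
  | predBody {ρ p es d vs a} : P.preds p = some d → List.Forall₂ (Eval H ρ) es vs →
      EFoot P H (mkEnv d.vars vs) d.body.body a → EFoot P H ρ (.pred p es) a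
  | iteCond {ρ e φ₁ φ₂ a} : EFootE H ρ e a → EFoot P H ρ (.ite e φ₁ φ₂) a
  | iteA {ρ e φ₁ φ₂ a} : Eval H ρ e (.bool true) → EFoot P H ρ φ₁ a →
      EFoot P H ρ (.ite e φ₁ φ₂) a
  | iteB {ρ e φ₁ φ₂ a} : Eval H ρ e (.bool false) → EFoot P H ρ φ₂ a →
      EFoot P H ρ (.ite e φ₁ φ₂) a
  | accSub {ρ e f a} : EFootE H ρ e a → EFoot P H ρ (.acc e f) a
  | acc {ρ e f l} : Eval H ρ e (.loc l) → EFoot P H ρ (.acc e f) (l, f)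

/-- The exact footprint of a gradual formula. -/
def efoot (P : Program) (H : Heap) (ρ : Env) (φ : GFormula) : Set Perm :=
  {a | EFoot P H ρ φ.body a}

/-- Framing of an expression by a set of permissions. -/
inductive Frm (H : Heap) (α : Set Perm) (ρ : Env) : Expr → Prop where
  | lit (l : Lit) : Frm H α ρ (.lit l)
  | var (x : Var) : Frm H α ρ (.var x)
  | field {e f l} : Frm H α ρ e → Eval H ρ e (.loc l) → (l, f) ∈ α → Frm H α ρ (.field e f)
  | op {o e₁ e₂} : Frm H α ρ e₁ → Frm H α ρ e₂ → Frm H α ρ (.op o e₁ e₂)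
  | orA {e₁ e₂} : Eval H ρ e₁ (.bool true) → Frm H α ρ e₁ → Frm H α ρ (.or e₁ e₂)
  | orB {e₁ e₂} : Eval H ρ e₁ (.bool false) → Frm H α ρ e₁ → Frm H α ρ e₂ →
      Frm H α ρ (.or e₁ e₂)
  | andA {e₁ e₂} : Eval H ρ e₁ (.bool false) → Frm H α ρ e₁ → Frm H α ρ (.and e₁ e₂)
  | andB {e₁ e₂} : Eval H ρ e₁ (.bool true) → Frm H α ρ e₁ → Frm H α ρ e₂ →
      Frm H α ρ (.and e₁ e₂)
  | not {e} : Frm H α ρ e → Frm H α ρ (.not e)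

/-- Iso-recursive framing of a formula. -/
inductive IFrm (H : Heap) (α : Set Perm) (ρ : Env) : Formula → Prop where
  | expr {e} : Frm H α ρ e → IFrm H α ρ (.expr e)
  | sep {φ₁ φ₂} : IFrm H α ρ φ₁ → IFrm H α ρ φ₂ → IFrm H α ρ (.sep φ₁ φ₂)
  | pred {p es} : (∀ e ∈ es, Frm H α ρ e) → IFrm H α ρ (.pred p es)
  | iteA {e φ₁ φ₂} : Eval H ρ e (.bool true) → Frm H α ρ e → IFrm H α ρ φ₁ →
      IFrm H α ρ (.ite e φ₁ φ₂)
  | iteB {e φ₁ φ₂} : Eval H ρ e (.bool false) → Frm H α ρ e → IFrm H α ρ φ₂ →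
      IFrm H α ρ (.ite e φ₁ φ₂)
  | acc {e f} : Frm H α ρ e → IFrm H α ρ (.acc e f)

/-- Equi-recursive framing of a formula (predicates are unrolled). -/
inductive EFrm (P : Program) (H : Heap) (α : Set Perm) : Env → Formula → Prop where
  | expr {ρ e} : Frm H α ρ e → EFrm P H α ρ (.expr e)
  | sep {ρ φ₁ φ₂} : EFrm P H α ρ φ₁ → EFrm P H α ρ φ₂ → EFrm P H α ρ (.sep φ₁ φ₂)
  | pred {ρ p es d vs} : P.preds p = some d → (∀ e ∈ es, Frm H α ρ e) →
      List.Forall₂ (Eval H ρ) es vs → EFrm P H α (mkEnv d.vars vs) d.body.body →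
      EFrm P H α ρ (.pred p es)
  | iteA {ρ e φ₁ φ₂} : Eval H ρ e (.bool true) → Frm H α ρ e → EFrm P H α ρ φ₁ →
      EFrm P H α ρ (.ite e φ₁ φ₂)
  | iteB {ρ e φ₁ φ₂} : Eval H ρ e (.bool false) → Frm H α ρ e → EFrm P H α ρ φ₂ →
      EFrm P H α ρ (.ite e φ₁ φ₂)
  | acc {ρ e f} : Frm H α ρ e → EFrm P H α ρ (.acc e f)

/-- Validity of a gradual formula for a heap, a permission set and an environment. -/
inductive Assert (P : Program) (H : Heap) : Set Perm → Env → GFormula → Prop where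
  | imprecise {α ρ φ} : Assert P H α ρ ⟨false, φ⟩ → EFrm P H α ρ φ → Assert P H α ρ ⟨true, φ⟩
  | value {α ρ e} : Eval H ρ e (.bool true) → Assert P H α ρ ⟨false, .expr e⟩
  | iteA {α ρ e φ₁ φ₂} : Eval H ρ e (.bool true) → Assert P H α ρ ⟨false, φ₁⟩ →
      Assert P H α ρ ⟨false, .ite e φ₁ φ₂⟩
  | iteB {α ρ e φ₁ φ₂} : Eval H ρ e (.bool false) → Assert P H α ρ ⟨false, φ₂⟩ →
      Assert P H α ρ ⟨false, .ite e φ₁ φ₂⟩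
  | acc {α ρ e f l} : Eval H ρ e (.loc l) → (l, f) ∈ α → Assert P H α ρ ⟨false, .acc e f⟩
  | sep {α α₁ α₂ ρ φ₁ φ₂} : Assert P H α₁ ρ ⟨false, φ₁⟩ → Assert P H α₂ ρ ⟨false, φ₂⟩ →
      α₁ ∪ α₂ ⊆ α → α₁ ∩ α₂ = ∅ → Assert P H α ρ ⟨false, .sep φ₁ φ₂⟩
  | pred {α ρ p es d vs} : P.preds p = some d → List.Forall₂ (Eval H ρ) es vs →
      Assert P H α (mkEnv d.vars vs) d.body → Assert P H α ρ ⟨false, .pred p es⟩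

/-- There is a derivation of the assertion in which the rule for imprecise formulas is applied. -/
inductive AssertUsesImprecise (P : Program) (H : Heap) : Set Perm → Env → GFormula → Prop where
  | imprecise {α ρ φ} : Assert P H α ρ ⟨false, φ⟩ → EFrm P H α ρ φ →
      AssertUsesImprecise P H α ρ ⟨true, φ⟩
  | iteA {α ρ e φ₁ φ₂} : Eval H ρ e (.bool true) → AssertUsesImprecise P H α ρ ⟨false, φ₁⟩ →
      AssertUsesImprecise P H α ρ ⟨false, .ite e φ₁ φ₂⟩
  | iteB {α ρ e φ₁ φ₂} : Eval H ρ e (.bool false) → AssertUsesImprecise P H α ρ ⟨false, φ₂⟩ →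
      AssertUsesImprecise P H α ρ ⟨false, .ite e φ₁ φ₂⟩
  | sepL {α α₁ α₂ ρ φ₁ φ₂} : AssertUsesImprecise P H α₁ ρ ⟨false, φ₁⟩ →
      Assert P H α₂ ρ ⟨false, φ₂⟩ → α₁ ∪ α₂ ⊆ α → α₁ ∩ α₂ = ∅ →
      AssertUsesImprecise P H α ρ ⟨false, .sep φ₁ φ₂⟩
  | sepR {α α₁ α₂ ρ φ₁ φ₂} : Assert P H α₁ ρ ⟨false, φ₁⟩ →
      AssertUsesImprecise P H α₂ ρ ⟨false, φ₂⟩ → α₁ ∪ α₂ ⊆ α → α₁ ∩ α₂ = ∅ →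
      AssertUsesImprecise P H α ρ ⟨false, .sep φ₁ φ₂⟩
  | pred {α ρ p es d vs} : P.preds p = some d → List.Forall₂ (Eval H ρ) es vs →
      AssertUsesImprecise P H α (mkEnv d.vars vs) d.body →
      AssertUsesImprecise P H α ρ ⟨false, .pred p es⟩

def CompletelyPrecise (P : Program) (φ : GFormula) : Prop :=
  ∀ H α ρ, ¬ AssertUsesImprecise P H α ρ φ

open Classical in
/-- The maximal footprint of a gradual formula. -/
noncomputable def foot (P : Program) (H : Heap) (α : Set Perm) (ρ : Env) (φ : GFormula) :
    Set Perm :=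
  if CompletelyPrecise P φ then efoot P H ρ φ else α

/-- A specification is an imprecise formula or a self-framed precise formula. -/
def Specification (P : Program) (φ : GFormula) : Prop :=
  φ.imp = true ∨ ∀ H α ρ, Assert P H α ρ ⟨false, φ.body⟩ → IFrm H α ρ φ.body

/-! ## Well-formed programs -/

abbrev TyEnv := Var → Option Ty

def BinOp.IsArith : BinOp → Prop
  | .add | .sub | .mul | .div => True
  | _ => False

def BinOp.IsOrder : BinOp → Prop
  | .lt | .le | .gt | .ge => True
  | _ => False

def BinOp.IsEquality : BinOp → Prop
  | .eq | .ne => True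
  | _ => False

inductive ExprTy (P : Program) (Δ : TyEnv) : Expr → Ty → Prop where
  | int (n : ℤ) : ExprTy P Δ (.lit (.int n)) .int
  | char (c : Char) : ExprTy P Δ (.lit (.char c)) .char
  | bool (b : Bool) : ExprTy P Δ (.lit (.bool b)) .bool
  | null (S : StructName) : ExprTy P Δ (.lit .null) (.struct S)
  | var {x T} : Δ x = some T → ExprTy P Δ (.var x) T
  | field {e S fs f T} : ExprTy P Δ e (.struct S) → P.structs S = some fs → (f, T) ∈ fs →
      ExprTy P Δ (.field e f) T
  | arith {o e₁ e₂} : o.IsArith → ExprTy P Δ e₁ .int → ExprTy P Δ e₂ .int →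
      ExprTy P Δ (.op o e₁ e₂) .int
  | order {o e₁ e₂} : o.IsOrder → ExprTy P Δ e₁ .int → ExprTy P Δ e₂ .int →
      ExprTy P Δ (.op o e₁ e₂) .bool
  | equality {o e₁ e₂ T} : o.IsEquality → ExprTy P Δ e₁ T → ExprTy P Δ e₂ T →
      ExprTy P Δ (.op o e₁ e₂) .bool
  | or {e₁ e₂} : ExprTy P Δ e₁ .bool → ExprTy P Δ e₂ .bool → ExprTy P Δ (.or e₁ e₂) .bool
  | and {e₁ e₂} : ExprTy P Δ e₁ .bool → ExprTy P Δ e₂ .bool → ExprTy P Δ (.and e₁ e₂) .bool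
  | not {e} : ExprTy P Δ e .bool → ExprTy P Δ (.not e) .bool

/-- Arguments match the declared parameters in number and type. -/
def ArgsTy (P : Program) (Δ : TyEnv) (es : List Expr) (params : List (Var × Ty)) : Prop :=
  List.Forall₂ (fun e xT => ExprTy P Δ e xT.2) es params

def FormulaTy (P : Program) (Δ : TyEnv) : Formula → Prop
  | .expr e => ExprTy P Δ e .bool
  | .pred p es => ∃ d, P.preds p = some d ∧ ArgsTy P Δ es d.params
  | .acc e f => ∃ T, ExprTy P Δ (.field e f) T
  | .sep φ₁ φ₂ => FormulaTy P Δ φ₁ ∧ FormulaTy P Δ φ₂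
  | .ite e φ₁ φ₂ => ExprTy P Δ e .bool ∧ FormulaTy P Δ φ₁ ∧ FormulaTy P Δ φ₂

def StmtTy (P : Program) (Δ : TyEnv) : Stmt → Prop
  | .skip => True
  | .assign x e => ∃ T, Δ x = some T ∧ ExprTy P Δ e T
  | .assignField x f e => ∃ T, ExprTy P Δ (.field (.var x) f) T ∧ ExprTy P Δ e T
  | .alloc x S => Δ x = some (.struct S) ∧ ∃ fs, P.structs S = some fs
  | .call y m es => ∃ d, P.methods m = some d ∧ ArgsTy P Δ es d.params ∧ Δ y = some d.ret
  | .assert φ => FormulaTy P Δ φ.body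
  | .ite e s₁ s₂ => ExprTy P Δ e .bool ∧ StmtTy P Δ s₁ ∧ StmtTy P Δ s₂
  | .loop e φ s => ExprTy P Δ e .bool ∧ FormulaTy P Δ φ.body ∧ StmtTy P Δ s
  | .foldPred p es => FormulaTy P Δ (.pred p es)
  | .unfoldPred p es => FormulaTy P Δ (.pred p es)
  | .seq s₁ s₂ => StmtTy P Δ s₁ ∧ StmtTy P Δ s₂

def Expr.fv : Expr → Set Var
  | .lit _ => ∅
  | .var x => {x}
  | .field e _ => e.fv
  | .op _ e₁ e₂ => e₁.fv ∪ e₂.fv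
  | .or e₁ e₂ => e₁.fv ∪ e₂.fv
  | .and e₁ e₂ => e₁.fv ∪ e₂.fv
  | .not e => e.fv

def argsFv (es : List Expr) : Set Var := {x | ∃ e ∈ es, x ∈ e.fv}

def Formula.fv : Formula → Set Var
  | .expr e => e.fv
  | .pred _ es => argsFv es
  | .acc e _ => e.fv
  | .sep φ₁ φ₂ => φ₁.fv ∪ φ₂.fv
  | .ite e φ₁ φ₂ => e.fv ∪ φ₁.fv ∪ φ₂.fv

/-- The variables certainly initialised after a statement that starts with those of `A`. -/
def Stmt.defs (A : Set Var) : Stmt → Set Var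
  | .assign x _ => insert x A
  | .alloc x _ => insert x A
  | .call y _ _ => insert y A
  | .ite _ s₁ s₂ => s₁.defs A ∩ s₂.defs A
  | .seq s₁ s₂ => s₂.defs (s₁.defs A)
  | _ => A

/-- Every variable is initialised before it is used, if those of `A` are at the start. In
particular no variable outside `A` is free in the statement. -/
def Stmt.InitOK (A : Set Var) : Stmt → Prop
  | .skip => True
  | .assign _ e => e.fv ⊆ A
  | .assignField x _ e => x ∈ A ∧ e.fv ⊆ A
  | .alloc _ _ => True
  | .call _ _ es => argsFv es ⊆ A
  | .assert φ => φ.body.fv ⊆ A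
  | .ite e s₁ s₂ => e.fv ⊆ A ∧ s₁.InitOK A ∧ s₂.InitOK A
  | .loop e φ s => e.fv ⊆ A ∧ φ.body.fv ⊆ A ∧ s.InitOK A
  | .foldPred _ es => argsFv es ⊆ A
  | .unfoldPred _ es => argsFv es ⊆ A
  | .seq s₁ s₂ => s₁.InitOK A ∧ s₂.InitOK (s₁.defs A)

/-- The loop invariants of a statement. -/
def Stmt.invariants : Stmt → Set GFormula
  | .ite _ s₁ s₂ => s₁.invariants ∪ s₂.invariants
  | .loop _ φ s => insert φ s.invariants
  | .seq s₁ s₂ => s₁.invariants ∪ s₂.invariants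
  | _ => ∅

def paramTys (params : List (Var × Ty)) : TyEnv :=
  mkEnv (params.map Prod.fst) (params.map Prod.snd)

structure PredDecl.WellFormed (P : Program) (d : PredDecl) : Prop where
  nodup : d.vars.Nodup
  typed : FormulaTy P (paramTys d.params) d.body.body
  spec : Specification P d.body

structure MethodDecl.WellFormed (P : Program) (d : MethodDecl) : Prop where
  nodup : d.vars.Nodup
  result_not_param : Var.result ∉ d.vars
  /-- Formulas in the pre-condition only reference parameters. -/
  pre_fv : ∀ x ∈ d.pre.body.fv, x ∈ d.vars
  /-- Formulas in the post-condition only reference parameters and `result`. -/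
  post_fv : ∀ x ∈ d.post.body.fv, x ∈ d.vars ∨ x = Var.result
  pre_typed : FormulaTy P (paramTys d.params) d.pre.body
  post_typed : FormulaTy P
    (Function.update (paramTys d.params) Var.result (some d.ret)) d.post.body
  body_typed : ∃ Δ : TyEnv, (∀ x ∈ d.vars, Δ x = paramTys d.params x) ∧
    Δ Var.result = some d.ret ∧ StmtTy P Δ d.body
  /-- The free variables of the body are parameters (so `result` is not free). -/
  body_init : d.body.InitOK {x | x ∈ d.vars}
  params_const : ∀ x ∈ d.body.modified, x ∉ d.vars
  pre_spec : Specification P d.pre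
  post_spec : Specification P d.post
  inv_spec : ∀ φ ∈ d.body.invariants, Specification P φ
  imprecise_post : d.pre.imp = true → d.post.imp = true

structure Program.WellFormed (P : Program) : Prop where
  structs : ∀ S fs, P.structs S = some fs → (fs.map Prod.fst).Nodup
  preds : ∀ p d, P.preds p = some d → d.WellFormed P
  methods : ∀ m d, P.methods m = some d → d.WellFormed P
  entry_typed : ∃ Δ : TyEnv, StmtTy P Δ P.entry
  entry_init : P.entry.InitOK ∅
  entry_inv : ∀ φ ∈ P.entry.invariants, Specification P φ

/-! ## Dynamic execution -/

/-- A stack frame: owned permissions, variable environment, remaining statement. -/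
structure Frame where
  α : Set Perm
  ρ : Env
  s : Stmt

abbrev Stack := List Frame

/-- Assignment to one field of the heap. -/
def Heap.set (H : Heap) (l : Loc) (f : FieldName) (v : Value) : Heap :=
  fun l' f' => if l' = l ∧ f' = f then v else H l' f'

/-- Initialisation of the given fields of `l` to their default values. -/
def Heap.init (H : Heap) (l : Loc) (fs : List (FieldName × Ty)) : Heap :=
  fun l' f' => if l' = l then
    match fs.lookup f' with
    | some T => .lit T.default
    | none => H l' f'
  else H l' f'

/-- A location that occurs nowhere in the state. -/
def FreshLoc (H : Heap) (S : Stack) (l : Loc) : Prop :=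
  (∀ l' f, H l' f ≠ .loc l) ∧
  ∀ fr ∈ S, (∀ f, (l, f) ∉ fr.α) ∧ ∀ x, fr.ρ x ≠ some (.loc l)

/-- Small-step execution with exclusion frame `X`. -/
inductive DStep (P : Program) (X : Set Perm) : Heap → Stack → Heap → Stack → Prop where
  | seq {H α ρ s S} :
      DStep P X H (⟨α, ρ, .seq .skip s⟩ :: S) H (⟨α, ρ, s⟩ :: S)
  | assign {H α ρ x e s S v} : Eval H ρ e v → Frm H α ρ e →
      DStep P X H (⟨α, ρ, .seq (.assign x e) s⟩ :: S)
        H (⟨α, Function.update ρ x (some v), s⟩ :: S)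
  | assignField {H α ρ x f e s S l v} : Eval H ρ (.var x) (.loc l) → Eval H ρ e v →
      Assert P H α ρ ⟨false, .acc (.var x) f⟩ → Frm H α ρ e →
      DStep P X H (⟨α, ρ, .seq (.assignField x f e) s⟩ :: S)
        (H.set l f v) (⟨α, ρ, s⟩ :: S)
  | alloc {H α ρ x St s S l fs} :
      FreshLoc H (⟨α, ρ, .seq (.alloc x St) s⟩ :: S) l → P.structs St = some fs →
      DStep P X H (⟨α, ρ, .seq (.alloc x St) s⟩ :: S)
        (H.init l fs)
        (⟨α ∪ {a | a.1 = l ∧ a.2 ∈ fs.map Prod.fst},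
          Function.update ρ x (some (.loc l)), s⟩ :: S)
  | callEnter {H α ρ y m es s S d vs α'} : P.methods m = some d →
      List.Forall₂ (Eval H ρ) es vs → (∀ e ∈ es, Frm H α ρ e) →
      Assert P H (α \ X) (mkEnv d.vars vs) d.pre →
      α' = foot P H (α \ X) (mkEnv d.vars vs) d.pre →
      DStep P X H (⟨α, ρ, .seq (.call y m es) s⟩ :: S)
        H (⟨α', mkEnv d.vars vs, d.body.append .skip⟩ ::
          ⟨α \ α', ρ, .seq (.call y m es) s⟩ :: S)
  | callExit {H α ρ α' ρ' y m es s S d v} : P.methods m = some d →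
      Assert P H α' ρ' d.post → ρ' .result = some v →
      DStep P X H (⟨α', ρ', .skip⟩ :: ⟨α, ρ, .seq (.call y m es) s⟩ :: S)
        H (⟨α ∪ foot P H α' ρ' d.post, Function.update ρ y (some v), s⟩ :: S)
  | assert {H α ρ φ s S} : Assert P H α ρ ⟨true, φ.body⟩ →
      DStep P X H (⟨α, ρ, .seq (.assert φ) s⟩ :: S) H (⟨α, ρ, s⟩ :: S)
  | iteA {H α ρ e s₁ s₂ s S} : Eval H ρ e (.bool true) → Frm H α ρ e →
      DStep P X H (⟨α, ρ, .seq (.ite e s₁ s₂) s⟩ :: S) H (⟨α, ρ, s₁.append s⟩ :: S)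
  | iteB {H α ρ e s₁ s₂ s S} : Eval H ρ e (.bool false) → Frm H α ρ e →
      DStep P X H (⟨α, ρ, .seq (.ite e s₁ s₂) s⟩ :: S) H (⟨α, ρ, s₂.append s⟩ :: S)
  | loopEnter {H α ρ e φ b s S α'} : Eval H ρ e (.bool true) → Frm H α ρ e →
      Assert P H (α \ X) ρ φ → α' = foot P H (α \ X) ρ φ →
      DStep P X H (⟨α, ρ, .seq (.loop e φ b) s⟩ :: S)
        H (⟨α', ρ, b.append .skip⟩ :: ⟨α \ α', ρ, .seq (.loop e φ b) s⟩ :: S)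
  | loopSkip {H α ρ e φ b s S} : Eval H ρ e (.bool false) → Frm H α ρ e →
      Assert P H (α \ X) ρ φ →
      DStep P X H (⟨α, ρ, .seq (.loop e φ b) s⟩ :: S) H (⟨α, ρ, s⟩ :: S)
  | loopFinish {H α ρ α' ρ' e φ b s S} : Assert P H α' ρ' φ →
      DStep P X H (⟨α', ρ', .skip⟩ :: ⟨α, ρ, .seq (.loop e φ b) s⟩ :: S)
        H (⟨α ∪ foot P H α' ρ' φ, ρ', .seq (.loop e φ b) s⟩ :: S)
  | foldPred {H α ρ p es s S} :
      DStep P X H (⟨α, ρ, .seq (.foldPred p es) s⟩ :: S) H (⟨α, ρ, s⟩ :: S)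
  | unfoldPred {H α ρ p es s S} :
      DStep P X H (⟨α, ρ, .seq (.unfoldPred p es) s⟩ :: S) H (⟨α, ρ, s⟩ :: S)

/-- Execution states. -/
inductive DState where
  | init
  | final
  | run (H : Heap) (S : Stack)

/-- The empty heap; no permission to any of its fields exists. -/
def Heap.empty : Heap := fun _ _ => .lit .null

def DState.heap : DState → Heap
  | .run H _ => H
  | _ => Heap.empty

/-- The permissions owned by the top stack frame. -/
def DState.perms : DState → Set Perm
  | .run _ (fr :: _) => fr.α
  | _ => ∅

/-- `DTrans P X Γ Γ'`: the transition from `Γ` to `Γ'` is reachable under the program `P`, using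
the exclusion frame `X`. -/
inductive DTrans (P : Program) : Set Perm → DState → DState → Prop where
  | init {X} : DTrans P X .init (.run Heap.empty [⟨∅, fun _ => none, P.entry.norm⟩])
  | step {X₀ Γ₀ X H S H' S'} : DTrans P X₀ Γ₀ (.run H S) → DStep P X H S H' S' →
      DTrans P X (.run H S) (.run H' S')
  | final {X H α ρ} : DTrans P X (.run H [⟨α, ρ, .skip⟩]) .final

/-! ## Symbolic states -/

/-- Symbolic expressions; symbolic values are natural numbers. -/
inductive SExpr where
  | sv (ν : ℕ)
  | lit (l : Lit)
  | not (t : SExpr)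
  | and (t₁ t₂ : SExpr)
  | or (t₁ t₂ : SExpr)
  | op (o : BinOp) (t₁ t₂ : SExpr)

abbrev SExpr.eq (t₁ t₂ : SExpr) : SExpr := .op .eq t₁ t₂

abbrev SValuation := ℕ → Value

/-- The extension of a valuation to symbolic expressions; undefined if an operand is undefined
or an operator is applied to values of the wrong type. -/
def SExpr.val (V : SValuation) : SExpr → Option Value
  | .sv ν => some (V ν)
  | .lit l => some (.lit l)
  | .not t => (t.val V).map Value.neg
  | .and t₁ t₂ => (t₁.val V).bind fun v₁ => (t₂.val V).map fun v₂ =>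
      .bool (decide (v₁ = .bool true ∧ v₂ = .bool true))
  | .or t₁ t₂ => (t₁.val V).bind fun v₁ => (t₂.val V).map fun v₂ =>
      .bool (decide (v₁ = .bool true ∨ v₂ = .bool true))
  | .op o t₁ t₂ => (t₁.val V).bind fun v₁ => (t₂.val V).bind fun v₂ => o.eval v₁ v₂

/-- Under every valuation for which both are defined, `t₂` is true if `t₁` is. -/
def SImplies (t₁ t₂ : SExpr) : Prop :=
  ∀ (V : SValuation) (v : Value), t₁.val V = some (.bool true) → t₂.val V = some v →
    v = .bool true

def Sat (t : SExpr) : Prop := ∃ V : SValuation, t.val V = some (.bool true)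

/-- A field chunk: the field `f` of the object `t` has the value `v`. -/
structure FChunk where
  f : FieldName
  t : SExpr
  v : SExpr

/-- A heap chunk: a field chunk or a predicate chunk. -/
inductive Chunk where
  | field (c : FChunk)
  | pred (p : PredName) (ts : List SExpr)

/-- Symbolic permissions. -/
inductive SPerm where
  | field (t : SExpr) (f : FieldName)
  | pred (p : PredName) (ts : List SExpr)

def Chunk.perm : Chunk → SPerm
  | .field c => .field c.t c.f
  | .pred p ts => .pred p ts

/-- Run-time checks. -/
inductive Check where
  | expr (t : SExpr)
  | perm (θ : SPerm)
  | sep (Θ₁ Θ₂ : Set SPerm)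
  | bot

abbrev SEnv := Var → Option SExpr

/-- Symbolic states: imprecise flag, path condition, precise heap, optimistic heap, symbolic
environment. -/
structure SState where
  imp : Bool
  g : SExpr
  H : Set Chunk
  O : Set FChunk
  γ : SEnv

def SState.empty (γ : SEnv) : SState := ⟨false, .lit (.bool true), ∅, ∅, γ⟩

/-- Symbolic values that occur in an expression. -/
def SExpr.svals : SExpr → Set ℕ
  | .sv ν => {ν}
  | .lit _ => ∅
  | .not t => t.svals
  | .and t₁ t₂ => t₁.svals ∪ t₂.svals
  | .or t₁ t₂ => t₁.svals ∪ t₂.svals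
  | .op _ t₁ t₂ => t₁.svals ∪ t₂.svals

def FChunk.svals (c : FChunk) : Set ℕ := c.t.svals ∪ c.v.svals

def Chunk.svals : Chunk → Set ℕ
  | .field c => c.svals
  | .pred _ ts => {ν | ∃ t ∈ ts, ν ∈ t.svals}

/-- Symbolic values that occur in a state. -/
def SState.svals (σ : SState) : Set ℕ :=
  σ.g.svals ∪ {ν | ∃ h ∈ σ.H, ν ∈ h.svals} ∪ {ν | ∃ c ∈ σ.O, ν ∈ c.svals} ∪
    {ν | ∃ x t, σ.γ x = some t ∧ ν ∈ t.svals}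

/-! ## Fresh values and corresponding valuations

A symbolic judgement records its fresh symbolic values in the order of their generation, each
with the value that the corresponding valuation gives to it: the current value of a field, or
the value of another symbolic expression. The argument `U` of a judgement holds the symbolic
values that are already in use. -/

inductive Origin where
  | read (t : SExpr) (f : FieldName)
  | copy (t : SExpr)

abbrev Trace := List (ℕ × Origin)

def Trace.names (δ : Trace) : Set ℕ := {ν | ∃ o, (ν, o) ∈ δ}

def Origin.val (H : Heap) (V : SValuation) : Origin → Option Value
  | .read t f => match t.val V with
    | some (.loc l) => some (H l f)
    | _ => none
  | .copy t => t.val V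

/-- The corresponding valuation: `V` extended to the fresh values of a judgement, for the heap
`H`. (Where no field is read, because `t` is not a location, `V` stays unchanged.) -/
def Trace.extend (H : Heap) : Trace → SValuation → SValuation
  | [], V => V
  | (ν, o) :: δ, V => Trace.extend H δ
      (match o.val H V with
        | some v => Function.update V ν v
        | none => V)

/-! ## Symbolic evaluation -/

/-- In the state `σ`, the precise heap holds a chunk for the field `f` of `t`. -/
def SState.InH (σ : SState) (t : SExpr) (f : FieldName) : Prop :=
  ∃ t' v, Chunk.field ⟨f, t', v⟩ ∈ σ.H ∧ SImplies σ.g (.eq t' t)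

/-- In the state `σ`, the optimistic heap holds a chunk for the field `f` of `t`. -/
def SState.InO (σ : SState) (t : SExpr) (f : FieldName) : Prop :=
  ∃ t' v, (⟨f, t', v⟩ : FChunk) ∈ σ.O ∧ SImplies σ.g (.eq t' t)

/-- `SEval U σ e t σ' R δ`: branching evaluation of `e` to `t`, with resulting state `σ'`, run-time
checks `R` and fresh values `δ`. -/
inductive SEval : Set ℕ → SState → Expr → SExpr → SState → Set Check → Trace → Prop where
  | lit {U σ l} : SEval U σ (.lit l) (.lit l) σ ∅ []
  | var {U σ x t} : σ.γ x = some t → SEval U σ (.var x) t σ ∅ []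
  | orA {U σ e₁ e₂ t₁ σ' R δ} : SEval U σ e₁ t₁ σ' R δ →
      SEval U σ (.or e₁ e₂) t₁ { σ' with g := .and σ'.g t₁ } R δ
  | orB {U σ e₁ e₂ t₁ t₂ σ' σ'' R₁ R₂ δ₁ δ₂} : SEval U σ e₁ t₁ σ' R₁ δ₁ →
      SEval (U ∪ δ₁.names) { σ' with g := .and σ'.g (.not t₁) } e₂ t₂ σ'' R₂ δ₂ →
      SEval U σ (.or e₁ e₂) t₂ σ'' (R₁ ∪ R₂) (δ₁ ++ δ₂)
  | andA {U σ e₁ e₂ t₁ σ' R δ} : SEval U σ e₁ t₁ σ' R δ →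
      SEval U σ (.and e₁ e₂) t₁ { σ' with g := .and σ'.g (.not t₁) } R δ
  | andB {U σ e₁ e₂ t₁ t₂ σ' σ'' R₁ R₂ δ₁ δ₂} : SEval U σ e₁ t₁ σ' R₁ δ₁ →
      SEval (U ∪ δ₁.names) { σ' with g := .and σ'.g t₁ } e₂ t₂ σ'' R₂ δ₂ →
      SEval U σ (.and e₁ e₂) t₂ σ'' (R₁ ∪ R₂) (δ₁ ++ δ₂)
  | op {U σ o e₁ e₂ t₁ t₂ σ' σ'' R₁ R₂ δ₁ δ₂} : SEval U σ e₁ t₁ σ' R₁ δ₁ →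
      SEval (U ∪ δ₁.names) σ' e₂ t₂ σ'' R₂ δ₂ →
      SEval U σ (.op o e₁ e₂) (.op o t₁ t₂) σ'' (R₁ ∪ R₂) (δ₁ ++ δ₂)
  | not {U σ e t σ' R δ} : SEval U σ e t σ' R δ → SEval U σ (.not e) (.not t) σ' R δ
  | field {U σ e f tₑ tₑ' t σ' R δ} : SEval U σ e tₑ σ' R δ →
      SImplies σ'.g (.eq tₑ' tₑ) → Chunk.field ⟨f, tₑ', t⟩ ∈ σ'.H →
      SEval U σ (.field e f) t σ' R δ
  | fieldOptimistic {U σ e f tₑ tₑ' t σ' R δ} : SEval U σ e tₑ σ' R δ →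
      ¬ σ'.InH tₑ f → (⟨f, tₑ', t⟩ : FChunk) ∈ σ'.O → SImplies σ'.g (.eq tₑ' tₑ) →
      SEval U σ (.field e f) t σ' R δ
  | fieldImprecise {U σ e f tₑ σ' R δ ν} : σ.imp = true → SEval U σ e tₑ σ' R δ →
      ¬ σ'.InH tₑ f → ¬ σ'.InO tₑ f → ν ∉ U ∪ δ.names →
      SEval U σ (.field e f) (.sv ν) { σ' with O := insert ⟨f, tₑ, .sv ν⟩ σ'.O }
        (insert (.perm (.field tₑ f)) R) (δ ++ [(ν, .read tₑ f)])
  | fieldFailure {U σ e f tₑ σ' R δ ν} : σ.imp = false → SEval U σ e tₑ σ' R δ →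
      ¬ σ'.InH tₑ f → ¬ σ'.InO tₑ f → ν ∉ U ∪ δ.names →
      SEval U σ (.field e f) (.sv ν) σ' {.bot} (δ ++ [(ν, .read tₑ f)])

/-- Evaluation of a list of expressions, from left to right. -/
inductive SEvalList :
    Set ℕ → SState → List Expr → List SExpr → SState → Set Check → Trace → Prop where
  | nil {U σ} : SEvalList U σ [] [] σ ∅ []
  | cons {U σ e es t ts σ' σ'' R R' δ δ'} : SEval U σ e t σ' R δ →
      SEvalList (U ∪ δ.names) σ' es ts σ'' R' δ' →
      SEvalList U σ (e :: es) (t :: ts) σ'' (R ∪ R') (δ ++ δ')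

/-- `SPCEval σ U e t R δ`: deterministic evaluation of `e` to `t` in the state `σ`, which it does
not modify, with run-time checks `R` and fresh values `δ`. -/
inductive SPCEval (σ : SState) : Set ℕ → Expr → SExpr → Set Check → Trace → Prop where
  | lit {U l} : SPCEval σ U (.lit l) (.lit l) ∅ []
  | var {U x t} : σ.γ x = some t → SPCEval σ U (.var x) t ∅ []
  | or {U e₁ e₂ t₁ t₂ R₁ R₂ δ₁ δ₂} : SPCEval σ U e₁ t₁ R₁ δ₁ →
      SPCEval σ (U ∪ δ₁.names) e₂ t₂ R₂ δ₂ →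
      SPCEval σ U (.or e₁ e₂) (.or t₁ t₂) (R₁ ∪ R₂) (δ₁ ++ δ₂)
  | and {U e₁ e₂ t₁ t₂ R₁ R₂ δ₁ δ₂} : SPCEval σ U e₁ t₁ R₁ δ₁ →
      SPCEval σ (U ∪ δ₁.names) e₂ t₂ R₂ δ₂ →
      SPCEval σ U (.and e₁ e₂) (.and t₁ t₂) (R₁ ∪ R₂) (δ₁ ++ δ₂)
  | op {U o e₁ e₂ t₁ t₂ R₁ R₂ δ₁ δ₂} : SPCEval σ U e₁ t₁ R₁ δ₁ →
      SPCEval σ (U ∪ δ₁.names) e₂ t₂ R₂ δ₂ →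
      SPCEval σ U (.op o e₁ e₂) (.op o t₁ t₂) (R₁ ∪ R₂) (δ₁ ++ δ₂)
  | not {U e t R δ} : SPCEval σ U e t R δ → SPCEval σ U (.not e) (.not t) R δ
  | field {U e f tₑ tₑ' t R δ} : SPCEval σ U e tₑ R δ →
      SImplies σ.g (.eq tₑ' tₑ) → Chunk.field ⟨f, tₑ', t⟩ ∈ σ.H →
      SPCEval σ U (.field e f) t R δ
  | fieldOptimistic {U e f tₑ tₑ' t R δ} : SPCEval σ U e tₑ R δ → ¬ σ.InH tₑ f →
      SImplies σ.g (.eq tₑ' tₑ) → (⟨f, tₑ', t⟩ : FChunk) ∈ σ.O →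
      SPCEval σ U (.field e f) t R δ
  | fieldImprecise {U e f tₑ R δ ν} : σ.imp = true → SPCEval σ U e tₑ R δ →
      ¬ σ.InH tₑ f → ¬ σ.InO tₑ f → ν ∉ U ∪ δ.names →
      SPCEval σ U (.field e f) (.sv ν) (insert (.perm (.field tₑ f)) R)
        (δ ++ [(ν, .read tₑ f)])
  | fieldMissing {U e f tₑ R δ ν} : σ.imp = false → SPCEval σ U e tₑ R δ →
      ¬ σ.InH tₑ f → ¬ σ.InO tₑ f → ν ∉ U ∪ δ.names →
      SPCEval σ U (.field e f) (.sv ν) (insert .bot R) (δ ++ [(ν, .read tₑ f)])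

inductive SPCEvalList (σ : SState) :
    Set ℕ → List Expr → List SExpr → Set Check → Trace → Prop where
  | nil {U} : SPCEvalList σ U [] [] ∅ []
  | cons {U e es t ts R R' δ δ'} : SPCEval σ U e t R δ →
      SPCEvalList σ (U ∪ δ.names) es ts R' δ' →
      SPCEvalList σ U (e :: es) (t :: ts) (R ∪ R') (δ ++ δ')

/-! ## Producing and consuming formulas -/

inductive SProduceF : Set ℕ → SState → Formula → SState → Trace → Prop where
  | expr {U σ e t R δ} : SPCEval σ U e t R δ →
      SProduceF U σ (.expr e) { σ with g := .and σ.g t } δ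
  | pred {U σ p es ts R δ} : SPCEvalList σ U es ts R δ →
      SProduceF U σ (.pred p es) { σ with H := insert (.pred p ts) σ.H } δ
  | acc {U σ e f tₑ R δ ν} : SPCEval σ U e tₑ R δ → ν ∉ U ∪ δ.names →
      SProduceF U σ (.acc e f) { σ with H := insert (.field ⟨f, tₑ, .sv ν⟩) σ.H }
        (δ ++ [(ν, .read tₑ f)])
  | sep {U σ φ₁ φ₂ σ' σ'' δ₁ δ₂} : SProduceF U σ φ₁ σ' δ₁ →
      SProduceF (U ∪ δ₁.names) σ' φ₂ σ'' δ₂ →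
      SProduceF U σ (.sep φ₁ φ₂) σ'' (δ₁ ++ δ₂)
  | iteA {U σ e φ₁ φ₂ t R σ' δ₁ δ₂} : SPCEval σ U e t R δ₁ →
      SProduceF (U ∪ δ₁.names) { σ with g := .and σ.g t } φ₁ σ' δ₂ →
      SProduceF U σ (.ite e φ₁ φ₂) σ' (δ₁ ++ δ₂)
  | iteB {U σ e φ₁ φ₂ t R σ' δ₁ δ₂} : SPCEval σ U e t R δ₁ →
      SProduceF (U ∪ δ₁.names) { σ with g := .and σ.g (.not t) } φ₂ σ' δ₂ →
      SProduceF U σ (.ite e φ₁ φ₂) σ' (δ₁ ++ δ₂)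

/-- Producing a gradual formula; an imprecise one makes the state imprecise. -/
inductive SProduce (U : Set ℕ) (σ : SState) : GFormula → SState → Trace → Prop where
  | precise {φ σ' δ} : SProduceF U σ φ σ' δ → SProduce U σ ⟨false, φ⟩ σ' δ
  | imprecise {φ σ' δ} : SProduceF U { σ with imp := true } φ σ' δ →
      SProduce U σ ⟨true, φ⟩ σ' δ

/-- The field `f'` of `t'` possibly coincides with the field `f` of `t`. -/
def Alias (σ : SState) (t : SExpr) (f : FieldName) (t' : SExpr) (f' : FieldName) : Prop :=
  f = f' ∧ (σ.imp = false → SImplies σ.g (.eq t t')) ∧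
    (σ.imp = true → Sat (.and σ.g (.eq t t')))

/-- The field chunks that remain after the removal of the field `f` of `t`. -/
def remF (O : Set FChunk) (σ : SState) (t : SExpr) (f : FieldName) : Set FChunk :=
  {c ∈ O | ¬ Alias σ t f c.t c.f}

/-- The same for a precise heap; all predicate chunks are removed. -/
def remFH (H : Set Chunk) (σ : SState) (t : SExpr) (f : FieldName) : Set Chunk :=
  {h | ∃ c, h = .field c ∧ h ∈ H ∧ ¬ Alias σ t f c.t c.f}

/-- The same for a precise heap; all predicate chunks are kept. -/
def remFP (H : Set Chunk) (σ : SState) (t : SExpr) (f : FieldName) : Set Chunk :=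
  remFH H σ t f ∪ {h | ∃ p ts, h = .pred p ts ∧ h ∈ H}

/-- Componentwise equality of lists of symbolic expressions, implied by `g`. -/
def SImpliesEqs (g : SExpr) (ts ts' : List SExpr) : Prop :=
  List.Forall₂ (fun t t' => SImplies g (.eq t t')) ts ts'

/-- `SConsumeF U σ σE φ σ' R Θ δ`: `φ` is consumed from `σ`, where expressions are evaluated in
`σE`; `Θ` collects the consumed permissions. -/
inductive SConsumeF : Set ℕ → SState → SState → Formula → SState → Set Check → Set SPerm →
    Trace → Prop where
  | value {U σ σE e t R δ} : SPCEval σE U e t R δ → SImplies σ.g t →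
      SConsumeF U σ σE (.expr e) σ R ∅ δ
  | valueImprecise {U σ σE e t R δ} : σ.imp = true → SPCEval σE U e t R δ →
      ¬ SImplies σ.g t →
      SConsumeF U σ σE (.expr e) { σ with g := .and σ.g t } (insert (.expr t) R) ∅ δ
  | valueFailure {U σ σE e t R δ} : σ.imp = false → SPCEval σE U e t R δ →
      ¬ SImplies σ.g t → SConsumeF U σ σE (.expr e) σ {.bot} ∅ δ
  | pred {U σ σE p es ts ts' R δ} : SPCEvalList σE U es ts R δ → SImpliesEqs σ.g ts ts' →
      Chunk.pred p ts' ∈ σ.H →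
      SConsumeF U σ σE (.pred p es) { σ with H := σ.H \ {.pred p ts'}, O := ∅ } R
        {.pred p ts} δ
  | predImprecise {U σ σE p es ts R δ} : σ.imp = true → SPCEvalList σE U es ts R δ →
      (¬ ∃ ts', Chunk.pred p ts' ∈ σ.H ∧ SImpliesEqs σ.g ts ts') →
      SConsumeF U σ σE (.pred p es) { σ with H := ∅, O := ∅ }
        (insert (.perm (.pred p ts)) R) {.pred p ts} δ
  | predFailure {U σ σE p es ts R δ} : σ.imp = false → SPCEvalList σE U es ts R δ →
      (¬ ∃ ts', Chunk.pred p ts' ∈ σ.H ∧ SImpliesEqs σ.g ts ts') →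
      SConsumeF U σ σE (.pred p es) σ {.bot} {.pred p ts} δ
  | acc {U σ σE e f tₑ tₑ' t R δ} : SPCEval σE U e tₑ R δ → SImplies σ.g (.eq tₑ' tₑ) →
      Chunk.field ⟨f, tₑ', t⟩ ∈ σ.H →
      SConsumeF U σ σE (.acc e f)
        { σ with H := remFP σ.H σ tₑ f, O := remF σ.O σ tₑ f } R {.field tₑ f} δ
  | accOptimistic {U σ σE e f tₑ tₑ' t R δ} : SPCEval σE U e tₑ R δ →
      SImplies σ.g (.eq tₑ' tₑ) → ¬ σ.InH tₑ f → (⟨f, tₑ', t⟩ : FChunk) ∈ σ.O →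
      SConsumeF U σ σE (.acc e f)
        { σ with H := remFH σ.H σ tₑ f, O := remF σ.O σ tₑ f } R {.field tₑ f} δ
  | accImprecise {U σ σE e f tₑ R δ} : σ.imp = true → SPCEval σE U e tₑ R δ →
      ¬ σ.InH tₑ f → ¬ σ.InO tₑ f →
      SConsumeF U σ σE (.acc e f)
        { σ with H := remFH σ.H σ tₑ f, O := remF σ.O σ tₑ f }
        (insert (.perm (.field tₑ f)) R) {.field tₑ f} δ
  | accFailure {U σ σE e f tₑ R δ} : σ.imp = false → SPCEval σE U e tₑ R δ →
      ¬ σ.InH tₑ f → ¬ σ.InO tₑ f →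
      SConsumeF U σ σE (.acc e f) σ {.bot} {.field tₑ f} δ
  | sep {U σ σE φ₁ φ₂ σ' σ'' R₁ R₂ Θ₁ Θ₂ δ₁ δ₂} :
      SConsumeF U σ σE φ₁ σ' R₁ Θ₁ δ₁ →
      SConsumeF (U ∪ δ₁.names) σ' { σE with g := σ'.g } φ₂ σ'' R₂ Θ₂ δ₂ →
      (∀ θ, Check.perm θ ∉ R₁ ∪ R₂) →
      SConsumeF U σ σE (.sep φ₁ φ₂) σ'' (R₁ ∪ R₂) (Θ₁ ∪ Θ₂) (δ₁ ++ δ₂)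
  | sepImprecise {U σ σE φ₁ φ₂ σ' σ'' R₁ R₂ Θ₁ Θ₂ δ₁ δ₂} :
      SConsumeF U σ σE φ₁ σ' R₁ Θ₁ δ₁ →
      SConsumeF (U ∪ δ₁.names) σ' { σE with g := σ'.g } φ₂ σ'' R₂ Θ₂ δ₂ →
      (∃ θ, Check.perm θ ∈ R₁ ∪ R₂) →
      SConsumeF U σ σE (.sep φ₁ φ₂) σ'' (insert (.sep Θ₁ Θ₂) (R₁ ∪ R₂)) (Θ₁ ∪ Θ₂)
        (δ₁ ++ δ₂)
  | iteA {U σ σE e φ₁ φ₂ t R σ' R' Θ δ₁ δ₂} : SPCEval σE U e t R δ₁ →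
      SConsumeF (U ∪ δ₁.names) { σ with g := .and σ.g t } { σE with g := .and σ.g t }
        φ₁ σ' R' Θ δ₂ →
      SConsumeF U σ σE (.ite e φ₁ φ₂) σ' (R ∪ R') Θ (δ₁ ++ δ₂)
  | iteB {U σ σE e φ₁ φ₂ t R σ' R' Θ δ₁ δ₂} : SPCEval σE U e t R δ₁ →
      SConsumeF (U ∪ δ₁.names) { σ with g := .and σ.g (.not t) }
        { σE with g := .and σ.g (.not t) } φ₂ σ' R' Θ δ₂ →
      SConsumeF U σ σE (.ite e φ₁ φ₂) σ' (R ∪ R') Θ (δ₁ ++ δ₂)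

/-- Consuming a gradual formula from a state. An imprecise formula is evaluated as in an imprecise
state, and leaves an imprecise state with empty heaps. -/
inductive SConsume (U : Set ℕ) (σ : SState) :
    GFormula → SState → Set Check → Trace → Prop where
  | precise {φ σ' R Θ δ} : SConsumeF U σ σ φ σ' R Θ δ → SConsume U σ ⟨false, φ⟩ σ' R δ
  | imprecise {φ σ' R Θ δ} : SConsumeF U σ { σ with imp := true } φ σ' R Θ δ →
      SConsume U σ ⟨true, φ⟩ ⟨true, σ'.g, ∅, ∅, σ'.γ⟩ R δ

/-! ## Symbolic execution and verification states -/

/-- Replacement of the given variables, where they are defined, by fresh symbolic values. -/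
inductive Havoc : Set ℕ → SEnv → List Var → SEnv → Trace → Prop where
  | nil {U γ} : Havoc U γ [] γ []
  | undef {U γ x xs γ' δ} : γ x = none → Havoc U γ xs γ' δ → Havoc U γ (x :: xs) γ' δ
  | cons {U γ x xs t ν γ' δ} : γ x = some t → ν ∉ U →
      Havoc (insert ν U) (Function.update γ x (some (.sv ν))) xs γ' δ →
      Havoc U γ (x :: xs) γ' ((ν, .copy t) :: δ)

/-- `SExec P σ s s' σ'`: one step of symbolic execution. Fresh values are those that do not occur
in `σ` and were not generated before in the same step. -/
inductive SExec (P : Program) (σ : SState) : Stmt → Stmt → SState → Prop where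
  | seq {s} : SExec P σ (.seq .skip s) s σ
  | assign {x e s t σ' R δ} : SEval σ.svals σ e t σ' R δ →
      SExec P σ (.seq (.assign x e) s) s { σ' with γ := Function.update σ.γ x (some t) }
  | assignField {x f e s t σ' R δ σ'' R' δ' tₓ} : SEval σ.svals σ e t σ' R δ →
      SConsume (σ.svals ∪ δ.names) σ' ⟨false, .acc (.var x) f⟩ σ'' R' δ' →
      σ''.γ x = some tₓ →
      SExec P σ (.seq (.assignField x f e) s) s
        { σ'' with H := insert (.field ⟨f, tₓ, t⟩) σ''.H }
  | alloc {x S s ν fs} : ν ∉ σ.svals → P.structs S = some fs →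
      SExec P σ (.seq (.alloc x S) s) s
        { σ with
          H := σ.H ∪ {h | ∃ fT ∈ fs, h = .field ⟨fT.1, .sv ν, .lit fT.2.default⟩}
          γ := Function.update σ.γ x (some (.sv ν)) }
  | call {y m es s d ts σ₁ R₁ δ₁ σ₂ R₂ δ₂ ν σ₃ δ₃} : P.methods m = some d →
      SEvalList σ.svals σ es ts σ₁ R₁ δ₁ →
      SConsume (σ.svals ∪ δ₁.names) { σ₁ with γ := mkEnv d.vars ts } d.pre σ₂ R₂ δ₂ →
      ν ∉ σ.svals ∪ δ₁.names ∪ δ₂.names →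
      SProduce (insert ν (σ.svals ∪ δ₁.names ∪ δ₂.names))
        { σ₂ with γ := Function.update (mkEnv d.vars ts) .result (some (.sv ν)) } d.post
        σ₃ δ₃ →
      SExec P σ (.seq (.call y m es) s) s
        { σ₃ with γ := Function.update σ.γ y (some (.sv ν)) }
  | assert {φ s σ' R δ σ'' δ'} : SConsume σ.svals σ ⟨true, φ.body⟩ σ' R δ →
      SProduce (σ.svals ∪ δ.names) σ' ⟨true, φ.body⟩ σ'' δ' →
      SExec P σ (.seq (.assert φ) s) s { σ with g := σ''.g }
  | foldPred {p es s d ts σ₁ R₁ δ₁ σ₂ R₂ δ₂} : P.preds p = some d →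
      SEvalList σ.svals σ es ts σ₁ R₁ δ₁ →
      SConsume (σ.svals ∪ δ₁.names) { σ₁ with γ := mkEnv d.vars ts } d.body σ₂ R₂ δ₂ →
      SExec P σ (.seq (.foldPred p es) s) s
        { σ₂ with H := insert (.pred p ts) σ₂.H, γ := σ.γ }
  | unfoldPred {p es s d ts σ₁ R₁ δ₁ σ₂ R₂ δ₂ σ₃ δ₃} : P.preds p = some d →
      SEvalList σ.svals σ es ts σ₁ R₁ δ₁ →
      SConsume (σ.svals ∪ δ₁.names) σ₁ ⟨false, .pred p es⟩ σ₂ R₂ δ₂ →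
      SProduce (σ.svals ∪ δ₁.names ∪ δ₂.names) { σ₂ with γ := mkEnv d.vars ts } d.body
        σ₃ δ₃ →
      SExec P σ (.seq (.unfoldPred p es) s) s { σ₃ with γ := σ.γ }
  | iteA {e s₁ s₂ s t σ' R δ} : SEval σ.svals σ e t σ' R δ →
      SExec P σ (.seq (.ite e s₁ s₂) s) (s₁.append s) { σ' with g := .and σ'.g t }
  | iteB {e s₁ s₂ s t σ' R δ} : SEval σ.svals σ e t σ' R δ →
      SExec P σ (.seq (.ite e s₁ s₂) s) (s₂.append s) { σ' with g := .and σ'.g (.not t) }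
  | loopSkip {e φ b s σ' R δ₁ γ' δ₂ σ'' δ₃ t R' δ₄} : SConsume σ.svals σ φ σ' R δ₁ →
      Havoc (σ.svals ∪ δ₁.names) σ'.γ b.modified γ' δ₂ →
      SProduce (σ.svals ∪ δ₁.names ∪ δ₂.names) { σ' with γ := γ' } φ σ'' δ₃ →
      SPCEval σ'' (σ.svals ∪ δ₁.names ∪ δ₂.names ∪ δ₃.names) e t R' δ₄ →
      SExec P σ (.seq (.loop e φ b) s) s { σ'' with g := .and σ''.g (.not t) }

/-- Verification states: a symbolic state, the remaining statement and the post-condition. -/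
inductive VState where
  | init
  | final
  | run (σ : SState) (s : Stmt) (φ : GFormula)

/-- Reachable verification transitions of modular verification. -/
inductive VTrans (P : Program) : VState → VState → Prop where
  | init : VTrans P .init
      (.run (SState.empty fun _ => none) P.entry.norm ⟨false, .expr (.lit (.bool true))⟩)
  | method {m d} {νs : List ℕ} {σ δ} : P.methods m = some d → νs.Nodup → νs.length = d.vars.length →
      SProduce {ν | ν ∈ νs} (SState.empty (mkEnv d.vars (νs.map SExpr.sv))) d.pre σ δ →
      VTrans P .init (.run σ (d.body.append .skip) d.post)
  | loopBody {Sg σ₀ e φ b s φ₀ γ' δ₁ σ₀' δ₂ t R δ₃} :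
      VTrans P Sg (.run σ₀ (.seq (.loop e φ b) s) φ₀) →
      Havoc σ₀.svals σ₀.γ b.modified γ' δ₁ →
      SProduce (σ₀.svals ∪ δ₁.names) ⟨false, σ₀.g, ∅, ∅, γ'⟩ φ σ₀' δ₂ →
      SPCEval σ₀' (σ₀.svals ∪ δ₁.names ∪ δ₂.names) e t R δ₃ →
      VTrans P (.run σ₀ (.seq (.loop e φ b) s) φ₀)
        (.run { σ₀' with g := .and σ₀'.g t } (b.append .skip) φ)
  | loop {Sg σ e φ b s φ₀ σ' R δ₁ γ' δ₂ σ'' δ₃} :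
      VTrans P Sg (.run σ (.seq (.loop e φ b) s) φ₀) →
      SConsume σ.svals σ φ σ' R δ₁ →
      Havoc (σ.svals ∪ δ₁.names) σ'.γ b.modified γ' δ₂ →
      SProduce (σ.svals ∪ δ₁.names ∪ δ₂.names) { σ' with γ := γ' } φ σ'' δ₃ →
      VTrans P (.run σ (.seq (.loop e φ b) s) φ₀) (.run σ'' (.seq (.loop e φ b) s) φ₀)
  | step {Sg σ s φ s' σ'} : VTrans P Sg (.run σ s φ) → SExec P σ s s' σ' →
      VTrans P (.run σ s φ) (.run σ' s' φ)
  | final {Sg σ φ σ' R δ} : VTrans P Sg (.run σ .skip φ) → SConsume σ.svals σ φ σ' R δ →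
      VTrans P (.run σ .skip φ) .final

def VReachable (P : Program) (Sg : VState) : Prop :=
  Sg = .init ∨ ∃ Sg₀, VTrans P Sg₀ Sg

/-! ## Guards -/

/-- The symbolic permissions that remain in `σ`, if `φ` is not completely precise. -/
def remPerms (P : Program) (σ : SState) (φ : GFormula) : Set SPerm :=
  {θ | ¬ CompletelyPrecise P φ ∧
    ((∃ h ∈ σ.H, θ = h.perm) ∨ ∃ c ∈ σ.O, θ = .field c.t c.f)}

/-- `Guard P Sg σ' R Θ δ`: before the next execution step from `Sg` the run-time checks `R` must
hold; `σ'` is the intermediate state, `Θ` the symbolic exclusion frame, and `δ` holds the fresh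
values of the derivation. -/
inductive Guard (P : Program) : VState → SState → Set Check → Set SPerm → Trace → Prop where
  | init : Guard P .init (SState.empty fun _ => none) ∅ ∅ []
  | seq {σ s φ} : Guard P (.run σ (.seq .skip s) φ) σ ∅ ∅ []
  | assign {σ x e s φ t σ' R δ} : SEval σ.svals σ e t σ' R δ →
      Guard P (.run σ (.seq (.assign x e) s) φ) σ' R ∅ δ
  | assignField {σ x f e s φ t σ' R δ σ'' R' δ'} : SEval σ.svals σ e t σ' R δ →
      SConsume (σ.svals ∪ δ.names) σ' ⟨false, .acc (.var x) f⟩ σ'' R' δ' →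
      Guard P (.run σ (.seq (.assignField x f e) s) φ) σ'' (R ∪ R') ∅ (δ ++ δ')
  | alloc {σ x S s φ} : Guard P (.run σ (.seq (.alloc x S) s) φ) σ ∅ ∅ []
  | call {σ y m es s φ d ts σ₁ R₁ δ₁ σ₂ R₂ δ₂} : P.methods m = some d →
      SEvalList σ.svals σ es ts σ₁ R₁ δ₁ →
      SConsume (σ.svals ∪ δ₁.names) { σ₁ with γ := mkEnv d.vars ts } d.pre σ₂ R₂ δ₂ →
      Guard P (.run σ (.seq (.call y m es) s) φ) { σ₂ with γ := σ.γ } (R₁ ∪ R₂)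
        (remPerms P σ₂ d.pre) (δ₁ ++ δ₂)
  | assert {σ ψ s φ σ' R δ} : SConsume σ.svals σ ⟨true, ψ.body⟩ σ' R δ →
      Guard P (.run σ (.seq (.assert ψ) s) φ) σ' R ∅ δ
  | foldPred {σ p es s φ d ts σ₁ R₁ δ₁ σ₂ R₂ δ₂} : P.preds p = some d →
      SEvalList σ.svals σ es ts σ₁ R₁ δ₁ →
      SConsume (σ.svals ∪ δ₁.names) { σ₁ with γ := mkEnv d.vars ts } d.body σ₂ R₂ δ₂ →
      Guard P (.run σ (.seq (.foldPred p es) s) φ) { σ₂ with γ := σ.γ } (R₁ ∪ R₂) ∅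
        (δ₁ ++ δ₂)
  | unfoldPred {σ p es s φ ts σ₁ R₁ δ₁ σ₂ R₂ δ₂} : SEvalList σ.svals σ es ts σ₁ R₁ δ₁ →
      SConsume (σ.svals ∪ δ₁.names) σ₁ ⟨false, .pred p es⟩ σ₂ R₂ δ₂ →
      Guard P (.run σ (.seq (.unfoldPred p es) s) φ) σ₂ (R₁ ∪ R₂) ∅ (δ₁ ++ δ₂)
  | ite {σ e s₁ s₂ s φ t σ' R δ} : SEval σ.svals σ e t σ' R δ →
      Guard P (.run σ (.seq (.ite e s₁ s₂) s) φ) σ' R ∅ δ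
  | loop {σ e ψ b s φ σ' R δ₁ γ' δ₂ σ'' δ₃ t R' δ₄} : SConsume σ.svals σ ψ σ' R δ₁ →
      Havoc (σ.svals ∪ δ₁.names) σ'.γ b.modified γ' δ₂ →
      SProduce (σ.svals ∪ δ₁.names ∪ δ₂.names) { σ' with γ := γ' } ψ σ'' δ₃ →
      SPCEval σ'' (σ.svals ∪ δ₁.names ∪ δ₂.names ∪ δ₃.names) e t R' δ₄ →
      Guard P (.run σ (.seq (.loop e ψ b) s) φ) { σ' with g := σ''.g } (R ∪ R')
        (remPerms P σ' ψ) (δ₁ ++ δ₂ ++ δ₃ ++ δ₄)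
  | finish {σ φ σ' R δ} : SConsume σ.svals σ φ σ' R δ →
      Guard P (.run σ .skip φ) σ' R ∅ δ

/-! ## Correspondence and valid states -/

/-- The values of a list of symbolic expressions. -/
def SVals (V : SValuation) (ts : List SExpr) (vs : List Value) : Prop :=
  List.Forall₂ (fun t v => t.val V = some v) ts vs

/-- The footprint of a symbolic permission. -/
def vfoot (P : Program) (V : SValuation) (H : Heap) : SPerm → Set Perm
  | .field t f => {a | t.val V = some (.loc a.1) ∧ a.2 = f}
  | .pred p ts => {a | ∃ d vs, P.preds p = some d ∧ SVals V ts vs ∧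
      a ∈ efoot P H (mkEnv d.vars vs) d.body}

/-- The footprint of a set of symbolic permissions. -/
def vfootSet (P : Program) (V : SValuation) (H : Heap) (Θ : Set SPerm) : Set Perm :=
  {a | ∃ θ ∈ Θ, a ∈ vfoot P V H θ}

/-- The predicate `p` with the given symbolic arguments holds. -/
def PredHolds (P : Program) (V : SValuation) (H : Heap) (α : Set Perm) (p : PredName)
    (ts : List SExpr) : Prop :=
  ∃ d vs, P.preds p = some d ∧ SVals V ts vs ∧ Assert P H α (mkEnv d.vars vs) d.body

/-- The run-time check holds. -/
def Check.Holds (P : Program) (V : SValuation) (H : Heap) (α : Set Perm) : Check → Prop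
  | .expr t => t.val V = some (.bool true)
  | .perm (.field t f) => ∃ l, t.val V = some (.loc l) ∧ (l, f) ∈ α
  | .perm (.pred p ts) => PredHolds P V H α p ts
  | .sep Θ₁ Θ₂ => vfootSet P V H Θ₁ ∩ vfootSet P V H Θ₂ = ∅
  | .bot => False

/-- The field chunk agrees with the heap, and its field is owned. -/
def FChunk.Holds (V : SValuation) (H : Heap) (α : Set Perm) (c : FChunk) : Prop :=
  ∃ l, c.t.val V = some (.loc l) ∧ c.v.val V = some (H l c.f) ∧ (l, c.f) ∈ α

/-- Correspondence between a symbolic state and a run-time state. -/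
structure SimState (P : Program) (V : SValuation) (σ : SState) (H : Heap) (α : Set Perm)
    (ρ : Env) : Prop where
  field : ∀ c, Chunk.field c ∈ σ.H → c.Holds V H α
  pred : ∀ p ts, Chunk.pred p ts ∈ σ.H → PredHolds P V H α p ts
  disjoint : ∀ h₁ ∈ σ.H, ∀ h₂ ∈ σ.H, h₁ ≠ h₂ →
    vfoot P V H h₁.perm ∩ vfoot P V H h₂.perm = ∅
  optimistic : ∀ c ∈ σ.O, c.Holds V H α
  env : ∀ x t, σ.γ x = some t → ∃ v, t.val V = some v ∧ ρ x = some v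
  path : σ.g.val V = some (.bool true)

/-- `PartialValid P H S Sg V`: the partial state formed by the heap `H` and the stack `S`, below a
frame that is verified by `Sg` with valuation `V`, is validated. -/
inductive PartialValid (P : Program) (H : Heap) : Stack → VState → SValuation → Prop where
  | nil {Sg V} : PartialValid P H [] Sg V
  | call {α ρ y m es s S σ sS V d σ₀ φ₀ V' ts σ₁ R₁ δ₁ σ' R₂ δ₂} :
      P.methods m = some d →
      PartialValid P H S (.run σ₀ (.seq (.call y m es) s) φ₀) V' →
      VReachable P (.run σ₀ (.seq (.call y m es) s) φ₀) →
      SEvalList σ₀.svals σ₀ es ts σ₁ R₁ δ₁ →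
      List.Forall₂ (fun x t => ∃ tₓ v, σ.γ x = some tₓ ∧ tₓ.val V = some v ∧
        t.val V' = some v) d.vars ts →
      SConsume (σ₀.svals ∪ δ₁.names) { σ₁ with γ := mkEnv d.vars ts } d.pre σ' R₂ δ₂ →
      SimState P V' { σ' with γ := σ₀.γ } H α ρ →
      PartialValid P H (⟨α, ρ, .seq (.call y m es) s⟩ :: S) (.run σ sS d.post) V
  | loop {α ρ e φ b s S σ sS V σ₀ φ₀ V' σ' R δ} :
      PartialValid P H S (.run σ₀ (.seq (.loop e φ b) s) φ₀) V' →
      VReachable P (.run σ₀ (.seq (.loop e φ b) s) φ₀) →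
      SConsume σ₀.svals σ₀ φ σ' R δ →
      SimState P V' σ' H α ρ →
      PartialValid P H (⟨α, ρ, .seq (.loop e φ b) s⟩ :: S) (.run σ sS φ) V

/-- A verification state corresponds, with valuation `V`, to an execution state. -/
def Corresponds (P : Program) (V : SValuation) : VState → DState → Prop
  | .init, .init => True
  | .final, .final => True
  | .run σ s _, .run H (fr :: _) => s = fr.s ∧ SimState P V σ H fr.α fr.ρ
  | _, _ => False

/-- The execution state `Γ` is validated by the verification state `Sg` and the valuation `V`. -/
structure Validated (P : Program) (Γ : DState) (Sg : VState) (V : SValuation) : Prop where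
  reachable : VReachable P Sg
  corresponds : Corresponds P V Sg Γ
  partialValid : ∀ H fr S, Γ = .run H (fr :: S) → PartialValid P H S Sg V

def ValidState (P : Program) (Γ : DState) : Prop :=
  ∃ Sg V, Validated P Γ Sg V

end GradualC0

open GradualC0

namespace GradualC0

/-! ## Evaluation, framing and footprints -/

/-! The execution step is matched by a transition between verification states: a step of symbolic
execution, the start of the verification of a method or loop body, or the return to a loop head. The
guard derivation already contains the evaluations and consumptions needed. What remains to be found
are the produced formulas, the branch of a conditional, and the fresh symbolic values with a
valuation for them. The run-time state dictates all these choices: branches follow the actual truth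
values, and a fresh value stands for the actual content of a field or variable.

Soundness of what the guard supplies: if the path condition and the run-time checks hold, symbolic
evaluation yields the run-time value (`SPCEval.sound`, `SEval.sound`). A consumed specification is
valid, and its exact footprint is disjoint from the footprints of the remaining chunks
(`SConsumeF.sound`, `SConsume.sound`). For a separating conjunction the disjointness of the two
parts comes either from the chunks, when no permission was checked at run time, or from the
separation check.

Completeness along the actual execution: a formula that is valid in permissions disjoint from those
of the chunks can be produced, with a valuation under which the result corresponds to the run-time
state (`SPCEval.exists`, `SProduce.exists`, `Havoc.exists`). Checks that arise in production are
discarded, so they need not hold.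

A frame property connects the two: correspondence depends on the heap only at owned fields
(`SimState.heap`), and on the permissions only through the footprints of the chunks
(`SimState.restrict`). Both rest on predicate bodies being imprecise or self-framed, by which a
valid body owns its exact footprint (`Assert.efoot_subset`). Consequently a caller, or a frame that
enters a loop, still corresponds to its consumed state after handing over permissions
(`SConsume.sound_diff_foot`). For a specification that is not completely precise this is exactly
what the exclusion frame achieves: it holds back the footprints of the remaining chunks.

Two invariants of reachable states are needed. `ExecInv` says that execution states are well typed,
so that the partial symbolic operators are defined where they are used, and that distinct frames own
disjoint permissions, so that the top frame cannot disturb those below. `VerifInv` provides fresh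
symbolic values, the absence of optimistic chunks in precise states, and a symbolic value for every
variable that is used. -/

theorem Eval.det {H : Heap} {ρ : Env} {e : Expr} {v w : Value} (h : Eval H ρ e v)
    (h' : Eval H ρ e w) : v = w := by
  induction h generalizing w with
  | lit l => cases h'; rfl
  | var h => cases h' with | var h' => rw [h] at h'; exact Option.some.inj h'
  | andA _ ih =>
    cases h' with
    | andA _ => rfl
    | andB h1 _ => cases ih h1
  | andB _ _ ih1 ih2 =>
    cases h' with
    | andA h1 => cases ih1 h1
    | andB _ h2 => exact ih2 h2
  | orA _ ih =>
    cases h' with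
    | orA _ => rfl
    | orB h1 _ => cases ih h1
  | orB _ _ ih1 ih2 =>
    cases h' with
    | orA h1 => cases ih1 h1
    | orB _ h2 => exact ih2 h2
  | op _ _ h3 ih1 ih2 =>
    cases h' with
    | op h1 h2 h3' => rw [ih1 h1, ih2 h2, h3'] at h3; exact (Option.some.inj h3).symm
  | not _ ih => cases h' with | not h1 => rw [ih h1]
  | field _ ih => cases h' with | field h1 => cases ih h1; rfl

theorem Eval.det_list {H : Heap} {ρ : Env} {es : List Expr} {vs ws : List Value}
    (h : List.Forall₂ (Eval H ρ) es vs) (h' : List.Forall₂ (Eval H ρ) es ws) : vs = ws := by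
  induction h generalizing ws with
  | nil => cases h'; rfl
  | cons h _ ih => cases h' with | cons h1 h2 => rw [h.det h1, ih h2]

/-- Framing consults the permissions only at fields that the expression reads, and these are in its
exact footprint. All other permissions may be dropped. -/
theorem Frm.restrict {H : Heap} {α β : Set Perm} {ρ : Env} {e : Expr} (h : Frm H α ρ e)
    (hβ : ∀ a ∈ α, EFootE H ρ e a → a ∈ β) : Frm H β ρ e := by
  induction h with
  | lit l => exact .lit l
  | var x => exact .var x
  | field _ h2 h3 ih =>
    exact .field (ih fun a ha h => hβ a ha (.fieldSub h)) h2 (hβ _ h3 (.field h2))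
  | op _ _ ih1 ih2 =>
    exact .op (ih1 fun a ha h => hβ a ha (.op₁ h)) (ih2 fun a ha h => hβ a ha (.op₂ h))
  | orA h _ ih => exact .orA h (ih fun a ha h => hβ a ha (.or₁ h))
  | orB h _ _ ih1 ih2 =>
    exact .orB h (ih1 fun a ha h => hβ a ha (.or₁ h)) (ih2 fun a ha h' => hβ a ha (.or₂ h h'))
  | andA h _ ih => exact .andA h (ih fun a ha h => hβ a ha (.and₁ h))
  | andB h _ _ ih1 ih2 =>
    exact .andB h (ih1 fun a ha h => hβ a ha (.and₁ h)) (ih2 fun a ha h' => hβ a ha (.and₂ h h'))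
  | not _ ih => exact .not (ih fun a ha h => hβ a ha (.not h))

theorem EFrm.restrict {P : Program} {H : Heap} {α β : Set Perm} {ρ : Env} {φ : Formula}
    (h : EFrm P H α ρ φ) (hβ : ∀ a ∈ α, EFoot P H ρ φ a → a ∈ β) : EFrm P H β ρ φ := by
  induction h with
  | expr h => exact .expr (h.restrict fun a ha h => hβ a ha (.expr h))
  | sep _ _ ih1 ih2 =>
    exact .sep (ih1 fun a ha h => hβ a ha (.sep₁ h)) (ih2 fun a ha h => hβ a ha (.sep₂ h))
  | pred h1 h2 h3 _ ih =>
    exact .pred h1 (fun e he => (h2 e he).restrict fun a ha h => hβ a ha (.predArg he h)) h3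
      (ih fun a ha h => hβ a ha (.predBody h1 h3 h))
  | iteA h1 h2 _ ih =>
    exact .iteA h1 (h2.restrict fun a ha h => hβ a ha (.iteCond h))
      (ih fun a ha h => hβ a ha (.iteA h1 h))
  | iteB h1 h2 _ ih =>
    exact .iteB h1 (h2.restrict fun a ha h => hβ a ha (.iteCond h))
      (ih fun a ha h => hβ a ha (.iteB h1 h))
  | acc h => exact .acc (h.restrict fun a ha h => hβ a ha (.accSub h))

/-- Permissions matter to validity only at accessibility predicates and in the framing of imprecise
formulas, and both stay within the exact footprint. This makes it sufficient to hand over just the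
exact footprint of a specification. -/
theorem Assert.restrict {P : Program} {H : Heap} {α β : Set Perm} {ρ : Env} {φ : GFormula}
    (h : Assert P H α ρ φ) (hβ : ∀ a ∈ α, EFoot P H ρ φ.body a → a ∈ β) :
    Assert P H β ρ φ := by
  induction h generalizing β with
  | imprecise _ h2 ih => exact .imprecise (ih hβ) (h2.restrict hβ)
  | value h => exact .value h
  | iteA h1 _ ih => exact .iteA h1 (ih fun a ha h => hβ a ha (.iteA h1 h))
  | iteB h1 _ ih => exact .iteB h1 (ih fun a ha h => hβ a ha (.iteB h1 h))
  | acc h1 h2 => exact .acc h1 (hβ _ h2 (.acc h1))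
  | @sep α α₁ α₂ ρ φ₁ φ₂ _ _ h3 h4 ih1 ih2 =>
    -- The given split has to be cut down to the footprints of the conjuncts, since only there do
    -- its permissions belong to `β`.
    refine .sep (α₁ := {a ∈ α₁ | EFoot P H ρ φ₁ a}) (α₂ := {a ∈ α₂ | EFoot P H ρ φ₂ a})
      (ih1 fun a ha h => ⟨ha, h⟩) (ih2 fun a ha h => ⟨ha, h⟩) ?_ ?_
    · rintro a (⟨ha, h⟩ | ⟨ha, h⟩)
      · exact hβ a (h3 (.inl ha)) (.sep₁ h)
      · exact hβ a (h3 (.inr ha)) (.sep₂ h)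
    · ext a
      simp only [Set.mem_inter_iff, Set.mem_ofPred_eq, Set.mem_empty_iff_false, iff_false]
      rintro ⟨⟨h, _⟩, ⟨h', _⟩⟩
      exact (h4 ▸ Set.mem_inter h h' : a ∈ (∅ : Set Perm))
  | pred h1 h2 _ ih => exact .pred h1 h2 (ih fun a ha h => hβ a ha (.predBody h1 h2 h))

theorem EFrm.mono {P : Program} {H : Heap} {α β : Set Perm} {ρ : Env} {φ : Formula}
    (h : EFrm P H α ρ φ) (hβ : α ⊆ β) : EFrm P H β ρ φ := h.restrict fun _ ha _ => hβ ha

theorem Assert.mono {P : Program} {H : Heap} {α β : Set Perm} {ρ : Env} {φ : GFormula}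
    (h : Assert P H α ρ φ) (hβ : α ⊆ β) : Assert P H β ρ φ := h.restrict fun _ ha _ => hβ ha

/-! ### Valid specifications own their exact footprint -/

theorem Frm.efootE_subset {H : Heap} {α : Set Perm} {ρ : Env} {e : Expr} (h : Frm H α ρ e)
    {a : Perm} (ha : EFootE H ρ e a) : a ∈ α := by
  induction ha with
  | fieldSub _ ih => cases h with | field h1 _ _ => exact ih h1
  | field he => cases h with | field _ h2 h3 => cases he.det h2; exact h3
  | op₁ _ ih => cases h with | op h1 _ => exact ih h1
  | op₂ _ ih => cases h with | op _ h2 => exact ih h2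
  | or₁ _ ih => cases h with
    | orA _ h => exact ih h
    | orB _ h _ => exact ih h
  | or₂ he _ ih => cases h with
    | orA h' _ => cases he.det h'
    | orB _ _ h => exact ih h
  | and₁ _ ih => cases h with
    | andA _ h => exact ih h
    | andB _ h _ => exact ih h
  | and₂ he _ ih => cases h with
    | andA h' _ => cases he.det h'
    | andB _ _ h => exact ih h
  | not _ ih => cases h with | not h => exact ih h

/-- Predicate bodies are specifications. -/
def Program.PredSpecs (P : Program) : Prop := ∀ p d, P.preds p = some d → Specification P d.body

/-- Iso-recursive framing stops at a predicate, but there validity supplies the framing of the body: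
an imprecise body carries equi-recursive framing in its validity derivation, and a precise one is
self-framed. The larger set `β` is needed because a conjunct may read fields whose permissions
belong to the other conjunct. -/
theorem Assert.efrm_of_iFrm {P : Program} (hP : P.PredSpecs) {H : Heap} {α β : Set Perm}
    {ρ : Env} {φ : GFormula} (h : Assert P H α ρ φ) (hβ : α ⊆ β)
    (hφ : φ.imp = true ∨ IFrm H β ρ φ.body) : EFrm P H β ρ φ.body := by
  induction h generalizing β with
  | imprecise _ h2 ih => exact h2.mono hβ
  | value h =>
    cases hφ with
    | inl h => cases h
    | inr h => cases h with | expr h => exact .expr h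
  | iteA h1 _ ih =>
    cases hφ with
    | inl h => cases h
    | inr h => cases h with
      | iteA h1 h2 h3 => exact .iteA h1 h2 (ih hβ (.inr h3))
      | iteB h1' => cases h1.det h1'
  | iteB h1 _ ih =>
    cases hφ with
    | inl h => cases h
    | inr h => cases h with
      | iteA h1' => cases h1.det h1'
      | iteB h1 h2 h3 => exact .iteB h1 h2 (ih hβ (.inr h3))
  | acc h1 h2 =>
    cases hφ with
    | inl h => cases h
    | inr h => cases h with | acc h => exact .acc h
  | sep _ _ h3 h4 ih1 ih2 =>
    cases hφ with
    | inl h => cases h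
    | inr h => cases h with
      | sep h1 h2 =>
        exact .sep (ih1 ((Set.subset_union_left.trans h3).trans hβ) (.inr h1))
          (ih2 ((Set.subset_union_right.trans h3).trans hβ) (.inr h2))
  | @pred α ρ p es d vs h1 h2 h3 ih =>
    cases hφ with
    | inl h => cases h
    | inr h => cases h with
      | pred h =>
        refine .pred h1 h h2 (ih hβ ?_)
        cases hd : d.body with
        | mk imp body =>
          cases imp with
          | true => exact .inl rfl
          | false =>
            right
            rcases hP _ _ h1 with h4 | h4
            · rw [hd] at h4; cases h4
            -- Self-framedness is available for every permission set, in particular for `β` in place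
            -- of the part `α` in which the body was shown valid.
            · rw [hd] at h3 h4; exact h4 _ _ _ (h3.mono hβ)

theorem Assert.efrm {P : Program} (hP : P.PredSpecs) {H : Heap} {α : Set Perm}
    {ρ : Env} {φ : GFormula} (hφ : Specification P φ) (h : Assert P H α ρ φ) :
    EFrm P H α ρ φ.body := by
  apply h.efrm_of_iFrm hP subset_rfl
  obtain ⟨imp, body⟩ := φ
  cases imp with
  | true => exact .inl rfl
  | false =>
    right
    rcases hφ with h4 | h4
    · cases h4
    · exact h4 _ _ _ h

/-- The footprint consists of fields that are read and fields that are claimed. Framing accounts for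
the former and validity for the latter, so neither hypothesis would do alone. -/
theorem Assert.efoot_subset_of_efrm {P : Program} {H : Heap} {α β : Set Perm} {ρ : Env}
    {φ : GFormula} (h : Assert P H α ρ φ) (hβ : α ⊆ β) (hφ : EFrm P H β ρ φ.body) {a : Perm}
    (ha : EFoot P H ρ φ.body a) : a ∈ β := by
  induction h generalizing β with
  | imprecise _ h2 ih => exact ih hβ hφ ha
  | value h =>
    cases ha with | expr ha => cases hφ with | expr h => exact h.efootE_subset ha
  | iteA h1 _ ih =>
    cases hφ with
    | iteB h1' => cases h1.det h1'
    | iteA _ h2 h3 =>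
      cases ha with
      | iteCond ha => exact h2.efootE_subset ha
      | iteA _ ha => exact ih hβ h3 ha
      | iteB h1' => cases h1.det h1'
  | iteB h1 _ ih =>
    cases hφ with
    | iteA h1' => cases h1.det h1'
    | iteB _ h2 h3 =>
      cases ha with
      | iteCond ha => exact h2.efootE_subset ha
      | iteB _ ha => exact ih hβ h3 ha
      | iteA h1' => cases h1.det h1'
  | acc h1 h2 =>
    cases hφ with
    | acc h =>
      cases ha with
      | accSub ha => exact h.efootE_subset ha
      | acc h1' => cases h1.det h1'; exact hβ h2
  | sep _ _ h3 h4 ih1 ih2 =>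
    cases hφ with
    | sep h1 h2 =>
      cases ha with
      | sep₁ ha => exact ih1 ((Set.subset_union_left.trans h3).trans hβ) h1 ha
      | sep₂ ha => exact ih2 ((Set.subset_union_right.trans h3).trans hβ) h2 ha
  | pred h1 h2 _ ih =>
    cases hφ with
    | pred h1' h h2' h3 =>
      cases h1.symm.trans h1'
      cases Eval.det_list h2 h2'
      cases ha with
      | predArg he ha => exact (h _ he).efootE_subset ha
      | predBody h1' h2' ha =>
        cases h1.symm.trans h1'
        cases Eval.det_list h2 h2'
        exact ih hβ h3 ha

theorem Assert.efoot_subset {P : Program} (hP : P.PredSpecs) {H : Heap} {α : Set Perm}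
    {ρ : Env} {φ : GFormula} (hφ : Specification P φ) (h : Assert P H α ρ φ) :
    efoot P H ρ φ ⊆ α := fun _ ha =>
  h.efoot_subset_of_efrm subset_rfl (h.efrm hP hφ) ha

/-! ## Heaps that agree on a set of permissions -/

def Heap.AgreeOn (H H' : Heap) (α : Set Perm) : Prop := ∀ l f, (l, f) ∈ α → H l f = H' l f

theorem Heap.AgreeOn.symm {H H' : Heap} {α : Set Perm} (h : H.AgreeOn H' α) : H'.AgreeOn H α :=
  fun l f ha => (h l f ha).symm

theorem Heap.AgreeOn.mono {H H' : Heap} {α β : Set Perm} (h : H.AgreeOn H' α) (hβ : β ⊆ α) :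
    H.AgreeOn H' β := fun l f ha => h l f (hβ ha)

/-- Framing follows the short-circuit branches that evaluation takes, by determinism, and every
field read on the way is owned. -/
theorem Frm.eval_heap {H H' : Heap} {α : Set Perm} {ρ : Env} {e : Expr} {v : Value}
    (h : Frm H α ρ e) (hH : H.AgreeOn H' α) (hv : Eval H ρ e v) : Eval H' ρ e v := by
  induction hv with
  | lit l => exact .lit l
  | var h' => exact .var h'
  | andA h1 ih => cases h with
    | andA _ h => exact .andA (ih h)
    | andB _ h _ => exact .andA (ih h)
  | andB h1 _ ih1 ih2 => cases h with
    | andA h' => cases h1.det h'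
    | andB _ h h' => exact .andB (ih1 h) (ih2 h')
  | orA h1 ih => cases h with
    | orA _ h => exact .orA (ih h)
    | orB _ h _ => exact .orA (ih h)
  | orB h1 _ ih1 ih2 => cases h with
    | orA h' => cases h1.det h'
    | orB _ h h' => exact .orB (ih1 h) (ih2 h')
  | op _ _ h3 ih1 ih2 => cases h with | op h h' => exact .op (ih1 h) (ih2 h') h3
  | not _ ih => cases h with | not h => exact .not (ih h)
  | field h1 ih => cases h with
    | field h h2 h3 => cases h1.det h2; rw [hH _ _ h3]; exact .field (ih h)

theorem Frm.heap {H H' : Heap} {α β : Set Perm} {ρ : Env} {e : Expr} (h : Frm H α ρ e)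
    (hα : α ⊆ β) (hH : H.AgreeOn H' β) : Frm H' α ρ e := by
  have hE : ∀ {e v}, Frm H α ρ e → Eval H ρ e v → Eval H' ρ e v :=
    fun h hv => h.eval_heap (hH.mono hα) hv
  induction h with
  | lit l => exact .lit l
  | var x => exact .var x
  | field h1 h2 h3 ih => exact .field ih (hE h1 h2) h3
  | op _ _ ih1 ih2 => exact .op ih1 ih2
  | orA h h1 ih => exact .orA (hE h1 h) ih
  | orB h h1 _ ih1 ih2 => exact .orB (hE h1 h) ih1 ih2
  | andA h h1 ih => exact .andA (hE h1 h) ih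
  | andB h h1 _ ih1 ih2 => exact .andB (hE h1 h) ih1 ih2
  | not _ ih => exact .not ih

theorem Eval.list_heap {H H' : Heap} {α : Set Perm} {ρ : Env} {es : List Expr} {vs : List Value}
    (h : ∀ e ∈ es, Frm H α ρ e) (hH : H.AgreeOn H' α) (hv : List.Forall₂ (Eval H ρ) es vs) :
    List.Forall₂ (Eval H' ρ) es vs := by
  induction hv with
  | nil => exact .nil
  | cons h1 _ ih =>
    exact .cons ((h _ (by simp)).eval_heap hH h1) (ih fun e he => h e (by simp [he]))

theorem EFrm.heap {P : Program} {H H' : Heap} {α β : Set Perm} {ρ : Env} {φ : Formula}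
    (h : EFrm P H α ρ φ) (hα : α ⊆ β) (hH : H.AgreeOn H' β) : EFrm P H' α ρ φ := by
  have hH' := hH.mono hα
  induction h with
  | expr h => exact .expr (h.heap hα hH)
  | sep _ _ ih1 ih2 => exact .sep ih1 ih2
  | pred h1 h2 h3 _ ih =>
    exact .pred h1 (fun e he => (h2 e he).heap hα hH) (Eval.list_heap h2 hH' h3) ih
  | iteA h1 h2 _ ih => exact .iteA (h2.eval_heap hH' h1) (h2.heap hα hH) ih
  | iteB h1 h2 _ ih => exact .iteB (h2.eval_heap hH' h1) (h2.heap hα hH) ih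
  | acc h => exact .acc (h.heap hα hH)

/-- The claimed permissions are divided at a separating conjunction, but the reads of a conjunct may
use permissions of the other. Hence validity is stated for `α` while framing and agreement of the
heaps are stated for an undivided `β`. -/
theorem Assert.heap {P : Program} {H H' : Heap} {α β : Set Perm} {ρ : Env} {φ : GFormula}
    (h : Assert P H α ρ φ) (hα : α ⊆ β) (hφ : EFrm P H β ρ φ.body) (hH : H.AgreeOn H' β) :
    Assert P H' α ρ φ := by
  induction h with
  | imprecise _ h2 ih => exact .imprecise (ih hα hφ) (h2.heap hα hH)
  | value h => cases hφ with | expr hφ => exact .value (hφ.eval_heap hH h)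
  | iteA h1 _ ih => cases hφ with
    | iteA _ h2 h3 => exact .iteA (h2.eval_heap hH h1) (ih hα h3)
    | iteB h => cases h.det h1
  | iteB h1 _ ih => cases hφ with
    | iteB _ h2 h3 => exact .iteB (h2.eval_heap hH h1) (ih hα h3)
    | iteA h => cases h.det h1
  | acc h1 h2 => cases hφ with | acc h => exact .acc (h.eval_heap hH h1) h2
  | sep _ _ h3 h4 ih1 ih2 => cases hφ with
    | sep h h' =>
      exact .sep (ih1 ((Set.subset_union_left.trans h3).trans hα) h)
        (ih2 ((Set.subset_union_right.trans h3).trans hα) h') h3 h4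
  | pred h1 h2 _ ih => cases hφ with
    | pred h1' h h2' h3 =>
      cases h1.symm.trans h1'
      cases Eval.det_list h2 h2'
      exact .pred h1 (Eval.list_heap h hH h2) (ih hα h3)

theorem EFootE.heap {H H' : Heap} {α : Set Perm} {ρ : Env} {e : Expr} {a : Perm}
    (h : Frm H α ρ e) (hH : H.AgreeOn H' α) (ha : EFootE H ρ e a) : EFootE H' ρ e a := by
  induction ha with
  | fieldSub _ ih => cases h with | field h1 _ _ => exact .fieldSub (ih h1)
  | field he => cases h with | field h1 h2 h3 => exact .field (h1.eval_heap hH he)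
  | op₁ _ ih => cases h with | op h1 _ => exact .op₁ (ih h1)
  | op₂ _ ih => cases h with | op _ h2 => exact .op₂ (ih h2)
  | or₁ _ ih => cases h with
    | orA _ h => exact .or₁ (ih h)
    | orB _ h _ => exact .or₁ (ih h)
  | or₂ he _ ih => cases h with
    | orA h' _ => cases he.det h'
    | orB _ h' h => exact .or₂ (h'.eval_heap hH he) (ih h)
  | and₁ _ ih => cases h with
    | andA _ h => exact .and₁ (ih h)
    | andB _ h _ => exact .and₁ (ih h)
  | and₂ he _ ih => cases h with
    | andA h' _ => cases he.det h'
    | andB _ h' h => exact .and₂ (h'.eval_heap hH he) (ih h)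
  | not _ ih => cases h with | not h => exact .not (ih h)

theorem EFoot.heap {P : Program} {H H' : Heap} {α : Set Perm} {ρ : Env} {φ : Formula} {a : Perm}
    (h : EFrm P H α ρ φ) (hH : H.AgreeOn H' α) (ha : EFoot P H ρ φ a) : EFoot P H' ρ φ a := by
  induction ha with
  | expr ha => cases h with | expr h => exact .expr (ha.heap h hH)
  | sep₁ _ ih => cases h with | sep h _ => exact .sep₁ (ih h)
  | sep₂ _ ih => cases h with | sep _ h => exact .sep₂ (ih h)
  | predArg he ha => cases h with | pred _ h => exact .predArg he (ha.heap (h _ he) hH)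
  | predBody h1 h2 _ ih => cases h with
    | pred h1' h h2' h3 =>
      cases h1.symm.trans h1'
      cases Eval.det_list h2 h2'
      exact .predBody h1 (Eval.list_heap h hH h2) (ih h3)
  | iteCond ha => cases h with
    | iteA _ h => exact .iteCond (ha.heap h hH)
    | iteB _ h => exact .iteCond (ha.heap h hH)
  | iteA h1 _ ih => cases h with
    | iteA _ h h' => exact .iteA (h.eval_heap hH h1) (ih h')
    | iteB h => cases h.det h1
  | iteB h1 _ ih => cases h with
    | iteB _ h h' => exact .iteB (h.eval_heap hH h1) (ih h')
    | iteA h => cases h.det h1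
  | accSub ha => cases h with | acc h => exact .accSub (ha.heap h hH)
  | acc h1 => cases h with | acc h => exact .acc (h.eval_heap hH h1)

/-- Framing itself survives the change of heap, so the argument for one inclusion also applies in
the opposite direction. -/
theorem EFrm.efoot_heap {P : Program} {H H' : Heap} {α : Set Perm} {ρ : Env} {φ : GFormula}
    (h : EFrm P H α ρ φ.body) (hH : H.AgreeOn H' α) : efoot P H' ρ φ = efoot P H ρ φ :=
  Set.ext fun _ => ⟨fun ha => ha.heap (h.heap subset_rfl hH) hH.symm, fun ha => ha.heap h hH⟩

/-! ## Environments that agree on the free variables -/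

theorem Eval.env {H : Heap} {ρ ρ' : Env} {e : Expr} {v : Value} (h : Eval H ρ e v)
    (hρ : ∀ x ∈ e.fv, ρ x = ρ' x) : Eval H ρ' e v := by
  induction h with
  | lit l => exact .lit l
  | var h => exact .var ((hρ _ rfl).symm.trans h)
  | andA _ ih => exact .andA (ih fun x hx => hρ x (.inl hx))
  | andB _ _ ih1 ih2 =>
    exact .andB (ih1 fun x hx => hρ x (.inl hx)) (ih2 fun x hx => hρ x (.inr hx))
  | orA _ ih => exact .orA (ih fun x hx => hρ x (.inl hx))
  | orB _ _ ih1 ih2 =>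
    exact .orB (ih1 fun x hx => hρ x (.inl hx)) (ih2 fun x hx => hρ x (.inr hx))
  | op _ _ h3 ih1 ih2 =>
    exact .op (ih1 fun x hx => hρ x (.inl hx)) (ih2 fun x hx => hρ x (.inr hx)) h3
  | not _ ih => exact .not (ih hρ)
  | field _ ih => exact .field (ih hρ)

theorem Frm.env {H : Heap} {α : Set Perm} {ρ ρ' : Env} {e : Expr} (h : Frm H α ρ e)
    (hρ : ∀ x ∈ e.fv, ρ x = ρ' x) : Frm H α ρ' e := by
  induction h with
  | lit l => exact .lit l
  | var h => exact .var _
  | field _ h2 h3 ih => exact .field (ih hρ) (h2.env hρ) h3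
  | op _ _ ih1 ih2 =>
    exact .op (ih1 fun x hx => hρ x (.inl hx)) (ih2 fun x hx => hρ x (.inr hx))
  | orA h _ ih => exact .orA (h.env fun x hx => hρ x (.inl hx)) (ih fun x hx => hρ x (.inl hx))
  | orB h _ _ ih1 ih2 =>
    exact .orB (h.env fun x hx => hρ x (.inl hx)) (ih1 fun x hx => hρ x (.inl hx))
      (ih2 fun x hx => hρ x (.inr hx))
  | andA h _ ih => exact .andA (h.env fun x hx => hρ x (.inl hx)) (ih fun x hx => hρ x (.inl hx))
  | andB h _ _ ih1 ih2 =>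
    exact .andB (h.env fun x hx => hρ x (.inl hx)) (ih1 fun x hx => hρ x (.inl hx))
      (ih2 fun x hx => hρ x (.inr hx))
  | not _ ih => exact .not (ih hρ)

theorem Eval.list_env {H : Heap} {ρ ρ' : Env} {es : List Expr} {vs : List Value}
    (h : List.Forall₂ (Eval H ρ) es vs) (hρ : ∀ x ∈ argsFv es, ρ x = ρ' x) :
    List.Forall₂ (Eval H ρ') es vs := by
  induction h with
  | nil => exact .nil
  | cons h1 _ ih =>
    exact .cons (h1.env fun x hx => hρ x ⟨_, by simp, hx⟩)
      (ih fun x ⟨e, he, hx⟩ => hρ x ⟨e, by simp [he], hx⟩)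

theorem EFrm.env {P : Program} {H : Heap} {α : Set Perm} {ρ ρ' : Env} {φ : Formula}
    (h : EFrm P H α ρ φ) (hρ : ∀ x ∈ φ.fv, ρ x = ρ' x) : EFrm P H α ρ' φ := by
  induction h generalizing ρ' with
  | expr h => exact .expr (h.env hρ)
  | sep _ _ ih1 ih2 =>
    exact .sep (ih1 fun x hx => hρ x (.inl hx)) (ih2 fun x hx => hρ x (.inr hx))
  | pred h1 h2 h3 h4 _ =>
    exact .pred h1 (fun e he => (h2 e he).env fun x hx => hρ x ⟨e, he, hx⟩)
      (Eval.list_env h3 hρ) h4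
  | iteA h1 h2 _ ih =>
    exact .iteA (h1.env fun x hx => hρ x (.inl (.inl hx)))
      (h2.env fun x hx => hρ x (.inl (.inl hx))) (ih fun x hx => hρ x (.inl (.inr hx)))
  | iteB h1 h2 _ ih =>
    exact .iteB (h1.env fun x hx => hρ x (.inl (.inl hx)))
      (h2.env fun x hx => hρ x (.inl (.inl hx))) (ih fun x hx => hρ x (.inr hx))
  | acc h => exact .acc (h.env hρ)

theorem Assert.env {P : Program} {H : Heap} {α : Set Perm} {ρ ρ' : Env} {φ : GFormula}
    (h : Assert P H α ρ φ) (hρ : ∀ x ∈ φ.body.fv, ρ x = ρ' x) : Assert P H α ρ' φ := by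
  induction h generalizing ρ' with
  | imprecise _ h2 ih => exact .imprecise (ih hρ) (h2.env hρ)
  | value h => exact .value (h.env hρ)
  | iteA h1 _ ih =>
    exact .iteA (h1.env fun x hx => hρ x (.inl (.inl hx))) (ih fun x hx => hρ x (.inl (.inr hx)))
  | iteB h1 _ ih =>
    exact .iteB (h1.env fun x hx => hρ x (.inl (.inl hx))) (ih fun x hx => hρ x (.inr hx))
  | acc h1 h2 => exact .acc (h1.env hρ) h2
  | sep _ _ h3 h4 ih1 ih2 =>
    exact .sep (ih1 fun x hx => hρ x (.inl hx)) (ih2 fun x hx => hρ x (.inr hx)) h3 h4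
  | pred h1 h2 h3 ih => exact .pred h1 (Eval.list_env h2 hρ) h3

/-! ## The footprint of the accessibility predicates and predicates of a formula -/

/-- The permissions demanded by the accessibility predicates and predicates of a formula. -/
def Formula.permFoot (P : Program) (H : Heap) (ρ : Env) : Formula → Set Perm
  | .expr _ => ∅
  | .pred p es => {a | ∃ d vs, P.preds p = some d ∧ List.Forall₂ (Eval H ρ) es vs ∧
      a ∈ efoot P H (mkEnv d.vars vs) d.body}
  | .acc e f => {a | Eval H ρ e (.loc a.1) ∧ a.2 = f}
  | .sep φ₁ φ₂ => φ₁.permFoot P H ρ ∪ φ₂.permFoot P H ρ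
  | .ite e φ₁ φ₂ => {a | (Eval H ρ e (.bool true) ∧ a ∈ φ₁.permFoot P H ρ) ∨
      (Eval H ρ e (.bool false) ∧ a ∈ φ₂.permFoot P H ρ)}

/-! ## Environments of parameters -/

theorem mkEnv_cons {A : Type} (x : Var) (xs : List Var) (a : A) (as : List A) (y : Var) :
    mkEnv (x :: xs) (a :: as) y = if y = x then some a else mkEnv xs as y := by
  unfold mkEnv
  rw [List.zip_cons_cons, List.lookup_cons]
  by_cases h : y = x
  · subst h; simp
  · rw [if_neg h, beq_eq_false_iff_ne.2 h]

theorem mkEnv_forall₂ {A B : Type} {R : A → B → Prop} {xs : List Var} {as : List A} {bs : List B}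
    (h : List.Forall₂ R as bs) {x : Var} {a : A} (hx : mkEnv xs as x = some a) :
    ∃ b, mkEnv xs bs x = some b ∧ R a b := by
  induction h generalizing xs with
  | nil => cases xs <;> simp [mkEnv] at hx
  | cons h _ ih =>
    cases xs with
    | nil => simp [mkEnv] at hx
    | cons y ys =>
      rw [mkEnv_cons] at hx ⊢
      split_ifs at hx ⊢
      · cases hx; exact ⟨_, rfl, h⟩
      · exact ih hx

theorem mkEnv_mem {A : Type} {xs : List Var} {as : List A} {x : Var} {a : A}
    (hx : mkEnv xs as x = some a) : x ∈ xs := by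
  induction xs generalizing as with
  | nil => simp [mkEnv] at hx
  | cons y ys ih =>
    cases as with
    | nil => simp [mkEnv] at hx
    | cons b bs =>
      rw [mkEnv_cons] at hx
      split_ifs at hx with h
      · simp [h]
      · simp [ih hx]

theorem mkEnv_isSome {A : Type} {xs : List Var} {as : List A} (hl : as.length = xs.length)
    {x : Var} (hx : x ∈ xs) : ∃ a, mkEnv xs as x = some a := by
  induction xs generalizing as with
  | nil => cases hx
  | cons y ys ih =>
    cases as with
    | nil => cases hl
    | cons b bs =>
      rw [mkEnv_cons]
      split_ifs with h
      · exact ⟨_, rfl⟩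
      · exact ih (by simpa using hl) (by simpa [h] using hx)

theorem mkEnv_of_forall₂ {A : Type} {R : Var → A → Prop} {xs : List Var} {as : List A}
    (h : List.Forall₂ R xs as) {x : Var} {a : A} (hx : mkEnv xs as x = some a) : R x a := by
  induction h with
  | nil => simp [mkEnv] at hx
  | cons h _ ih =>
    rw [mkEnv_cons] at hx
    split_ifs at hx with h'
    · cases hx; rw [h']; exact h
    · exact ih hx

/-- Lookup finds the first occurrence of a variable, which is the intended position only if no
variable is repeated. -/
theorem mkEnv_nodup {A : Type} {xs : List Var} {as : List A} (hl : as.length = xs.length)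
    (hn : xs.Nodup) : List.Forall₂ (fun x a => mkEnv xs as x = some a) xs as := by
  induction xs generalizing as with
  | nil => cases as with | nil => exact .nil | cons => cases hl
  | cons y ys ih =>
    cases as with
    | nil => cases hl
    | cons b bs =>
      rw [List.nodup_cons] at hn
      refine .cons (by simp [mkEnv_cons]) ?_
      refine ((List.forall₂_and_left (p := fun x => x ∈ ys) _ _).2
        ⟨fun x hx => hx, ih (by simpa using hl) hn.2⟩).imp ?_
      rintro x a ⟨hx, h⟩
      rw [mkEnv_cons, if_neg (by rintro rfl; exact hn.1 hx)]
      exact h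

/-! ## Typing of values, heaps and environments -/

/-- Typing of values, where `Ψ` gives the struct of every location. -/
inductive VTy (Ψ : Loc → Option StructName) : Value → Ty → Prop where
  | int (n : ℤ) : VTy Ψ (.lit (.int n)) .int
  | char (c : Char) : VTy Ψ (.lit (.char c)) .char
  | bool (b : Bool) : VTy Ψ (.lit (.bool b)) .bool
  | null (S : StructName) : VTy Ψ (.lit .null) (.struct S)
  | loc {l S} : Ψ l = some S → VTy Ψ (.loc l) (.struct S)

def HeapTy (P : Program) (Ψ : Loc → Option StructName) (H : Heap) : Prop :=
  ∀ l S fs f T, Ψ l = some S → P.structs S = some fs → (f, T) ∈ fs → VTy Ψ (H l f) T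

def EnvTy (Ψ : Loc → Option StructName) (Δ : TyEnv) (ρ : Env) : Prop :=
  ∀ x v T, ρ x = some v → Δ x = some T → VTy Ψ v T

theorem VTy.default (Ψ : Loc → Option StructName) (T : Ty) : VTy Ψ (.lit T.default) T := by
  cases T
  · exact .int _
  · exact .bool _
  · exact .char _
  · exact .null _

theorem VTy.exists_bool {Ψ : Loc → Option StructName} {v : Value} (h : VTy Ψ v .bool) :
    ∃ b, v = .bool b := by cases h with | bool b => exact ⟨b, rfl⟩

theorem VTy.neg (Ψ : Loc → Option StructName) (v : Value) : VTy Ψ v.neg .bool := .bool _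

theorem BinOp.IsArith.eval {Ψ : Loc → Option StructName} {o : BinOp} (ho : o.IsArith)
    {v w : Value} (hv : VTy Ψ v .int) (hw : VTy Ψ w .int) :
    ∃ u, o.eval v w = some u ∧ VTy Ψ u .int := by
  cases hv; cases hw
  cases o <;> first | exact ho.elim | exact ⟨_, rfl, .int _⟩

theorem BinOp.IsOrder.eval {Ψ : Loc → Option StructName} {o : BinOp} (ho : o.IsOrder)
    {v w : Value} (hv : VTy Ψ v .int) (hw : VTy Ψ w .int) :
    ∃ u, o.eval v w = some u ∧ VTy Ψ u .bool := by
  cases hv; cases hw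
  cases o <;> first | exact ho.elim | exact ⟨_, rfl, .bool _⟩

theorem BinOp.IsEquality.eval {Ψ : Loc → Option StructName} {o : BinOp} (ho : o.IsEquality)
    (v w : Value) : ∃ u, o.eval v w = some u ∧ VTy Ψ u .bool := by
  cases o <;> first | exact ho.elim | exact ⟨_, by simp only [BinOp.eval]; rfl, .bool _⟩

/-- Operators are defined on operands of the right types. -/
theorem ExprTy.op_eval {P : Program} {Δ : TyEnv} {o : BinOp} {e₁ e₂ : Expr} {T : Ty}
    (h : ExprTy P Δ (.op o e₁ e₂) T) : ∃ T₁ T₂, ExprTy P Δ e₁ T₁ ∧ ExprTy P Δ e₂ T₂ ∧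
      ∀ Ψ v w, VTy Ψ v T₁ → VTy Ψ w T₂ → ∃ u, o.eval v w = some u ∧ VTy Ψ u T := by
  cases h with
  | arith ho h1 h2 => exact ⟨_, _, h1, h2, fun Ψ v w hv hw => ho.eval hv hw⟩
  | order ho h1 h2 => exact ⟨_, _, h1, h2, fun Ψ v w hv hw => ho.eval hv hw⟩
  | equality ho h1 h2 => exact ⟨_, _, h1, h2, fun Ψ v w _ _ => ho.eval v w⟩

theorem HeapTy.field {P : Program} {Ψ : Loc → Option StructName} {H : Heap}
    (hH : HeapTy P Ψ H) {S : StructName} {fs : List (FieldName × Ty)} {f : FieldName} {T : Ty}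
    (hS : P.structs S = some fs) (hf : (f, T) ∈ fs) {l : Loc} (hl : VTy Ψ (.loc l) (.struct S)) :
    VTy Ψ (H l f) T := by
  cases hl with | loc hl => exact hH l S fs f T hl hS hf

/-- Type soundness of evaluation. It is needed for more than typing of states: symbolic connectives
and operators are undefined or meaningless on values of the wrong type, and well-typedness of
run-time values is what rules this out. -/
theorem Eval.vty {P : Program} {Ψ : Loc → Option StructName} {Δ : TyEnv} {H : Heap} {ρ : Env}
    (hH : HeapTy P Ψ H) (hρ : EnvTy Ψ Δ ρ) {e : Expr} {v : Value} {T : Ty}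
    (h : Eval H ρ e v) (hT : ExprTy P Δ e T) : VTy Ψ v T := by
  induction h generalizing T with
  | lit l => cases hT <;> constructor
  | var h => cases hT with | var hT => exact hρ _ _ _ h hT
  | andA _ ih => cases hT; exact .bool _
  | andB _ _ _ ih2 => cases hT with | and _ h => exact ih2 h
  | orA _ ih => cases hT; exact .bool _
  | orB _ _ _ ih2 => cases hT with | or _ h => exact ih2 h
  | op _ _ h3 ih1 ih2 =>
    obtain ⟨T₁, T₂, h1, h2, h⟩ := hT.op_eval
    obtain ⟨u, hu, hu'⟩ := h Ψ _ _ (ih1 h1) (ih2 h2)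
    cases hu.symm.trans h3
    exact hu'
  | not _ _ => cases hT; exact VTy.neg _ _
  | field _ ih => cases hT with | field h hS hf => exact hH.field hS hf (ih h)

theorem EnvTy.params {Ψ : Loc → Option StructName} {params : List (Var × Ty)} {vs : List Value}
    (h : List.Forall₂ (fun v (xT : Var × Ty) => VTy Ψ v xT.2) vs params) :
    EnvTy Ψ (paramTys params) (mkEnv (params.map Prod.fst) vs) := by
  intro x v T hx hT
  obtain ⟨xT, h1, h2⟩ := mkEnv_forall₂ h hx
  have h3 : List.Forall₂ (fun (xT : Var × Ty) T => xT.2 = T) params (params.map Prod.snd) := by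
    rw [List.forall₂_map_right_iff]; exact List.forall₂_same.2 fun _ _ => rfl
  obtain ⟨T', h4, h5⟩ := mkEnv_forall₂ h3 h1
  cases h4.symm.trans hT
  exact h5 ▸ h2

theorem Eval.list_vty {P : Program} {Ψ : Loc → Option StructName} {Δ : TyEnv} {H : Heap}
    {ρ : Env} (hH : HeapTy P Ψ H) (hρ : EnvTy Ψ Δ ρ) {es : List Expr} {vs : List Value}
    {params : List (Var × Ty)} (h : List.Forall₂ (Eval H ρ) es vs)
    (hT : ArgsTy P Δ es params) :
    List.Forall₂ (fun v (xT : Var × Ty) => VTy Ψ v xT.2) vs params := by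
  induction h generalizing params with
  | nil => cases hT; exact .nil
  | cons h _ ih => cases hT with | cons h1 h2 => exact .cons (h.vty hH hρ h1) (ih h2)

/-! ## Sequential composition -/

theorem Stmt.modified_append (s t : Stmt) : (s.append t).modified = s.modified ++ t.modified := by
  induction s generalizing t with
  | seq s₁ s₂ ih1 ih2 => simp [Stmt.append, Stmt.modified, ih1, ih2]
  | _ => rfl

theorem Stmt.invariants_append (s t : Stmt) :
    (s.append t).invariants = s.invariants ∪ t.invariants := by
  induction s generalizing t with
  | seq s₁ s₂ ih1 ih2 => simp [Stmt.append, Stmt.invariants, ih1, ih2, Set.union_assoc]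
  | _ => rfl

theorem Stmt.ty_append {P : Program} {Δ : TyEnv} (s t : Stmt) :
    StmtTy P Δ (s.append t) ↔ StmtTy P Δ s ∧ StmtTy P Δ t := by
  induction s generalizing t with
  | seq s₁ s₂ ih1 ih2 => simp [Stmt.append, StmtTy, ih1, ih2, and_assoc]
  | _ => exact Iff.rfl

theorem Stmt.initOK_append (A : Set Var) (s t : Stmt) :
    (s.append t).InitOK A ↔ s.InitOK A ∧ t.InitOK (s.defs A) := by
  induction s generalizing t A with
  | seq s₁ s₂ ih1 ih2 => simp [Stmt.append, Stmt.InitOK, Stmt.defs, ih1, ih2, and_assoc]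
  | _ => exact Iff.rfl

theorem Stmt.norm_props {P : Program} {Δ : TyEnv} (s : Stmt) :
    (StmtTy P Δ s.norm ↔ StmtTy P Δ s) ∧ s.norm.invariants = s.invariants ∧
      ∀ A, s.norm.InitOK A ↔ s.InitOK A := by
  induction s with
  | seq s₁ s₂ _ ih2 =>
    refine ⟨?_, ?_, fun A => ?_⟩
    · rw [Stmt.norm, Stmt.ty_append, ih2.1]; rfl
    · rw [Stmt.norm, Stmt.invariants_append, ih2.2.1]; rfl
    · rw [Stmt.norm, Stmt.initOK_append, ih2.2.2]; rfl
  | _ => exact ⟨Iff.rfl, rfl, fun _ => Iff.rfl⟩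

theorem Stmt.defs_mono (s : Stmt) {A B : Set Var} (h : A ⊆ B) : s.defs A ⊆ s.defs B := by
  induction s generalizing A B with
  | ite e s₁ s₂ ih1 ih2 => exact Set.inter_subset_inter (ih1 h) (ih2 h)
  | seq s₁ s₂ ih1 ih2 => exact ih2 (ih1 h)
  | assign | alloc | call => exact Set.insert_subset_insert h
  | _ => exact h

theorem Stmt.InitOK.mono {s : Stmt} {A B : Set Var} (hs : s.InitOK A) (h : A ⊆ B) :
    s.InitOK B := by
  induction s generalizing A B with
  | skip => trivial
  | alloc => trivial
  | ite e s₁ s₂ ih1 ih2 => exact ⟨hs.1.trans h, ih1 hs.2.1 h, ih2 hs.2.2 h⟩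
  | seq s₁ s₂ ih1 ih2 => exact ⟨ih1 hs.1 h, ih2 hs.2 (s₁.defs_mono h)⟩
  | loop e φ s ih => exact ⟨hs.1.trans h, hs.2.1.trans h, ih hs.2.2 h⟩
  | assignField => exact ⟨h hs.1, hs.2.trans h⟩
  | _ => exact Set.Subset.trans hs h

/-! ## Invariants of execution states -/

/-- The environment of the frame is well typed, and so is its remaining statement, whose loop
invariants are specifications. -/
structure FrameOK (P : Program) (Ψ : Loc → Option StructName) (Δ : TyEnv) (fr : Frame) :
    Prop where
  stmt : StmtTy P Δ fr.s
  env : EnvTy Ψ Δ fr.ρ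
  spec : ∀ φ ∈ fr.s.invariants, Specification P φ

/-- Typing of a stack whose top frame is typed by the given type environment. A frame above a call
does not assign to the parameters, and a frame above a loop only assigns to variables that the
loop modifies. -/
inductive StackOK (P : Program) (Ψ : Loc → Option StructName) : TyEnv → Stack → Prop where
  | base {Δ fr} : FrameOK P Ψ Δ fr → StackOK P Ψ Δ [fr]
  | call {Δ₀ Δ fr α ρ y m es s S d} :
      StackOK P Ψ Δ₀ (⟨α, ρ, .seq (.call y m es) s⟩ :: S) → P.methods m = some d →
      FrameOK P Ψ Δ fr → (∀ x ∈ d.vars, Δ x = paramTys d.params x) →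
      Δ .result = some d.ret → (∀ x ∈ fr.s.modified, x ∉ d.vars) →
      StackOK P Ψ Δ (fr :: ⟨α, ρ, .seq (.call y m es) s⟩ :: S)
  | loop {Δ fr α ρ e φ b s S} :
      StackOK P Ψ Δ (⟨α, ρ, .seq (.loop e φ b) s⟩ :: S) → FrameOK P Ψ Δ fr →
      (∀ x ∈ fr.s.modified, x ∈ b.modified) → (∀ x ∉ b.modified, fr.ρ x = ρ x) →
      (∀ x, ρ x ≠ none → fr.ρ x ≠ none) →
      StackOK P Ψ Δ (fr :: ⟨α, ρ, .seq (.loop e φ b) s⟩ :: S)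

theorem StackOK.frame {P : Program} {Ψ : Loc → Option StructName} {Δ : TyEnv} {fr : Frame}
    {S : Stack} (h : StackOK P Ψ Δ (fr :: S)) : FrameOK P Ψ Δ fr := by
  cases h <;> assumption

/-- The links between a frame and the one below concern only which variables may still be assigned,
which have kept their values, and which are defined. The last three hypotheses say that a step of
the top frame respects each of these. -/
theorem StackOK.replace {P : Program} {Ψ : Loc → Option StructName} {Δ : TyEnv} {fr fr' : Frame}
    {S : Stack} (h : StackOK P Ψ Δ (fr :: S)) (hfr : FrameOK P Ψ Δ fr')
    (hm : ∀ x ∈ fr'.s.modified, x ∈ fr.s.modified)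
    (hρ : ∀ x ∉ fr.s.modified, fr'.ρ x = fr.ρ x) (hd : ∀ x, fr.ρ x ≠ none → fr'.ρ x ≠ none) :
    StackOK P Ψ Δ (fr' :: S) := by
  cases h with
  | base => exact .base hfr
  | call h1 h2 _ h4 h5 h6 => exact .call h1 h2 hfr h4 h5 fun x hx => h6 x (hm x hx)
  | loop h1 _ h3 h4 h5 =>
    exact .loop h1 hfr (fun x hx => h3 x (hm x hx))
      (fun x hx => (hρ x fun h => hx (h3 x h)).trans (h4 x hx)) fun x hx => hd x (h5 x hx)

/-- Only the value `.loc l` depends on the struct recorded for `l`. This serves allocation, where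
`l` occurs nowhere in the state, so that its struct may be redefined. -/
theorem VTy.update {Ψ : Loc → Option StructName} {l : Loc} {S : Option StructName} {v : Value}
    {T : Ty} (h : VTy Ψ v T) (hv : v ≠ .loc l) : VTy (Function.update Ψ l S) v T := by
  cases h with
  | @loc l' S' h =>
    refine .loc ?_
    rw [Function.update_of_ne (by rintro rfl; exact hv rfl)]
    exact h
  | _ => constructor

theorem EnvTy.update {Ψ : Loc → Option StructName} {Δ : TyEnv} {ρ : Env} (h : EnvTy Ψ Δ ρ)
    {l : Loc} {S : Option StructName} (hρ : ∀ x, ρ x ≠ some (.loc l)) :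
    EnvTy (Function.update Ψ l S) Δ ρ := fun x v T hx hT =>
  (h x v T hx hT).update (by rintro rfl; exact hρ x hx)

theorem FrameOK.update {P : Program} {Ψ : Loc → Option StructName} {Δ : TyEnv} {fr : Frame}
    (h : FrameOK P Ψ Δ fr) {l : Loc} {S : Option StructName} (hρ : ∀ x, fr.ρ x ≠ some (.loc l)) :
    FrameOK P (Function.update Ψ l S) Δ fr := ⟨h.stmt, h.env.update hρ, h.spec⟩

theorem StackOK.update {P : Program} {Ψ : Loc → Option StructName} {Δ : TyEnv} {St : Stack}
    (h : StackOK P Ψ Δ St) {l : Loc} {S : Option StructName}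
    (hρ : ∀ fr ∈ St, ∀ x, fr.ρ x ≠ some (.loc l)) :
    StackOK P (Function.update Ψ l S) Δ St := by
  induction h with
  | base h => exact .base (h.update (hρ _ (by simp)))
  | call _ h2 h3 h4 h5 h6 ih =>
    exact .call (ih fun fr hfr => hρ fr (by simp [List.mem_cons.1 hfr])) h2
      (h3.update (hρ _ (by simp))) h4 h5 h6
  | loop _ h3 h4 h5 h6 ih =>
    exact .loop (ih fun fr hfr => hρ fr (by simp [List.mem_cons.1 hfr]))
      (h3.update (hρ _ (by simp))) h4 h5 h6

theorem EnvTy.update_var {Ψ : Loc → Option StructName} {Δ : TyEnv} {ρ : Env} (h : EnvTy Ψ Δ ρ)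
    {x : Var} {v : Value} {T : Ty} (hx : Δ x = some T) (hv : VTy Ψ v T) :
    EnvTy Ψ Δ (Function.update ρ x (some v)) := by
  intro y w T' hy hT
  by_cases hyx : y = x
  · subst hyx
    rw [Function.update_self] at hy
    cases hy
    cases hx.symm.trans hT
    exact hv
  · rw [Function.update_of_ne hyx] at hy
    exact h y w T' hy hT

/-- The invariants of reachable execution states. -/
structure ExecInv (P : Program) (H : Heap) (S : Stack) : Prop where
  typed : ∃ Ψ Δ, HeapTy P Ψ H ∧ StackOK P Ψ Δ S
  disjoint : S.Pairwise fun a b => Disjoint a.α b.α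

theorem Program.WellFormed.predSpecs {P : Program} (hP : P.WellFormed) : P.PredSpecs :=
  fun p d h => (hP.preds p d h).spec

/-- The permissions handed over are among those available. -/
theorem Assert.foot_subset {P : Program} (hP : P.PredSpecs) {H : Heap} {α : Set Perm}
    {ρ : Env} {φ : GFormula} (hφ : Specification P φ) (h : Assert P H α ρ φ) :
    foot P H α ρ φ ⊆ α := by
  unfold foot
  split_ifs
  · exact h.efoot_subset hP hφ
  · exact subset_rfl

theorem Assert.foot {P : Program} {H : Heap} {α : Set Perm} {ρ : Env} {φ : GFormula}
    (h : Assert P H α ρ φ) : Assert P H (foot P H α ρ φ) ρ φ := by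
  unfold GradualC0.foot
  split_ifs
  · exact h.restrict fun a _ ha => ha
  · exact h

/-- The static type of the receiver agrees with the struct that `Ψ` records for `l`, and a struct
declares each field only once. So the type of the assigned expression is the only one demanded of
this field. -/
theorem HeapTy.set {P : Program} {Ψ : Loc → Option StructName} {Δ : TyEnv} {H : Heap}
    (hP : P.WellFormed) (hH : HeapTy P Ψ H) {ρ : Env} (hρ : EnvTy Ψ Δ ρ) {e₀ e : Expr} {l : Loc}
    {f : FieldName} {v : Value} {T : Ty} (h₀ : Eval H ρ e₀ (.loc l)) (h : Eval H ρ e v)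
    (hT₀ : ExprTy P Δ (.field e₀ f) T) (hT : ExprTy P Δ e T) : HeapTy P Ψ (H.set l f v) := by
  intro l' S fs f' T' hl hS hf
  unfold Heap.set
  split_ifs with hc
  · obtain ⟨rfl, rfl⟩ := hc
    cases hT₀ with
    | field h1 h2 h3 =>
      have h4 := h₀.vty hH hρ h1
      cases h4 with
      | loc h4 =>
        cases h4.symm.trans hl
        cases h2.symm.trans hS
        have hn := hP.structs _ _ hS
        have := List.inj_on_of_nodup_map hn h3 hf rfl
        cases this
        exact h.vty hH hρ hT
  · exact hH l' S fs f' T' hl hS hf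

theorem lookup_of_nodup {A B : Type} [DecidableEq A] {fs : List (A × B)}
    (hn : (fs.map Prod.fst).Nodup) {f : A} {T : B} (h : (f, T) ∈ fs) : fs.lookup f = some T := by
  induction fs with
  | nil => cases h
  | cons g fs ih =>
    obtain ⟨f', T'⟩ := g
    rw [List.map_cons, List.nodup_cons] at hn
    rw [List.lookup_cons]
    rcases List.mem_cons.1 h with h' | h'
    · cases h'; simp
    · have : f ≠ f' := by
        rintro rfl
        exact hn.1 (List.mem_map.2 ⟨(f, T), h', rfl⟩)
      rw [beq_eq_false_iff_ne.2 this]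
      exact ih hn.2 h'

/-- The initialised fields have the default values of their types. No other value of the heap refers
to `l`, so its new struct invalidates nothing. -/
theorem HeapTy.init {P : Program} {Ψ : Loc → Option StructName} {H : Heap}
    (hP : P.WellFormed) (hH : HeapTy P Ψ H) {l : Loc} {St : StructName}
    {fs : List (FieldName × Ty)} (hS : P.structs St = some fs) (hl : ∀ l' f, H l' f ≠ .loc l) :
    HeapTy P (Function.update Ψ l (some St)) (H.init l fs) := by
  intro l' S fs' f' T' hl' hS' hf
  unfold Heap.init
  split_ifs with hc
  · subst hc
    rw [Function.update_self] at hl'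
    cases hl'
    cases hS.symm.trans hS'
    rw [lookup_of_nodup (hP.structs _ _ hS) hf]
    exact VTy.default _ _
  · rw [Function.update_of_ne hc] at hl'
    exact (hH l' S fs' f' T' hl' hS' hf).update (hl _ _)

theorem update_ne_none {ρ : Env} {x : Var} {v : Value} (y : Var) (h : ρ y ≠ none) :
    Function.update ρ x (some v) y ≠ none := by
  by_cases hy : y = x
  · subst hy; simp
  · rwa [Function.update_of_ne hy]

theorem pairwise_replace {fr fr' : Frame} {S : Stack}
    (h : (fr :: S).Pairwise fun a b => Disjoint a.α b.α) (hα : fr'.α ⊆ fr.α) :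
    (fr' :: S).Pairwise fun a b => Disjoint a.α b.α := by
  rw [List.pairwise_cons] at h ⊢
  exact ⟨fun b hb => (h.1 b hb).mono_left hα, h.2⟩

/-- Part of the permissions of the top frame is handed over to a new frame. -/
theorem pairwise_push {fr : Frame} {α α' : Set Perm} {ρ ρ' : Env} {s s' : Stmt} {S : Stack}
    (h : (fr :: S).Pairwise fun a b => Disjoint a.α b.α) (hα : α' ⊆ fr.α)
    (hα' : α ⊆ fr.α \ α') :
    (⟨α', ρ', s'⟩ :: ⟨α, ρ, s⟩ :: S : Stack).Pairwise fun a b => Disjoint a.α b.α := by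
  refine List.pairwise_cons.2 ⟨fun b hb => ?_, pairwise_replace h (hα'.trans Set.sdiff_subset)⟩
  rcases List.mem_cons.1 hb with rfl | hb
  · exact Set.disjoint_sdiff_right.mono_right hα'
  · exact ((List.pairwise_cons.1 h).1 b hb).mono_left hα

/-- Permissions of the top frame are returned to the frame below it. -/
theorem pairwise_pop {fr fr₀ fr' : Frame} {S : Stack}
    (h : (fr :: fr₀ :: S).Pairwise fun a b => Disjoint a.α b.α) (hα : fr'.α ⊆ fr₀.α ∪ fr.α) :
    (fr' :: S).Pairwise fun a b => Disjoint a.α b.α := by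
  rw [List.pairwise_cons, List.pairwise_cons] at h
  refine List.pairwise_cons.2 ⟨fun b hb => ?_, h.2.2⟩
  exact (Disjoint.union_left (h.2.1 b hb) (h.1 b (by simp [hb]))).mono_left hα

/-- Disjointness persists because permissions are never copied: entering a call or loop divides the
set of the top frame, leaving one returns a part of it to the frame below, and allocation only adds
fields of a location that no frame owns. -/
theorem DStep.execInv {P : Program} (hP : P.WellFormed) {X : Set Perm} {H H' : Heap}
    {S S' : Stack} (hinv : ExecInv P H S) (h : DStep P X H S H' S') : ExecInv P H' S' := by
  obtain ⟨⟨Ψ, Δ, hH, hS⟩, hdisj⟩ := hinv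
  have hPS := hP.predSpecs
  cases h with
  | seq =>
    have hf := hS.frame
    refine ⟨⟨Ψ, Δ, hH, hS.replace ⟨hf.stmt.2, hf.env, fun φ h => hf.spec φ (.inr h)⟩
      (fun x hx => ?_) (fun _ _ => rfl) fun _ h => h⟩, pairwise_replace hdisj subset_rfl⟩
    simpa [Stmt.modified] using hx
  | @assign α ρ x e s S v he _ =>
    have hf := hS.frame
    obtain ⟨⟨T, hx, hT⟩, hs⟩ := hf.stmt
    refine ⟨⟨Ψ, Δ, hH, hS.replace ⟨hs, hf.env.update_var hx (he.vty hH hf.env hT),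
      fun φ h => hf.spec φ (.inr h)⟩ (fun y hy => ?_) (fun y hy => ?_)
      fun y => update_ne_none y⟩, pairwise_replace hdisj subset_rfl⟩
    · simp [Stmt.modified] at hy ⊢; exact .inr hy
    · simp [Stmt.modified] at hy
      exact Function.update_of_ne hy.1 _ _
  | assignField h1 h2 _ _ =>
    have hf := hS.frame
    obtain ⟨⟨T, hT₀, hT⟩, hs⟩ := hf.stmt
    refine ⟨⟨Ψ, Δ, hH.set hP hf.env h1 h2 hT₀ hT, hS.replace ⟨hs, hf.env,
      fun φ h => hf.spec φ (.inr h)⟩ (fun y hy => ?_) (fun _ _ => rfl) fun _ h => h⟩,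
      pairwise_replace hdisj subset_rfl⟩
    simpa [Stmt.modified] using hy
  | @alloc α ρ x St s S l fs hl hSt =>
    have hS' := hS.update (l := l) (S := some St) fun fr hfr => (hl.2 fr hfr).2
    have hf := hS'.frame
    obtain ⟨⟨hx, hT⟩, hs⟩ := hf.stmt
    refine ⟨⟨_, Δ, hH.init hP hSt hl.1, hS'.replace ⟨hs,
      hf.env.update_var hx (.loc (by simp)),
      fun φ h => hf.spec φ (.inr h)⟩ (fun y hy => ?_) (fun y hy => ?_)
      fun y => update_ne_none y⟩, ?_⟩
    · simp [Stmt.modified] at hy ⊢; exact .inr hy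
    · simp [Stmt.modified] at hy
      exact Function.update_of_ne hy.1 _ _
    · rw [List.pairwise_cons] at hdisj ⊢
      refine ⟨fun b hb => Disjoint.union_left (hdisj.1 b hb) ?_, hdisj.2⟩
      rw [Set.disjoint_left]
      rintro ⟨l', f⟩ ⟨rfl, _⟩ ha
      exact (hl.2 b (by simp [hb])).1 f ha
  | @callEnter α ρ y m es s S d vs α' hm hes _ hpre hα' =>
    have hf := hS.frame
    obtain ⟨⟨d', hd', hargs, hy⟩, hs⟩ := hf.stmt
    cases hm.symm.trans hd'
    have hd := hP.methods _ _ hm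
    obtain ⟨Δ', h1, h2, h3⟩ := hd.body_typed
    -- The handed-over permissions come from the available ones: the exact footprint is owned
    -- because the pre-condition is a specification, and the other possibility is the available set
    -- itself.
    have hsub : α' ⊆ α := hα' ▸ (hpre.foot_subset hPS hd.pre_spec).trans Set.sdiff_subset
    refine ⟨⟨Ψ, Δ', hH, .call (hS.replace ⟨hf.stmt, hf.env, hf.spec⟩ (fun _ h => h)
      (fun _ _ => rfl) fun _ h => h) hm ⟨?_, ?_, ?_⟩ h1 h2 ?_⟩,
      pairwise_push hdisj hsub subset_rfl⟩
    · exact (Stmt.ty_append _ _).2 ⟨h3, trivial⟩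
    · intro x v T hx hT
      refine EnvTy.params (Eval.list_vty hH hf.env hes hargs) x v T hx ?_
      rw [← h1 x (mkEnv_mem hx)]; exact hT
    · simpa [Stmt.invariants_append, Stmt.invariants] using hd.inv_spec
    · simpa [Stmt.modified_append, Stmt.modified] using hd.params_const
  | @callExit α ρ α' ρ' y m es s S d v hm hpost hv =>
    cases hS with
    | call h1 h2 h3 h4 h5 h6 =>
      cases hm.symm.trans h2
      have hf := h1.frame
      obtain ⟨⟨d', hd', hargs, hy⟩, hs⟩ := hf.stmt
      cases hm.symm.trans hd'
      refine ⟨⟨Ψ, _, hH, h1.replace ⟨hs, hf.env.update_var hy (h3.env _ _ _ hv h5),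
        fun φ h => hf.spec φ (.inr h)⟩ (fun y hy => ?_) (fun y hy => ?_)
        fun y => update_ne_none y⟩, pairwise_pop hdisj ?_⟩
      · simp [Stmt.modified] at hy ⊢; exact .inr hy
      · simp [Stmt.modified] at hy
        exact Function.update_of_ne hy.1 _ _
      · exact Set.union_subset_union_right _
          (hpost.foot_subset hPS (hP.methods _ _ hm).post_spec)
  | assert =>
    have hf := hS.frame
    refine ⟨⟨Ψ, Δ, hH, hS.replace ⟨hf.stmt.2, hf.env, fun φ h => hf.spec φ (.inr h)⟩
      (fun x hx => ?_) (fun _ _ => rfl) fun _ h => h⟩, pairwise_replace hdisj subset_rfl⟩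
    simpa [Stmt.modified] using hx
  | iteA =>
    have hf := hS.frame
    refine ⟨⟨Ψ, Δ, hH, hS.replace ⟨(Stmt.ty_append _ _).2 ⟨hf.stmt.1.2.1, hf.stmt.2⟩, hf.env,
      fun φ h => hf.spec φ ?_⟩
      (fun x hx => ?_) (fun _ _ => rfl) fun _ h => h⟩, pairwise_replace hdisj subset_rfl⟩
    · rw [Stmt.invariants_append] at h
      exact h.imp Or.inl id
    · simp [Stmt.modified_append, Stmt.modified] at hx ⊢
      tauto
  | iteB =>
    have hf := hS.frame
    refine ⟨⟨Ψ, Δ, hH, hS.replace ⟨(Stmt.ty_append _ _).2 ⟨hf.stmt.1.2.2, hf.stmt.2⟩, hf.env,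
      fun φ h => hf.spec φ ?_⟩
      (fun x hx => ?_) (fun _ _ => rfl) fun _ h => h⟩, pairwise_replace hdisj subset_rfl⟩
    · rw [Stmt.invariants_append] at h
      exact h.imp Or.inr id
    · simp [Stmt.modified_append, Stmt.modified] at hx ⊢
      tauto
  | @loopEnter α ρ e φ b s S α' _ _ hφ hα' =>
    have hf := hS.frame
    obtain ⟨⟨he, hT, hb⟩, hs⟩ := hf.stmt
    have hsub : α' ⊆ α := hα' ▸ (hφ.foot_subset hPS
      (hf.spec _ (.inl (Set.mem_insert _ _)))).trans Set.sdiff_subset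
    refine ⟨⟨Ψ, Δ, hH, .loop (hS.replace ⟨hf.stmt, hf.env, hf.spec⟩ (fun _ h => h)
      (fun _ _ => rfl) fun _ h => h) ⟨?_, hf.env, ?_⟩ ?_ (fun _ _ => rfl) fun _ h => h⟩,
      pairwise_push hdisj hsub subset_rfl⟩
    · exact (Stmt.ty_append _ _).2 ⟨hb, trivial⟩
    · intro ψ hψ
      simp [Stmt.invariants_append, Stmt.invariants] at hψ
      exact hf.spec _ (.inl (Set.mem_insert_of_mem _ hψ))
    · simp [Stmt.modified_append, Stmt.modified]
  | loopSkip =>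
    have hf := hS.frame
    refine ⟨⟨Ψ, Δ, hH, hS.replace ⟨hf.stmt.2, hf.env, fun φ h => hf.spec φ (.inr h)⟩
      (fun x hx => ?_) (fun _ _ => rfl) fun _ h => h⟩, pairwise_replace hdisj subset_rfl⟩
    simp [Stmt.modified] at hx ⊢; exact .inr hx
  | loopFinish hφ =>
    cases hS with
    | loop h1 h2 h3 h4 h5 =>
      have hf := h1.frame
      refine ⟨⟨Ψ, _, hH, h1.replace ⟨hf.stmt, h2.env, hf.spec⟩ (fun _ h => h)
        (fun x hx => h4 x ?_) h5⟩, pairwise_pop hdisj ?_⟩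
      · simp [Stmt.modified] at hx; exact hx.1
      · exact Set.union_subset_union_right _ (hφ.foot_subset hPS
          (hf.spec _ (.inl (Set.mem_insert _ _))))
  | foldPred =>
    have hf := hS.frame
    refine ⟨⟨Ψ, Δ, hH, hS.replace ⟨hf.stmt.2, hf.env, fun φ h => hf.spec φ (.inr h)⟩
      (fun x hx => ?_) (fun _ _ => rfl) fun _ h => h⟩, pairwise_replace hdisj subset_rfl⟩
    simpa [Stmt.modified] using hx
  | unfoldPred =>
    have hf := hS.frame
    refine ⟨⟨Ψ, Δ, hH, hS.replace ⟨hf.stmt.2, hf.env, fun φ h => hf.spec φ (.inr h)⟩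
      (fun x hx => ?_) (fun _ _ => rfl) fun _ h => h⟩, pairwise_replace hdisj subset_rfl⟩
    simpa [Stmt.modified] using hx

theorem DTrans.execInv {P : Program} (hP : P.WellFormed) {X : Set Perm} {Γ Γ' : DState}
    (h : DTrans P X Γ Γ') : ∀ H S, Γ' = .run H S → ExecInv P H S := by
  induction h with
  | init =>
    rintro H S ⟨⟩
    obtain ⟨Δ, hΔ⟩ := hP.entry_typed
    refine ⟨⟨fun _ => none, Δ, ?_, .base ⟨?_, ?_, ?_⟩⟩, List.pairwise_singleton _ _⟩
    · intro l S fs f T hl; cases hl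
    · exact (Stmt.norm_props _).1.2 hΔ
    · intro x v T hx; cases hx
    · rw [(Stmt.norm_props (P := P) (Δ := Δ) _).2.1]
      exact hP.entry_inv
  | step _ hs ih => rintro H S ⟨⟩; exact hs.execInv hP (ih _ _ rfl)
  | final => rintro H S ⟨⟩

/-! ## Symbolic expressions under a valuation -/

theorem SExpr.val_congr {V V' : SValuation} {t : SExpr} (h : Set.EqOn V V' t.svals) :
    t.val V = t.val V' := by
  induction t with
  | sv ν => exact congrArg some (h rfl)
  | lit l => rfl
  | not t ih => simp only [SExpr.val, ih h]
  | and t₁ t₂ ih1 ih2 =>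
    simp only [SExpr.val, ih1 (h.mono Set.subset_union_left), ih2 (h.mono Set.subset_union_right)]
  | or t₁ t₂ ih1 ih2 =>
    simp only [SExpr.val, ih1 (h.mono Set.subset_union_left), ih2 (h.mono Set.subset_union_right)]
  | op o t₁ t₂ ih1 ih2 =>
    simp only [SExpr.val, ih1 (h.mono Set.subset_union_left), ih2 (h.mono Set.subset_union_right)]

theorem SExpr.val_and {V : SValuation} {t₁ t₂ : SExpr} :
    (SExpr.and t₁ t₂).val V = some (.bool true) ↔
      t₁.val V = some (.bool true) ∧ t₂.val V = some (.bool true) := by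
  cases h1 : t₁.val V <;> cases h2 : t₂.val V <;> simp [SExpr.val, h1, h2, Value.bool]

theorem SExpr.val_not {V : SValuation} {t : SExpr} :
    (SExpr.not t).val V = some (.bool true) ↔ t.val V = some (.bool false) := by
  cases h1 : t.val V <;> simp [SExpr.val, h1, Value.neg, Value.bool]

theorem SExpr.val_eq {V : SValuation} {t₁ t₂ : SExpr} {v₁ v₂ : Value} (h₁ : t₁.val V = some v₁)
    (h₂ : t₂.val V = some v₂) : (SExpr.eq t₁ t₂).val V = some (.bool (decide (v₁ = v₂))) := by
  simp [SExpr.val, h₁, h₂, BinOp.eval]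

/-- Implication is restricted to valuations for which both sides are defined. Equality is defined on
any two values, so values for the operands are all that is needed to apply it. -/
theorem SImplies.eq_val {V : SValuation} {g t₁ t₂ : SExpr} {v₁ v₂ : Value}
    (h : SImplies g (.eq t₁ t₂)) (hg : g.val V = some (.bool true)) (h₁ : t₁.val V = some v₁)
    (h₂ : t₂.val V = some v₂) : v₁ = v₂ := by
  have := h V _ hg (SExpr.val_eq h₁ h₂)
  simpa using this

/-! ## Fresh values -/

def Origin.svals : Origin → Set ℕ
  | .read t _ => t.svals
  | .copy t => t.svals

theorem Trace.names_nil : Trace.names [] = ∅ := by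
  ext; simp [Trace.names]

theorem Trace.names_cons (ν : ℕ) (o : Origin) (δ : Trace) :
    Trace.names ((ν, o) :: δ) = insert ν (Trace.names δ) := by
  ext μ; simp [Trace.names, exists_or]

theorem Trace.names_append (δ₁ δ₂ : Trace) :
    Trace.names (δ₁ ++ δ₂) = δ₁.names ∪ δ₂.names := by
  ext μ; simp [Trace.names, exists_or]

theorem Trace.names_finite (δ : Trace) : δ.names.Finite := by
  induction δ with
  | nil => rw [Trace.names_nil]; exact Set.finite_empty
  | cons a δ ih => rw [Trace.names_cons]; exact ih.insert _

/-- The values of the trace are new, and originate from earlier values. -/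
def Trace.Fresh : Set ℕ → Trace → Prop
  | _, [] => True
  | U, (ν, o) :: δ => ν ∉ U ∧ o.svals ⊆ U ∧ Trace.Fresh (insert ν U) δ

theorem Trace.Fresh.append {U : Set ℕ} {δ₁ δ₂ : Trace} (h₁ : δ₁.Fresh U)
    (h₂ : δ₂.Fresh (U ∪ δ₁.names)) : Trace.Fresh U (δ₁ ++ δ₂) := by
  induction δ₁ generalizing U with
  | nil => simpa [Trace.names_nil] using h₂
  | cons a δ ih =>
    obtain ⟨ν, o⟩ := a
    refine ⟨h₁.1, h₁.2.1, ih h₁.2.2 ?_⟩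
    rw [Trace.names_cons] at h₂
    rwa [Set.insert_union, ← Set.union_insert]

theorem Trace.Fresh.concat {U : Set ℕ} {δ : Trace} {ν : ℕ} {o : Origin} (h₁ : δ.Fresh U)
    (hν : ν ∉ U ∪ δ.names) (ho : o.svals ⊆ U ∪ δ.names) : Trace.Fresh U (δ ++ [(ν, o)]) :=
  h₁.append ⟨hν, ho, trivial⟩

theorem Trace.names_concat (δ : Trace) (ν : ℕ) (o : Origin) :
    Trace.names (δ ++ [(ν, o)]) = insert ν δ.names := by
  rw [Trace.names_append, Trace.names_cons, Trace.names_nil]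
  ext; simp

/-- The valuation gives to the values of the trace the values of their origins. -/
def Trace.Consistent (H : Heap) (V : SValuation) (δ : Trace) : Prop :=
  ∀ ν o v, (ν, o) ∈ δ → o.val H V = some v → V ν = v

theorem Trace.Consistent.left {H : Heap} {V : SValuation} {δ₁ δ₂ : Trace}
    (h : Trace.Consistent H V (δ₁ ++ δ₂)) : δ₁.Consistent H V :=
  fun ν o v hν => h ν o v (List.mem_append_left _ hν)

theorem Trace.Consistent.right {H : Heap} {V : SValuation} {δ₁ δ₂ : Trace}
    (h : Trace.Consistent H V (δ₁ ++ δ₂)) : δ₂.Consistent H V :=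
  fun ν o v hν => h ν o v (List.mem_append_right _ hν)

theorem Origin.val_congr {H : Heap} {V V' : SValuation} {o : Origin}
    (h : Set.EqOn V V' o.svals) : o.val H V = o.val H V' := by
  cases o with
  | read t f => simp only [Origin.val, SExpr.val_congr (t := t) h]
  | copy t => exact SExpr.val_congr h

/-- Each fresh value is set once, after everything that its origin mentions, so later updates change
neither it nor its origin. The two resulting properties, agreement on the old values and consistency
with the origins, are all that is used of a corresponding valuation. -/
theorem Trace.Fresh.extend {H : Heap} {U : Set ℕ} {δ : Trace} (h : δ.Fresh U) (V : SValuation) :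
    Set.EqOn V (δ.extend H V) U ∧ δ.Consistent H (δ.extend H V) := by
  induction δ generalizing U V with
  | nil => exact ⟨fun _ _ => rfl, fun _ _ _ h => by cases h⟩
  | cons a δ ih =>
    obtain ⟨ν, o⟩ := a
    obtain ⟨hν, ho, hδ⟩ := h
    -- `V₁` is the valuation after the first entry. If the origin has no value, it is `V` itself,
    -- and consistency demands nothing of this entry.
    obtain ⟨V₁, hV₁, h3, h5⟩ : ∃ V₁, Trace.extend H ((ν, o) :: δ) V = Trace.extend H δ V₁ ∧
        Set.EqOn V V₁ U ∧ ∀ v, o.val H V = some v → V₁ ν = v := by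
      cases ho : o.val H V with
      | none => exact ⟨V, by rw [Trace.extend, ho], fun _ _ => rfl, by simp⟩
      | some v =>
        refine ⟨Function.update V ν v, by rw [Trace.extend, ho], fun μ hμ => ?_, by simp⟩
        rw [Function.update_of_ne (by rintro rfl; exact hν hμ)]
    rw [hV₁]
    obtain ⟨h1, h2⟩ := ih hδ V₁
    have h4 := h3.trans (h1.mono (Set.subset_insert ν U))
    refine ⟨h4, fun μ o' v hμ hv => ?_⟩
    rcases List.mem_cons.1 hμ with hμ | hμ
    · cases hμ
      rw [← Origin.val_congr (h4.mono ho)] at hv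
      rw [← h1 (Set.mem_insert ν U), h5 v hv]
    · exact h2 μ o' v hμ hv

/-- The symbolic values of the state are in the given set. -/
structure SState.Scoped (σ : SState) (U : Set ℕ) : Prop where
  path : σ.g.svals ⊆ U
  chunk : ∀ h ∈ σ.H, h.svals ⊆ U
  optimistic : ∀ c ∈ σ.O, c.svals ⊆ U
  env : ∀ x t, σ.γ x = some t → t.svals ⊆ U

theorem SState.Scoped.mono {σ : SState} {U U' : Set ℕ} (h : σ.Scoped U) (hU : U ⊆ U') :
    σ.Scoped U' :=
  ⟨h.path.trans hU, fun c hc => (h.chunk c hc).trans hU,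
    fun c hc => (h.optimistic c hc).trans hU, fun x t hx => (h.env x t hx).trans hU⟩

theorem SState.scoped_svals (σ : SState) : σ.Scoped σ.svals where
  path _ h := .inl (.inl (.inl h))
  chunk c hc _ h := .inl (.inl (.inr ⟨c, hc, h⟩))
  optimistic c hc _ h := .inl (.inr ⟨c, hc, h⟩)
  env x t hx _ h := .inr ⟨x, t, hx, h⟩

theorem SState.Scoped.svals_subset {σ : SState} {U : Set ℕ} (h : σ.Scoped U) : σ.svals ⊆ U := by
  rintro ν (((hν | ⟨c, hc, hν⟩) | ⟨c, hc, hν⟩) | ⟨x, t, hx, hν⟩)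
  · exact h.path hν
  · exact h.chunk c hc hν
  · exact h.optimistic c hc hν
  · exact h.env x t hx hν

theorem SState.Scoped.and {σ : SState} {U : Set ℕ} (h : σ.Scoped U) {t : SExpr}
    (ht : t.svals ⊆ U) : { σ with g := .and σ.g t }.Scoped U :=
  ⟨Set.union_subset h.path ht, h.chunk, h.optimistic, h.env⟩

theorem SState.Scoped.setEnv {σ : SState} {U : Set ℕ} (h : σ.Scoped U) {γ : SEnv}
    (hγ : ∀ x t, γ x = some t → t.svals ⊆ U) : { σ with γ := γ }.Scoped U :=
  ⟨h.path, h.chunk, h.optimistic, hγ⟩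

theorem SState.Scoped.insertChunk {σ : SState} {U : Set ℕ} (h : σ.Scoped U) {c : Chunk}
    (hc : c.svals ⊆ U) : { σ with H := insert c σ.H }.Scoped U :=
  ⟨h.path, fun c' hc' => by
    rcases Set.mem_insert_iff.1 hc' with rfl | hc'
    · exact hc
    · exact h.chunk c' hc', h.optimistic, h.env⟩

theorem SEnv.update_svals {γ : SEnv} {U : Set ℕ} (h : ∀ x t, γ x = some t → t.svals ⊆ U) {y : Var}
    {u : SExpr} (hu : u.svals ⊆ U) (x : Var) (t : SExpr)
    (hx : Function.update γ y (some u) x = some t) : t.svals ⊆ U := by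
  by_cases hxy : x = y
  · subst hxy
    rw [Function.update_self] at hx
    cases hx
    exact hu
  · rw [Function.update_of_ne hxy] at hx
    exact h x t hx

theorem mkEnv_svals {U : Set ℕ} {xs : List Var} {ts : List SExpr} (h : ∀ t ∈ ts, t.svals ⊆ U)
    (x : Var) (t : SExpr) (hx : mkEnv xs ts x = some t) : t.svals ⊆ U := by
  obtain ⟨b, hb, rfl, h'⟩ := mkEnv_forall₂ (R := fun t b : SExpr => b = t ∧ t.svals ⊆ U)
    (List.forall₂_same.2 fun t ht => ⟨rfl, h t ht⟩) hx
  exact h'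

/-! ### Scope of the symbolic judgements -/

/-- A fresh value is recorded after the evaluation of its receiver, so its origin mentions only
values already in use. This is where the freshness conditions of all traces ultimately come from. -/
theorem SPCEval.scope {σ : SState} {U : Set ℕ} {e : Expr} {t : SExpr} {R : Set Check} {δ : Trace}
    (h : SPCEval σ U e t R δ) (hσ : σ.Scoped U) : δ.Fresh U ∧ t.svals ⊆ U ∪ δ.names := by
  have two : ∀ {U : Set ℕ} {t₁ t₂ : SExpr} {δ₁ δ₂ : Trace}, δ₁.Fresh U ∧ t₁.svals ⊆ U ∪ δ₁.names →
      δ₂.Fresh (U ∪ δ₁.names) ∧ t₂.svals ⊆ U ∪ δ₁.names ∪ δ₂.names →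
      Trace.Fresh U (δ₁ ++ δ₂) ∧ t₁.svals ∪ t₂.svals ⊆ U ∪ Trace.names (δ₁ ++ δ₂) := by
    intro U t₁ t₂ δ₁ δ₂ h1 h2
    refine ⟨h1.1.append h2.1, ?_⟩
    rw [Trace.names_append, ← Set.union_assoc]
    exact Set.union_subset (h1.2.trans Set.subset_union_left) h2.2
  induction h with
  | lit => exact ⟨trivial, Set.empty_subset _⟩
  | var h => exact ⟨trivial, (hσ.env _ _ h).trans Set.subset_union_left⟩
  | or _ _ ih1 ih2 => exact two (ih1 hσ) (ih2 (hσ.mono Set.subset_union_left))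
  | and _ _ ih1 ih2 => exact two (ih1 hσ) (ih2 (hσ.mono Set.subset_union_left))
  | op _ _ ih1 ih2 => exact two (ih1 hσ) (ih2 (hσ.mono Set.subset_union_left))
  | not _ ih => exact ih hσ
  | field _ _ hc ih =>
    exact ⟨(ih hσ).1, (Set.subset_union_right.trans (hσ.chunk _ hc)).trans Set.subset_union_left⟩
  | fieldOptimistic _ _ _ hc ih =>
    exact ⟨(ih hσ).1,
      (Set.subset_union_right.trans (hσ.optimistic _ hc)).trans Set.subset_union_left⟩
  | fieldImprecise _ _ _ _ hν ih | fieldMissing _ _ _ _ hν ih =>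
    refine ⟨(ih hσ).1.concat hν (ih hσ).2, ?_⟩
    rw [Trace.names_concat]
    exact Set.singleton_subset_iff.2 (.inr (Set.mem_insert _ _))

theorem SPCEvalList.scope {σ : SState} {U : Set ℕ} {es : List Expr} {ts : List SExpr}
    {R : Set Check} {δ : Trace} (h : SPCEvalList σ U es ts R δ) (hσ : σ.Scoped U) :
    δ.Fresh U ∧ ∀ t ∈ ts, t.svals ⊆ U ∪ δ.names := by
  induction h with
  | nil => exact ⟨trivial, by simp⟩
  | cons h _ ih =>
    have h1 := h.scope hσ
    have h2 := ih (hσ.mono Set.subset_union_left)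
    refine ⟨h1.1.append h2.1, ?_⟩
    rw [Trace.names_append, ← Set.union_assoc]
    rintro t ht
    rcases List.mem_cons.1 ht with rfl | ht
    · exact h1.2.trans Set.subset_union_left
    · exact h2.2 t ht

theorem SEval.scope {U : Set ℕ} {σ σ' : SState} {e : Expr} {t : SExpr} {R : Set Check} {δ : Trace}
    (h : SEval U σ e t σ' R δ) (hσ : σ.Scoped U) :
    δ.Fresh U ∧ t.svals ⊆ U ∪ δ.names ∧ σ'.Scoped (U ∪ δ.names) := by
  induction h with
  | lit => exact ⟨trivial, Set.empty_subset _, hσ.mono Set.subset_union_left⟩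
  | var h =>
    exact ⟨trivial, (hσ.env _ _ h).trans Set.subset_union_left, hσ.mono Set.subset_union_left⟩
  | orA _ ih => exact ⟨(ih hσ).1, (ih hσ).2.1, (ih hσ).2.2.and (ih hσ).2.1⟩
  | andA _ ih => exact ⟨(ih hσ).1, (ih hσ).2.1, (ih hσ).2.2.and (t := .not _) (ih hσ).2.1⟩
  | orB _ _ ih1 ih2 =>
    obtain ⟨h1, h2, h3⟩ := ih1 hσ
    obtain ⟨h4, h5, h6⟩ := ih2 (h3.and (t := .not _) h2)
    rw [Trace.names_append, ← Set.union_assoc]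
    exact ⟨h1.append h4, h5, h6⟩
  | andB _ _ ih1 ih2 =>
    obtain ⟨h1, h2, h3⟩ := ih1 hσ
    obtain ⟨h4, h5, h6⟩ := ih2 (h3.and h2)
    rw [Trace.names_append, ← Set.union_assoc]
    exact ⟨h1.append h4, h5, h6⟩
  | op _ _ ih1 ih2 =>
    obtain ⟨h1, h2, h3⟩ := ih1 hσ
    obtain ⟨h4, h5, h6⟩ := ih2 h3
    rw [Trace.names_append, ← Set.union_assoc]
    exact ⟨h1.append h4, Set.union_subset (h2.trans Set.subset_union_left) h5, h6⟩
  | not _ ih => exact ih hσ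
  | field _ _ hc ih =>
    exact ⟨(ih hσ).1, Set.subset_union_right.trans ((ih hσ).2.2.chunk _ hc), (ih hσ).2.2⟩
  | fieldOptimistic _ _ hc _ ih =>
    exact ⟨(ih hσ).1, Set.subset_union_right.trans ((ih hσ).2.2.optimistic _ hc), (ih hσ).2.2⟩
  | @fieldImprecise U σ e f tₑ σ' R δ ν _ _ _ _ hν ih =>
    obtain ⟨h1, h2, h3⟩ := ih hσ
    rw [Trace.names_concat]
    have hU : U ∪ δ.names ⊆ U ∪ insert ν δ.names :=
      Set.union_subset_union_right _ (Set.subset_insert _ _)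
    have hν' : (SExpr.sv ν).svals ⊆ U ∪ insert ν δ.names :=
      Set.singleton_subset_iff.2 (.inr (Set.mem_insert _ _))
    have h4 := h3.mono hU
    refine ⟨h1.concat hν h2, hν', h4.path, h4.chunk, ?_, h4.env⟩
    rintro c (rfl | hc)
    · exact Set.union_subset (h2.trans hU) hν'
    · exact h4.optimistic c hc
  | fieldFailure _ _ _ _ hν ih =>
    obtain ⟨h1, h2, h3⟩ := ih hσ
    rw [Trace.names_concat]
    exact ⟨h1.concat hν h2, Set.singleton_subset_iff.2 (.inr (Set.mem_insert _ _)),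
      h3.mono (Set.union_subset_union_right _ (Set.subset_insert _ _))⟩

theorem SEvalList.scope {U : Set ℕ} {σ σ' : SState} {es : List Expr} {ts : List SExpr}
    {R : Set Check} {δ : Trace} (h : SEvalList U σ es ts σ' R δ) (hσ : σ.Scoped U) :
    δ.Fresh U ∧ (∀ t ∈ ts, t.svals ⊆ U ∪ δ.names) ∧ σ'.Scoped (U ∪ δ.names) := by
  induction h with
  | nil => exact ⟨trivial, by simp, hσ.mono Set.subset_union_left⟩
  | cons h _ ih =>
    obtain ⟨h1, h2, h3⟩ := h.scope hσ
    obtain ⟨h4, h5, h6⟩ := ih h3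
    rw [Trace.names_append, ← Set.union_assoc]
    refine ⟨h1.append h4, ?_, h6⟩
    rintro t ht
    rcases List.mem_cons.1 ht with rfl | ht
    · exact h2.trans Set.subset_union_left
    · exact h5 t ht

theorem SProduceF.scope {U : Set ℕ} {σ σ' : SState} {φ : Formula} {δ : Trace}
    (h : SProduceF U σ φ σ' δ) (hσ : σ.Scoped U) : δ.Fresh U ∧ σ'.Scoped (U ∪ δ.names) := by
  induction h with
  | expr h => exact ⟨(h.scope hσ).1, (hσ.mono Set.subset_union_left).and (h.scope hσ).2⟩
  | pred h =>
    refine ⟨(h.scope hσ).1, (hσ.mono Set.subset_union_left).insertChunk ?_⟩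
    rintro ν ⟨t, ht, hν⟩
    exact (h.scope hσ).2 t ht hν
  | @acc U σ e f tₑ R δ ν h hν =>
    obtain ⟨h1, h2⟩ := h.scope hσ
    rw [Trace.names_concat]
    exact ⟨h1.concat hν h2, (hσ.mono Set.subset_union_left).insertChunk (Set.union_subset
      (h2.trans (Set.union_subset_union_right _ (Set.subset_insert _ _)))
      (Set.singleton_subset_iff.2 (.inr (Set.mem_insert _ _))))⟩
  | sep _ _ ih1 ih2 =>
    obtain ⟨h1, h2⟩ := ih1 hσ
    obtain ⟨h3, h4⟩ := ih2 h2
    rw [Trace.names_append, ← Set.union_assoc]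
    exact ⟨h1.append h3, h4⟩
  | iteA h _ ih =>
    obtain ⟨h1, h2⟩ := h.scope hσ
    obtain ⟨h3, h4⟩ := ih ((hσ.mono Set.subset_union_left).and h2)
    rw [Trace.names_append, ← Set.union_assoc]
    exact ⟨h1.append h3, h4⟩
  | iteB h _ ih =>
    obtain ⟨h1, h2⟩ := h.scope hσ
    obtain ⟨h3, h4⟩ := ih ((hσ.mono Set.subset_union_left).and (t := .not _) h2)
    rw [Trace.names_append, ← Set.union_assoc]
    exact ⟨h1.append h3, h4⟩

theorem SProduce.scope {U : Set ℕ} {σ σ' : SState} {φ : GFormula} {δ : Trace}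
    (h : SProduce U σ φ σ' δ) (hσ : σ.Scoped U) : δ.Fresh U ∧ σ'.Scoped (U ∪ δ.names) := by
  cases h with
  | precise h => exact h.scope hσ
  | imprecise h => exact h.scope ⟨hσ.path, hσ.chunk, hσ.optimistic, hσ.env⟩

/-- The second state has fewer chunks and a stronger path condition. -/
structure SState.Shrinks (σ σ' : SState) : Prop where
  chunk : σ'.H ⊆ σ.H
  optimistic : σ'.O ⊆ σ.O
  env : σ'.γ = σ.γ
  path : ∀ V, σ'.g.val V = some (.bool true) → σ.g.val V = some (.bool true)

theorem SState.Shrinks.refl (σ : SState) : σ.Shrinks σ := ⟨subset_rfl, subset_rfl, rfl, fun _ h => h⟩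

theorem SState.Shrinks.trans {σ σ' σ'' : SState} (h : σ.Shrinks σ') (h' : σ'.Shrinks σ'') :
    σ.Shrinks σ'' :=
  ⟨h'.chunk.trans h.chunk, h'.optimistic.trans h.optimistic, h'.env.trans h.env,
    fun V hV => h.path V (h'.path V hV)⟩

theorem SState.Shrinks.and (σ : SState) (t : SExpr) : σ.Shrinks { σ with g := .and σ.g t } :=
  ⟨subset_rfl, subset_rfl, rfl, fun _ hV => (SExpr.val_and.1 hV).1⟩

theorem remF_subset (O : Set FChunk) (σ : SState) (t : SExpr) (f : FieldName) :
    remF O σ t f ⊆ O := fun _ h => h.1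

theorem remFH_subset (H : Set Chunk) (σ : SState) (t : SExpr) (f : FieldName) :
    remFH H σ t f ⊆ H := fun _ ⟨_, _, h, _⟩ => h

theorem remFP_subset (H : Set Chunk) (σ : SState) (t : SExpr) (f : FieldName) :
    remFP H σ t f ⊆ H := by
  rintro h (⟨_, _, h, _⟩ | ⟨_, _, _, h⟩) <;> exact h

theorem SConsumeF.shrinks {U : Set ℕ} {σ σE σ' : SState} {φ : Formula} {R : Set Check}
    {Θ : Set SPerm} {δ : Trace} (h : SConsumeF U σ σE φ σ' R Θ δ) :
    σ.Shrinks σ' ∧ σ'.imp = σ.imp := by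
  induction h with
  | value | valueFailure | predFailure | accFailure => exact ⟨.refl _, rfl⟩
  | valueImprecise => exact ⟨.and _ _, rfl⟩
  | pred => exact ⟨⟨Set.sdiff_subset, Set.empty_subset _, rfl, fun _ h => h⟩, rfl⟩
  | predImprecise => exact ⟨⟨Set.empty_subset _, Set.empty_subset _, rfl, fun _ h => h⟩, rfl⟩
  | acc => exact ⟨⟨remFP_subset _ _ _ _, remF_subset _ _ _ _, rfl, fun _ h => h⟩, rfl⟩
  | accOptimistic | accImprecise =>
    exact ⟨⟨remFH_subset _ _ _ _, remF_subset _ _ _ _, rfl, fun _ h => h⟩, rfl⟩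
  | sep _ _ _ ih1 ih2 | sepImprecise _ _ _ ih1 ih2 =>
    exact ⟨ih1.1.trans ih2.1, ih2.2.trans ih1.2⟩
  | iteA _ _ ih | iteB _ _ ih => exact ⟨(SState.Shrinks.and _ _).trans ih.1, ih.2⟩

theorem SState.Scoped.shrinks {σ σ' : SState} {U : Set ℕ} (hσ : σ.Scoped U) (h : σ.Shrinks σ')
    (hg : σ'.g.svals ⊆ U) : σ'.Scoped U :=
  ⟨hg, fun c hc => hσ.chunk c (h.chunk hc), fun c hc => hσ.optimistic c (h.optimistic hc),
    fun x t hx => hσ.env x t (h.env ▸ hx)⟩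

theorem SConsumeF.scope {U : Set ℕ} {σ σE σ' : SState} {φ : Formula} {R : Set Check}
    {Θ : Set SPerm} {δ : Trace} (h : SConsumeF U σ σE φ σ' R Θ δ) (hσ : σ.Scoped U)
    (hE : σE.Scoped U) : δ.Fresh U ∧ σ'.g.svals ⊆ U ∪ δ.names := by
  have setPath : ∀ {σE : SState} {U : Set ℕ} {g : SExpr}, σE.Scoped U → g.svals ⊆ U →
      SState.Scoped { σE with g := g } U := fun h hg => ⟨hg, h.chunk, h.optimistic, h.env⟩
  induction h with
  | value h | valueFailure _ h =>
    exact ⟨(h.scope hE).1, hσ.path.trans Set.subset_union_left⟩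
  | acc h | accOptimistic h | accImprecise _ h | accFailure _ h =>
    exact ⟨(h.scope hE).1, hσ.path.trans Set.subset_union_left⟩
  | pred h | predImprecise _ h | predFailure _ h =>
    exact ⟨(h.scope hE).1, hσ.path.trans Set.subset_union_left⟩
  | valueImprecise _ h =>
    exact ⟨(h.scope hE).1,
      Set.union_subset (hσ.path.trans Set.subset_union_left) (h.scope hE).2⟩
  | sep h _ _ ih1 ih2 | sepImprecise h _ _ ih1 ih2 =>
    obtain ⟨h1, h2⟩ := ih1 hσ hE
    obtain ⟨h3, h4⟩ := ih2 ((hσ.mono Set.subset_union_left).shrinks h.shrinks.1 h2)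
      (setPath (hE.mono Set.subset_union_left) h2)
    rw [Trace.names_append, ← Set.union_assoc]
    exact ⟨h1.append h3, h4⟩
  | iteA h _ ih =>
    obtain ⟨h1, h2⟩ := h.scope hE
    have h5 := (hσ.mono Set.subset_union_left).and h2
    obtain ⟨h3, h4⟩ := ih h5 (setPath (hE.mono Set.subset_union_left) h5.path)
    rw [Trace.names_append, ← Set.union_assoc]
    exact ⟨h1.append h3, h4⟩
  | iteB h _ ih =>
    obtain ⟨h1, h2⟩ := h.scope hE
    have h5 := (hσ.mono Set.subset_union_left).and (t := .not _) h2
    obtain ⟨h3, h4⟩ := ih h5 (setPath (hE.mono Set.subset_union_left) h5.path)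
    rw [Trace.names_append, ← Set.union_assoc]
    exact ⟨h1.append h3, h4⟩

theorem SConsume.shrinks {U : Set ℕ} {σ σ' : SState} {φ : GFormula} {R : Set Check} {δ : Trace}
    (h : SConsume U σ φ σ' R δ) : σ.Shrinks σ' := by
  cases h with
  | precise h => exact h.shrinks.1
  | imprecise h =>
    exact ⟨Set.empty_subset _, Set.empty_subset _, h.shrinks.1.env, h.shrinks.1.path⟩

theorem SConsume.scope {U : Set ℕ} {σ σ' : SState} {φ : GFormula} {R : Set Check} {δ : Trace}
    (h : SConsume U σ φ σ' R δ) (hσ : σ.Scoped U) :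
    δ.Fresh U ∧ σ'.Scoped (U ∪ δ.names) := by
  have h0 := h.shrinks
  suffices δ.Fresh U ∧ σ'.g.svals ⊆ U ∪ δ.names from
    ⟨this.1, (hσ.mono Set.subset_union_left).shrinks h0 this.2⟩
  cases h with
  | precise h => exact h.scope hσ hσ
  | imprecise h => exact h.scope hσ ⟨hσ.path, hσ.chunk, hσ.optimistic, hσ.env⟩

theorem Havoc.scope {U : Set ℕ} {γ γ' : SEnv} {xs : List Var} {δ : Trace}
    (h : Havoc U γ xs γ' δ) (hγ : ∀ x t, γ x = some t → t.svals ⊆ U) :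
    δ.Fresh U ∧ ∀ x t, γ' x = some t → t.svals ⊆ U ∪ δ.names := by
  induction h with
  | nil => exact ⟨trivial, fun x t hx => (hγ x t hx).trans Set.subset_union_left⟩
  | undef _ _ ih => exact ih hγ
  | @cons U γ x xs t ν γ' δ hx hν _ ih =>
    obtain ⟨h1, h2⟩ := ih (SEnv.update_svals
      (fun y u hy => (hγ y u hy).trans (Set.subset_insert _ _))
      (Set.singleton_subset_iff.2 (Set.mem_insert _ _)))
    refine ⟨⟨hν, hγ x t hx, h1⟩, ?_⟩
    rw [Trace.names_cons, Set.union_insert, ← Set.insert_union]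
    exact h2

theorem Havoc.eq_none {U : Set ℕ} {γ γ' : SEnv} {xs : List Var} {δ : Trace}
    (h : Havoc U γ xs γ' δ) (x : Var) : γ' x = none ↔ γ x = none := by
  induction h with
  | nil => rfl
  | undef _ _ ih => exact ih
  | @cons U γ y xs t ν γ' δ hy _ _ ih =>
    rw [ih]
    by_cases hxy : x = y
    · subst hxy; simp [hy]
    · rw [Function.update_of_ne hxy]

theorem Havoc.eq_of_not_mem {U : Set ℕ} {γ γ' : SEnv} {xs : List Var} {δ : Trace}
    (h : Havoc U γ xs γ' δ) {x : Var} (hx : x ∉ xs) : γ' x = γ x := by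
  induction h with
  | nil => rfl
  | undef _ _ ih => exact ih fun h => hx (by simp [h])
  | cons _ _ _ ih =>
    rw [ih fun h => hx (by simp [h]), Function.update_of_ne (by rintro rfl; simp at hx)]

/-! ## Effect of the symbolic judgements on the components of a state -/

/-- The second state differs from the first in a stronger path condition, and, if the state is
imprecise, in more optimistic chunks. -/
structure SState.Extends (σ σ' : SState) : Prop where
  chunk : σ'.H = σ.H
  env : σ'.γ = σ.γ
  imp : σ'.imp = σ.imp
  optimistic : σ.imp = false → σ'.O = σ.O
  path : ∀ V, σ'.g.val V = some (.bool true) → σ.g.val V = some (.bool true)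

theorem SState.Extends.refl (σ : SState) : σ.Extends σ :=
  ⟨rfl, rfl, rfl, fun _ => rfl, fun _ h => h⟩

theorem SState.Extends.trans {σ σ' σ'' : SState} (h : σ.Extends σ') (h' : σ'.Extends σ'') :
    σ.Extends σ'' :=
  ⟨h'.chunk.trans h.chunk, h'.env.trans h.env, h'.imp.trans h.imp,
    fun hi => (h'.optimistic (h.imp.trans hi)).trans (h.optimistic hi),
    fun V hV => h.path V (h'.path V hV)⟩

theorem SState.Extends.and (σ : SState) (t : SExpr) : σ.Extends { σ with g := .and σ.g t } :=
  ⟨rfl, rfl, rfl, fun _ => rfl, fun _ hV => (SExpr.val_and.1 hV).1⟩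

theorem SEval.extends {U : Set ℕ} {σ σ' : SState} {e : Expr} {t : SExpr} {R : Set Check}
    {δ : Trace} (h : SEval U σ e t σ' R δ) : σ.Extends σ' := by
  induction h with
  | lit | var => exact .refl _
  | orA _ ih | andA _ ih => exact ih.trans (.and _ _)
  | orB _ _ ih1 ih2 | andB _ _ ih1 ih2 => exact (ih1.trans (.and _ _)).trans ih2
  | op _ _ ih1 ih2 => exact ih1.trans ih2
  | not _ ih => exact ih
  | field _ _ _ ih => exact ih
  | fieldOptimistic _ _ _ _ ih => exact ih
  | fieldImprecise hi _ _ _ _ ih =>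
    refine ih.trans ⟨rfl, rfl, rfl, fun h => ?_, fun _ h => h⟩
    rw [ih.imp, hi] at h
    cases h
  | fieldFailure _ _ _ _ _ ih => exact ih

theorem SEvalList.extends {U : Set ℕ} {σ σ' : SState} {es : List Expr} {ts : List SExpr}
    {R : Set Check} {δ : Trace} (h : SEvalList U σ es ts σ' R δ) : σ.Extends σ' := by
  induction h with
  | nil => exact .refl _
  | cons h _ ih => exact h.extends.trans ih

theorem SProduceF.props {U : Set ℕ} {σ σ' : SState} {φ : Formula} {δ : Trace}
    (h : SProduceF U σ φ σ' δ) : σ'.γ = σ.γ ∧ σ'.O = σ.O ∧ σ'.imp = σ.imp ∧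
      ∀ V, σ'.g.val V = some (.bool true) → σ.g.val V = some (.bool true) := by
  induction h with
  | expr => exact ⟨rfl, rfl, rfl, fun _ hV => (SExpr.val_and.1 hV).1⟩
  | pred | acc => exact ⟨rfl, rfl, rfl, fun _ h => h⟩
  | sep _ _ ih1 ih2 =>
    exact ⟨ih2.1.trans ih1.1, ih2.2.1.trans ih1.2.1, ih2.2.2.1.trans ih1.2.2.1,
      fun V hV => ih1.2.2.2 V (ih2.2.2.2 V hV)⟩
  | iteA _ _ ih | iteB _ _ ih =>
    exact ⟨ih.1, ih.2.1, ih.2.2.1, fun V hV => (SExpr.val_and.1 (ih.2.2.2 V hV)).1⟩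

theorem SProduce.props {U : Set ℕ} {σ σ' : SState} {φ : GFormula} {δ : Trace}
    (h : SProduce U σ φ σ' δ) : σ'.γ = σ.γ ∧ σ'.O = σ.O ∧ (σ'.imp = false → σ.imp = false) ∧
      ∀ V, σ'.g.val V = some (.bool true) → σ.g.val V = some (.bool true) := by
  cases h with
  | precise h => exact ⟨h.props.1, h.props.2.1, fun hi => h.props.2.2.1.symm.trans hi, h.props.2.2.2⟩
  | imprecise h =>
    refine ⟨h.props.1, h.props.2.1, fun hi => ?_, h.props.2.2.2⟩
    cases h.props.2.2.1.symm.trans hi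

/-- A precise state has no optimistic chunks. -/
def SState.OptOK (σ : SState) : Prop := σ.imp = false → σ.O = ∅

theorem SState.OptOK.extends {σ σ' : SState} (hσ : σ.OptOK) (h : σ.Extends σ') : σ'.OptOK :=
  fun hi => (h.optimistic (h.imp.symm.trans hi)).trans (hσ (h.imp.symm.trans hi))

theorem SConsumeF.optOK {U : Set ℕ} {σ σE σ' : SState} {φ : Formula} {R : Set Check}
    {Θ : Set SPerm} {δ : Trace} (h : SConsumeF U σ σE φ σ' R Θ δ) (hσ : σ.OptOK) : σ'.OptOK :=
  fun hi => Set.subset_empty_iff.1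
    (hσ (h.shrinks.2.symm.trans hi) ▸ h.shrinks.1.optimistic)

theorem SConsume.optOK {U : Set ℕ} {σ σ' : SState} {φ : GFormula} {R : Set Check} {δ : Trace}
    (h : SConsume U σ φ σ' R δ) (hσ : σ.OptOK) : σ'.OptOK := by
  cases h with
  | precise h => exact h.optOK hσ
  | imprecise h => exact fun _ => rfl

theorem SProduce.optOK {U : Set ℕ} {σ σ' : SState} {φ : GFormula} {δ : Trace}
    (h : SProduce U σ φ σ' δ) (hσ : σ.OptOK) : σ'.OptOK :=
  fun hi => h.props.2.1.trans (hσ (h.props.2.2.1 hi))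

/-! ## Invariants of reachable verification states -/

def SState.dom (σ : SState) : Set Var := {x | σ.γ x ≠ none}

/-- Finiteness ensures that fresh symbolic values can be chosen. The condition on optimistic chunks
matters because correspondence does not separate them from other chunks. Initialisation gives a
symbolic value to every variable that must be evaluated. -/
structure VerifInv (σ : SState) (s : Stmt) : Prop where
  finite : σ.svals.Finite
  optOK : σ.OptOK
  init : s.InitOK σ.dom

theorem SState.Scoped.finite {σ : SState} {U : Set ℕ} (h : σ.Scoped U) (hU : U.Finite) :
    σ.svals.Finite := hU.subset h.svals_subset

theorem SEnv.insert_dom {γ : SEnv} {x : Var} {t : SExpr} :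
    insert x {y | γ y ≠ none} ⊆ {y | Function.update γ x (some t) y ≠ none} := by
  intro y hy
  by_cases hyx : y = x
  · subst hyx; simp
  · simpa [Function.update_of_ne hyx, hyx] using hy

theorem VerifInv.step {P : Program} {σ σ' : SState} {s s' : Stmt} (h : VerifInv σ s)
    (hs : SExec P σ s s' σ') : VerifInv σ' s' := by
  have hσ := σ.scoped_svals
  have hf := h.finite
  have fin1 : ∀ δ : Trace, (σ.svals ∪ δ.names).Finite := fun δ => hf.union δ.names_finite
  cases hs with
  | seq => exact ⟨hf, h.optOK, h.init.2⟩
  | @assign x e s t σ₁ R δ he =>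
    obtain ⟨h1, h2, h3⟩ := he.scope hσ
    refine ⟨SState.Scoped.finite (h3.setEnv (SEnv.update_svals (he.extends.env ▸ h3.env) h2))
      (fin1 δ), ?_, h.init.2.mono SEnv.insert_dom⟩
    exact show σ₁.OptOK from h.optOK.extends he.extends
  | @assignField x f e s t σ₁ R δ σ₂ R' δ' tₓ he hc hx =>
    obtain ⟨h1, h2, h3⟩ := he.scope hσ
    obtain ⟨h4, h5⟩ := hc.scope h3
    refine ⟨SState.Scoped.finite (h5.insertChunk ?_) ((fin1 δ).union δ'.names_finite), ?_,
      h.init.2.mono ?_⟩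
    · exact Set.union_subset (h5.env x _ hx) (h2.trans Set.subset_union_left)
    · exact hc.optOK (show σ₁.OptOK from h.optOK.extends he.extends)
    · intro y hy
      change σ₂.γ y ≠ none
      rw [hc.shrinks.env, he.extends.env]
      exact hy
  | @alloc x S s ν fs hν hS =>
    have h1 := hσ.mono (Set.subset_insert ν _)
    have h2 : (SExpr.sv ν).svals ⊆ insert ν σ.svals :=
      Set.singleton_subset_iff.2 (Set.mem_insert _ _)
    refine ⟨SState.Scoped.finite (U := insert ν σ.svals) ⟨h1.path, ?_, h1.optimistic,
      SEnv.update_svals h1.env h2⟩ (hf.insert ν), h.optOK, h.init.2.mono SEnv.insert_dom⟩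
    rintro c (hc | ⟨fT, _, rfl⟩)
    · exact h1.chunk c hc
    · exact Set.union_subset h2 (Set.empty_subset _)
  | @call y m es s d ts σ₁ R₁ δ₁ σ₂ R₂ δ₂ ν σ₃ δ₃ hm he hc hν hp =>
    obtain ⟨h1, h2, h3⟩ := he.scope hσ
    obtain ⟨h4, h5⟩ := hc.scope (h3.setEnv (mkEnv_svals h2))
    have h6 := h5.mono (Set.subset_insert ν _)
    have hν' : (SExpr.sv ν).svals ⊆ insert ν (σ.svals ∪ δ₁.names ∪ δ₂.names) :=
      Set.singleton_subset_iff.2 (Set.mem_insert _ _)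
    obtain ⟨h7, h8⟩ := hp.scope (h6.setEnv (SEnv.update_svals (mkEnv_svals fun t ht =>
      (h2 t ht).trans (Set.subset_union_left.trans (Set.subset_insert _ _))) hν'))
    refine ⟨SState.Scoped.finite (h8.setEnv (SEnv.update_svals ?_
      (hν'.trans Set.subset_union_left)))
      ((((fin1 δ₁).union δ₂.names_finite).insert ν).union δ₃.names_finite), ?_,
      h.init.2.mono SEnv.insert_dom⟩
    · intro x t hx
      refine (hσ.env x t hx).trans fun _ h => ?_
      exact .inl (.inr (.inl (.inl h)))
    · exact hp.optOK (hc.optOK (show σ₁.OptOK from h.optOK.extends he.extends))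
  | @assert φ s σ₁ R δ σ₂ δ' hc hp =>
    obtain ⟨h4, h5⟩ := hc.scope hσ
    obtain ⟨h7, h8⟩ := hp.scope h5
    have h9 := hσ.mono (Set.subset_union_left.trans
      (Set.subset_union_left : _ ⊆ σ.svals ∪ δ.names ∪ δ'.names))
    exact ⟨SState.Scoped.finite (U := σ.svals ∪ δ.names ∪ δ'.names) ⟨h8.path, h9.chunk,
      h9.optimistic, h9.env⟩ ((fin1 δ).union δ'.names_finite), h.optOK, h.init.2⟩
  | @foldPred p es s d ts σ₁ R₁ δ₁ σ₂ R₂ δ₂ hd he hc =>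
    obtain ⟨h1, h2, h3⟩ := he.scope hσ
    obtain ⟨h4, h5⟩ := hc.scope (h3.setEnv (mkEnv_svals h2))
    refine ⟨SState.Scoped.finite ((h5.insertChunk (c := .pred p ts) ?_).setEnv (γ := σ.γ) ?_)
      ((fin1 δ₁).union δ₂.names_finite), hc.optOK (show σ₁.OptOK from h.optOK.extends he.extends), h.init.2⟩
    · rintro ν ⟨t, ht, hν⟩
      exact .inl (h2 t ht hν)
    · exact fun x t hx => (hσ.env x t hx).trans (Set.subset_union_left.trans Set.subset_union_left)
  | @unfoldPred p es s d ts σ₁ R₁ δ₁ σ₂ R₂ δ₂ σ₃ δ₃ hd he hc hp =>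
    obtain ⟨h1, h2, h3⟩ := he.scope hσ
    obtain ⟨h4, h5⟩ := hc.scope h3
    obtain ⟨h7, h8⟩ := hp.scope (h5.setEnv (mkEnv_svals fun t ht =>
      (h2 t ht).trans Set.subset_union_left))
    refine ⟨SState.Scoped.finite (h8.setEnv (γ := σ.γ) fun x t hx => (hσ.env x t hx).trans ?_)
      (((fin1 δ₁).union δ₂.names_finite).union δ₃.names_finite),
      hp.optOK (hc.optOK (show σ₁.OptOK from h.optOK.extends he.extends)), h.init.2⟩
    exact fun _ h => .inl (.inl (.inl h))
  | @iteA e s₁ s₂ s t σ₁ R δ he =>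
    obtain ⟨h1, h2, h3⟩ := he.scope hσ
    refine ⟨(h3.and h2).finite (fin1 δ), show σ₁.OptOK from h.optOK.extends he.extends,
      (Stmt.initOK_append _ _ _).2 ?_⟩
    change s₁.InitOK σ₁.dom ∧ s.InitOK (s₁.defs σ₁.dom)
    rw [SState.dom, he.extends.env]
    exact ⟨h.init.1.2.1, h.init.2.mono Set.inter_subset_left⟩
  | @iteB e s₁ s₂ s t σ₁ R δ he =>
    obtain ⟨h1, h2, h3⟩ := he.scope hσ
    refine ⟨(h3.and (t := .not _) h2).finite (fin1 δ), show σ₁.OptOK from h.optOK.extends he.extends,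
      (Stmt.initOK_append _ _ _).2 ?_⟩
    change s₂.InitOK σ₁.dom ∧ s.InitOK (s₂.defs σ₁.dom)
    rw [SState.dom, he.extends.env]
    exact ⟨h.init.1.2.2, h.init.2.mono Set.inter_subset_right⟩
  | @loopSkip e φ b s σ₁ R δ₁ γ' δ₂ σ₂ δ₃ t R' δ₄ hc hh hp he =>
    obtain ⟨h4, h5⟩ := hc.scope hσ
    obtain ⟨h6, h6'⟩ := hh.scope h5.env
    obtain ⟨h7, h8⟩ := hp.scope ((h5.mono Set.subset_union_left).setEnv h6')
    obtain ⟨h9, h10⟩ := he.scope h8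
    refine ⟨((h8.mono Set.subset_union_left).and (t := .not _) h10).finite
      ((((fin1 δ₁).union δ₂.names_finite).union δ₃.names_finite).union δ₄.names_finite),
      hp.optOK (hc.optOK h.optOK), h.init.2.mono ?_⟩
    intro x hx
    change σ₂.γ x ≠ none
    rw [hp.props.1]
    change γ' x ≠ none
    rw [Ne, hh.eq_none, hc.shrinks.env]
    exact hx

theorem VTrans.inv {P : Program} (hP : P.WellFormed) {Sg Sg' : VState} (h : VTrans P Sg Sg') :
    ∀ σ s φ, Sg' = .run σ s φ → VerifInv σ s := by
  induction h with
  | init =>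
    rintro σ s φ ⟨⟩
    -- Any type environment serves here, as only the equivalence about initialisation is used.
    refine ⟨?_, fun _ => rfl, ((Stmt.norm_props (P := P) (Δ := fun _ => none) _).2.2 _).2
      (hP.entry_init.mono (Set.empty_subset _))⟩
    refine Set.finite_empty.subset (SState.Scoped.svals_subset ⟨?_, ?_, ?_, ?_⟩)
    · exact subset_rfl
    · rintro c ⟨⟩
    · rintro c ⟨⟩
    · rintro x t ⟨⟩
  | @method m d νs σ δ hm hn hl hp =>
    rintro σ s φ ⟨⟩
    have h0 : SState.Scoped (SState.empty (mkEnv d.vars (νs.map SExpr.sv))) {ν | ν ∈ νs} := by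
      refine ⟨Set.empty_subset _, ?_, ?_, mkEnv_svals ?_⟩
      · rintro c ⟨⟩
      · rintro c ⟨⟩
      · intro t ht
        obtain ⟨ν, hν, rfl⟩ := List.mem_map.1 ht
        exact Set.singleton_subset_iff.2 hν
    refine ⟨(hp.scope h0).2.finite (νs.finite_toSet.union δ.names_finite),
      hp.optOK fun _ => rfl, (Stmt.initOK_append _ _ _).2
      ⟨(hP.methods _ _ hm).body_init.mono ?_, trivial⟩⟩
    intro x hx
    change σ.γ x ≠ none
    rw [hp.props.1]
    obtain ⟨t, ht⟩ := mkEnv_isSome (as := νs.map SExpr.sv) (by simpa using hl) hx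
    change mkEnv _ _ _ ≠ none
    rw [ht]
    simp
  | @loopBody Sg σ₀ e φ b s φ₀ γ' δ₁ σ₀' δ₂ t R δ₃ _ hh hp he ih =>
    rintro σ s φ ⟨⟩
    have h := ih _ _ _ rfl
    have hσ := σ₀.scoped_svals
    obtain ⟨h6, h6'⟩ := hh.scope hσ.env
    obtain ⟨h7, h8⟩ := hp.scope (σ := ⟨false, σ₀.g, ∅, ∅, γ'⟩)
      ⟨hσ.path.trans Set.subset_union_left, fun c hc => hc.elim, fun c hc => hc.elim, h6'⟩
    obtain ⟨h9, h10⟩ := he.scope h8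
    refine ⟨((h8.mono Set.subset_union_left).and h10).finite
      (((h.finite.union δ₁.names_finite).union δ₂.names_finite).union δ₃.names_finite),
      hp.optOK fun _ => rfl, (Stmt.initOK_append _ _ _).2 ⟨h.init.1.2.2.mono ?_, trivial⟩⟩
    intro x hx
    change σ₀'.γ x ≠ none
    rw [hp.props.1]
    change γ' x ≠ none
    rw [Ne, hh.eq_none]
    exact hx
  | @loop Sg σ e φ b s φ₀ σ' R δ₁ γ' δ₂ σ'' δ₃ _ hc hh hp ih =>
    rintro σ₃ s φ ⟨⟩
    have h := ih _ _ _ rfl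
    have hσ := σ.scoped_svals
    obtain ⟨h4, h5⟩ := hc.scope hσ
    obtain ⟨h6, h6'⟩ := hh.scope h5.env
    obtain ⟨h7, h8⟩ := hp.scope ((h5.mono Set.subset_union_left).setEnv h6')
    refine ⟨h8.finite
      (((h.finite.union δ₁.names_finite).union δ₂.names_finite).union δ₃.names_finite),
      hp.optOK (hc.optOK h.optOK), h.init.mono ?_⟩
    intro x hx
    change σ''.γ x ≠ none
    rw [hp.props.1]
    change γ' x ≠ none
    rw [Ne, hh.eq_none, hc.shrinks.env]
    exact hx
  | step _ hs ih => rintro σ s φ ⟨⟩; exact (ih _ _ _ rfl).step hs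
  | final => rintro σ s φ ⟨⟩

theorem VReachable.inv {P : Program} (hP : P.WellFormed) {σ : SState} {s : Stmt} {φ : GFormula}
    (h : VReachable P (.run σ s φ)) : VerifInv σ s := by
  rcases h with h | ⟨_, h⟩
  · cases h
  · exact h.inv hP _ _ _ rfl

/-! ## Changes of corresponding states -/

theorem SimState.shrinks {P : Program} {V : SValuation} {σ σ' : SState} {H : Heap} {α : Set Perm}
    {ρ : Env} (h : SimState P V σ H α ρ) (hσ : σ.Shrinks σ')
    (hg : σ'.g.val V = some (.bool true)) : SimState P V σ' H α ρ where
  field c hc := h.field c (hσ.chunk hc)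
  pred p ts hc := h.pred p ts (hσ.chunk hc)
  disjoint h₁ hh₁ h₂ hh₂ := h.disjoint h₁ (hσ.chunk hh₁) h₂ (hσ.chunk hh₂)
  optimistic c hc := h.optimistic c (hσ.optimistic hc)
  env x t hx := h.env x t (hσ.env ▸ hx)
  path := hg

theorem SimState.setEnv {P : Program} {V : SValuation} {σ : SState} {H : Heap} {α : Set Perm}
    {ρ ρ' : Env} {γ : SEnv} (h : SimState P V σ H α ρ)
    (hγ : ∀ x t, γ x = some t → ∃ v, t.val V = some v ∧ ρ' x = some v) :
    SimState P V { σ with γ := γ } H α ρ' :=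
  ⟨h.field, h.pred, h.disjoint, h.optimistic, hγ, h.path⟩

theorem SimState.setPath {P : Program} {V : SValuation} {σ : SState} {H : Heap} {α : Set Perm}
    {ρ : Env} {g : SExpr} (h : SimState P V σ H α ρ) (hg : g.val V = some (.bool true)) :
    SimState P V { σ with g := g } H α ρ :=
  ⟨h.field, h.pred, h.disjoint, h.optimistic, h.env, hg⟩

theorem SVals.congr {V V' : SValuation} {ts : List SExpr} {vs : List Value}
    (h : SVals V ts vs) (hV : ∀ t ∈ ts, Set.EqOn V V' t.svals) : SVals V' ts vs := by
  induction h with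
  | nil => exact .nil
  | cons h _ ih =>
    refine .cons ?_ (ih fun t ht => hV t (by simp [ht]))
    rw [← SExpr.val_congr (hV _ (by simp))]
    exact h

theorem SVals.unique {V : SValuation} {ts : List SExpr} {vs ws : List Value}
    (h : SVals V ts vs) (h' : SVals V ts ws) : vs = ws := by
  induction h generalizing ws with
  | nil => cases h'; rfl
  | cons h _ ih =>
    cases h' with
    | cons h1 h2 => rw [ih h2, Option.some.inj (h.symm.trans h1)]

def SPerm.svals : SPerm → Set ℕ
  | .field t _ => t.svals
  | .pred _ ts => {ν | ∃ t ∈ ts, ν ∈ t.svals}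

theorem Chunk.perm_svals (c : Chunk) : c.perm.svals ⊆ c.svals := by
  cases c with
  | field c => exact Set.subset_union_left
  | pred p ts => exact subset_rfl

theorem vfoot_congr {P : Program} {V V' : SValuation} {H : Heap} {θ : SPerm}
    (hV : Set.EqOn V V' θ.svals) : vfoot P V H θ = vfoot P V' H θ := by
  cases θ with
  | field t f => simp only [vfoot, SExpr.val_congr (t := t) hV]
  | pred p ts =>
    have h1 : ∀ t ∈ ts, Set.EqOn V V' t.svals := fun t ht =>
    hV.mono (show t.svals ⊆ {ν | ∃ t ∈ ts, ν ∈ t.svals} from fun ν hν => ⟨t, ht, hν⟩)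
    ext a
    exact ⟨fun ⟨d, vs, h2, h3, h4⟩ => ⟨d, vs, h2, h3.congr h1, h4⟩,
      fun ⟨d, vs, h2, h3, h4⟩ => ⟨d, vs, h2, h3.congr fun t ht => (h1 t ht).symm, h4⟩⟩

theorem FChunk.Holds.congr {V V' : SValuation} {H : Heap} {α : Set Perm} {c : FChunk}
    (h : c.Holds V H α) (hV : Set.EqOn V V' c.svals) : c.Holds V' H α := by
  obtain ⟨l, h1, h2, h3⟩ := h
  refine ⟨l, ?_, ?_, h3⟩
  · rw [← SExpr.val_congr (hV.mono Set.subset_union_left)]; exact h1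
  · rw [← SExpr.val_congr (hV.mono Set.subset_union_right)]; exact h2

/-- Correspondence looks at the valuation only through symbolic values that occur in the state, so
extending the valuation to fresh values is harmless. -/
theorem SimState.congr {P : Program} {V V' : SValuation} {σ : SState} {H : Heap} {α : Set Perm}
    {ρ : Env} {U : Set ℕ} (h : SimState P V σ H α ρ) (hσ : σ.Scoped U) (hV : Set.EqOn V V' U) :
    SimState P V' σ H α ρ where
  field c hc := (h.field c hc).congr (hV.mono (hσ.chunk _ hc))
  pred p ts hc := by
    obtain ⟨d, vs, h1, h2, h3⟩ := h.pred p ts hc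
    exact ⟨d, vs, h1, h2.congr fun t ht =>
      hV.mono (Set.Subset.trans (show t.svals ⊆ (Chunk.pred p ts).svals from
        fun ν hν => ⟨t, ht, hν⟩) (hσ.chunk _ hc)), h3⟩
  disjoint h₁ hh₁ h₂ hh₂ hne := by
    rw [← vfoot_congr (hV.mono (h₁.perm_svals.trans (hσ.chunk _ hh₁))),
      ← vfoot_congr (hV.mono (h₂.perm_svals.trans (hσ.chunk _ hh₂)))]
    exact h.disjoint h₁ hh₁ h₂ hh₂ hne
  optimistic c hc := (h.optimistic c hc).congr (hV.mono (hσ.optimistic _ hc))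
  env x t hx := by
    rw [← SExpr.val_congr (hV.mono (hσ.env x t hx))]
    exact h.env x t hx
  path := by
    rw [← SExpr.val_congr (hV.mono hσ.path)]
    exact h.path

/-- The permissions of the chunks of a state. -/
def SState.perms (σ : SState) : Set SPerm :=
  {θ | (∃ h ∈ σ.H, θ = h.perm) ∨ ∃ c ∈ σ.O, θ = .field c.t c.f}

theorem FChunk.Holds.vfoot_subset {P : Program} {V : SValuation} {H : Heap} {α : Set Perm}
    {c : FChunk} (h : c.Holds V H α) : vfoot P V H (.field c.t c.f) ⊆ α := by
  obtain ⟨l, h1, h2, h3⟩ := h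
  rintro ⟨l', f⟩ ⟨h4, h5⟩
  cases h1.symm.trans h4
  cases h5
  exact h3

theorem PredHolds.vfoot_subset {P : Program} (hP : P.PredSpecs) {V : SValuation} {H : Heap}
    {α : Set Perm} {p : PredName} {ts : List SExpr} (h : PredHolds P V H α p ts) :
    vfoot P V H (.pred p ts) ⊆ α := by
  obtain ⟨d, vs, h1, h2, h3⟩ := h
  rintro a ⟨d', vs', h1', h2', ha⟩
  cases h1.symm.trans h1'
  cases h2.unique h2'
  exact h3.efoot_subset hP (hP _ _ h1) ha

/-- For field chunks ownership is part of correspondence. For a predicate chunk it follows because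
the body is a specification, so a valid instance owns its exact footprint. -/
theorem SimState.vfoot_subset {P : Program} (hP : P.PredSpecs) {V : SValuation} {σ : SState}
    {H : Heap} {α : Set Perm} {ρ : Env} (h : SimState P V σ H α ρ) {θ : SPerm}
    (hθ : θ ∈ σ.perms) : vfoot P V H θ ⊆ α := by
  rcases hθ with ⟨c, hc, rfl⟩ | ⟨c, hc, rfl⟩
  · cases c with
    | field c => exact (h.field c hc).vfoot_subset
    | pred p ts => exact (h.pred p ts hc).vfoot_subset hP
  · exact (h.optimistic c hc).vfoot_subset

theorem FChunk.Holds.restrict {P : Program} {V : SValuation} {H : Heap} {α β : Set Perm}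
    {c : FChunk} (h : c.Holds V H α) (hβ : vfoot P V H (.field c.t c.f) ⊆ β) :
    c.Holds V H β := by
  obtain ⟨l, h1, h2, h3⟩ := h
  exact ⟨l, h1, h2, hβ ⟨h1, rfl⟩⟩

/-- A state corresponds to every set of permissions that contains the footprints of its chunks. -/
theorem SimState.restrict {P : Program} {V : SValuation} {σ : SState} {H : Heap} {α β : Set Perm}
    {ρ : Env} (h : SimState P V σ H α ρ) (hβ : ∀ θ ∈ σ.perms, vfoot P V H θ ⊆ β) :
    SimState P V σ H β ρ where
  field c hc := (h.field c hc).restrict (hβ _ (.inl ⟨_, hc, rfl⟩))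
  pred p ts hc := by
    obtain ⟨d, vs, h1, h2, h3⟩ := h.pred p ts hc
    exact ⟨d, vs, h1, h2, h3.restrict fun a _ ha =>
      hβ _ (.inl ⟨_, hc, rfl⟩) ⟨d, vs, h1, h2, ha⟩⟩
  disjoint := h.disjoint
  optimistic c hc := (h.optimistic c hc).restrict (hβ _ (.inr ⟨_, hc, rfl⟩))
  env := h.env
  path := h.path

theorem SimState.mono {P : Program} (hP : P.PredSpecs) {V : SValuation} {σ : SState} {H : Heap}
    {α β : Set Perm} {ρ : Env} (h : SimState P V σ H α ρ) (hβ : α ⊆ β) : SimState P V σ H β ρ :=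
  h.restrict fun _ hθ => (h.vfoot_subset hP hθ).trans hβ

/-- Correspondence is preserved by changes of the heap outside of the permissions. -/
theorem SimState.heap {P : Program} (hP : P.PredSpecs) {V : SValuation} {σ : SState}
    {H H' : Heap} {α : Set Perm} {ρ : Env} (h : SimState P V σ H α ρ) (hH : H.AgreeOn H' α) :
    SimState P V σ H' α ρ where
  field c hc := by
    obtain ⟨l, h1, h2, h3⟩ := h.field c hc
    exact ⟨l, h1, hH _ _ h3 ▸ h2, h3⟩
  pred p ts hc := by
    obtain ⟨d, vs, h1, h2, h3⟩ := h.pred p ts hc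
    exact ⟨d, vs, h1, h2, h3.heap subset_rfl (h3.efrm hP (hP _ _ h1)) hH⟩
  disjoint h₁ hh₁ h₂ hh₂ hne := by
    -- The footprint of a predicate chunk depends on the heap, but its body is framed by the owned
    -- permissions, on which the heaps agree.
    have key : ∀ c ∈ σ.H, vfoot P V H' c.perm = vfoot P V H c.perm := by
      intro c hc
      cases c with
      | field c => rfl
      | pred p ts =>
        obtain ⟨d, vs, h1, h2, h3⟩ := h.pred p ts hc
        have h4 := (h3.efrm hP (hP _ _ h1)).efoot_heap hH
        ext a
        constructor
        · rintro ⟨d', vs', h1', h2', ha⟩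
          cases h1.symm.trans h1'
          cases h2.unique h2'
          exact ⟨d, vs, h1, h2, h4 ▸ ha⟩
        · rintro ⟨d', vs', h1', h2', ha⟩
          cases h1.symm.trans h1'
          cases h2.unique h2'
          exact ⟨d, vs, h1, h2, h4.symm ▸ ha⟩
    rw [key _ hh₁, key _ hh₂]
    exact h.disjoint h₁ hh₁ h₂ hh₂ hne
  optimistic c hc := by
    obtain ⟨l, h1, h2, h3⟩ := h.optimistic c hc
    exact ⟨l, h1, hH _ _ h3 ▸ h2, h3⟩
  env := h.env
  path := h.path

theorem SimState.insert {P : Program} {V : SValuation} {σ : SState} {H : Heap} {α : Set Perm}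
    {ρ : Env} (h : SimState P V σ H α ρ) {c : Chunk}
    (hf : ∀ c', c = .field c' → c'.Holds V H α)
    (hp : ∀ p ts, c = .pred p ts → PredHolds P V H α p ts)
    (hd : ∀ c' ∈ σ.H, Disjoint (vfoot P V H c'.perm) (vfoot P V H c.perm)) :
    SimState P V { σ with H := insert c σ.H } H α ρ where
  field c' hc' := by
    rcases Set.mem_insert_iff.1 hc' with hc' | hc'
    · exact hf c' hc'.symm
    · exact h.field c' hc'
  pred p ts hc' := by
    rcases Set.mem_insert_iff.1 hc' with hc' | hc'
    · exact hp p ts hc'.symm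
    · exact h.pred p ts hc'
  disjoint h₁ hh₁ h₂ hh₂ hne := by
    rcases Set.mem_insert_iff.1 hh₁ with h1 | h1
    · rcases Set.mem_insert_iff.1 hh₂ with h2 | h2
      · exact (hne (h1.trans h2.symm)).elim
      · exact h1 ▸ Set.disjoint_iff_inter_eq_empty.1 (hd _ h2).symm
    · rcases Set.mem_insert_iff.1 hh₂ with h2 | h2
      · exact h2 ▸ Set.disjoint_iff_inter_eq_empty.1 (hd _ h1)
      · exact h.disjoint h₁ h1 h₂ h2 hne
  optimistic := h.optimistic
  env := h.env
  path := h.path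

/-! ## Soundness of symbolic evaluation -/

/-- The field chunks and the environment of the state correspond to the run-time state. -/
structure ValueSim (V : SValuation) (σ : SState) (H : Heap) (α : Set Perm) (ρ : Env) : Prop where
  field : ∀ c, Chunk.field c ∈ σ.H → c.Holds V H α
  optimistic : ∀ c ∈ σ.O, c.Holds V H α
  env : ∀ x t, σ.γ x = some t → ∃ v, t.val V = some v ∧ ρ x = some v

theorem SimState.valueSim {P : Program} {V : SValuation} {σ : SState} {H : Heap} {α : Set Perm}
    {ρ : Env} (h : SimState P V σ H α ρ) : ValueSim V σ H α ρ := ⟨h.field, h.optimistic, h.env⟩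

/-- The chunk may name its object by another expression; the equality implied by the path condition
identifies the two locations. -/
theorem FChunk.Holds.lookup {V : SValuation} {H : Heap} {α : Set Perm} {f : FieldName}
    {g t t' u : SExpr} (h : FChunk.Holds V H α ⟨f, t', u⟩) (hg : g.val V = some (.bool true))
    (ht : SImplies g (.eq t' t)) {v : Value} (hv : t.val V = some v) :
    ∃ l, v = .loc l ∧ u.val V = some (H l f) ∧ (l, f) ∈ α := by
  obtain ⟨l, h1, h2, h3⟩ := h
  exact ⟨l, (ht.eq_val hg h1 hv).symm, h2, h3⟩

/-- Deterministic evaluation visits both operands of a connective, whereas the run-time evaluation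
short-circuits. As the checks of both operands hold, both have values, which are booleans by typing,
and then the two readings of the connective agree. A chunk or a check provides the permission for
every field read, which gives framing as well. -/
theorem SPCEval.sound {P : Program} {Ψ : Loc → Option StructName} {Δ : TyEnv} {V : SValuation}
    {σ : SState} {H : Heap} {α : Set Perm} {ρ : Env} (hH : HeapTy P Ψ H) (hρ : EnvTy Ψ Δ ρ)
    (hσ : ValueSim V σ H α ρ) (hg : σ.g.val V = some (.bool true)) {U : Set ℕ} {e : Expr}
    {t : SExpr} {R : Set Check} {δ : Trace} (h : SPCEval σ U e t R δ) (hδ : δ.Consistent H V)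
    (hR : ∀ r ∈ R, r.Holds P V H α) {T : Ty} (hT : ExprTy P Δ e T) :
    ∃ v, t.val V = some v ∧ Eval H ρ e v ∧ Frm H α ρ e := by
  have left : ∀ {R₁ R₂ : Set Check}, (∀ r ∈ R₁ ∪ R₂, r.Holds P V H α) →
    ∀ r ∈ R₁, r.Holds P V H α := fun h r hr => h r (.inl hr)
  have right : ∀ {R₁ R₂ : Set Check}, (∀ r ∈ R₁ ∪ R₂, r.Holds P V H α) →
    ∀ r ∈ R₂, r.Holds P V H α := fun h r hr => h r (.inr hr)
  induction h generalizing T with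
  | lit => exact ⟨_, rfl, .lit _, .lit _⟩
  | var h =>
    obtain ⟨v, h1, h2⟩ := hσ.env _ _ h
    exact ⟨v, h1, .var h2, .var _⟩
  | or _ _ ih1 ih2 =>
    cases hT with
    | or hT1 hT2 =>
      obtain ⟨v₁, h1, h2, h3⟩ := ih1 hδ.left (left hR) hT1
      obtain ⟨v₂, h4, h5, h6⟩ := ih2 hδ.right (right hR) hT2
      obtain ⟨b₁, rfl⟩ := (h2.vty hH hρ hT1).exists_bool
      obtain ⟨b₂, rfl⟩ := (h5.vty hH hρ hT2).exists_bool
      cases b₁ with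
      | true => exact ⟨.bool true, by simp [SExpr.val, h1, h4], .orA h2, .orA h2 h3⟩
      | false => exact ⟨.bool b₂, by simp [SExpr.val, h1, h4], .orB h2 h5, .orB h2 h3 h6⟩
  | and _ _ ih1 ih2 =>
    cases hT with
    | and hT1 hT2 =>
      obtain ⟨v₁, h1, h2, h3⟩ := ih1 hδ.left (left hR) hT1
      obtain ⟨v₂, h4, h5, h6⟩ := ih2 hδ.right (right hR) hT2
      obtain ⟨b₁, rfl⟩ := (h2.vty hH hρ hT1).exists_bool
      obtain ⟨b₂, rfl⟩ := (h5.vty hH hρ hT2).exists_bool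
      cases b₁ with
      | false => exact ⟨.bool false, by simp [SExpr.val, h1, h4], .andA h2, .andA h2 h3⟩
      | true => exact ⟨.bool b₂, by simp [SExpr.val, h1, h4], .andB h2 h5, .andB h2 h3 h6⟩
  | op _ _ ih1 ih2 =>
    obtain ⟨T₁, T₂, hT1, hT2, hop⟩ := hT.op_eval
    obtain ⟨v₁, h1, h2, h3⟩ := ih1 hδ.left (left hR) hT1
    obtain ⟨v₂, h4, h5, h6⟩ := ih2 hδ.right (right hR) hT2
    obtain ⟨v, hv, _⟩ := hop Ψ v₁ v₂ (h2.vty hH hρ hT1) (h5.vty hH hρ hT2)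
    exact ⟨v, by simp [SExpr.val, h1, h4, hv], .op h2 h5 hv, .op h3 h6⟩
  | not _ ih =>
    cases hT with
    | not hT =>
      obtain ⟨v, h1, h2, h3⟩ := ih hδ hR hT
      exact ⟨v.neg, by simp [SExpr.val, h1], .not h2, .not h3⟩
  | field _ h2 h3 ih =>
    cases hT with
    | field hT =>
      obtain ⟨v, h4, h5, h6⟩ := ih hδ hR hT
      obtain ⟨l, rfl, h7, h8⟩ := (hσ.field _ h3).lookup hg h2 h4
      exact ⟨_, h7, .field h5, .field h6 h5 h8⟩
  | fieldOptimistic _ _ h2 h3 ih =>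
    cases hT with
    | field hT =>
      obtain ⟨v, h4, h5, h6⟩ := ih hδ hR hT
      obtain ⟨l, rfl, h7, h8⟩ := (hσ.optimistic _ h3).lookup hg h2 h4
      exact ⟨_, h7, .field h5, .field h6 h5 h8⟩
  | @fieldImprecise U e f tₑ R δ ν _ _ _ _ _ ih =>
    cases hT with
    | field hT =>
      obtain ⟨v, h4, h5, h6⟩ := ih hδ.left (fun r hr => hR r (.inr hr)) hT
      obtain ⟨l, h7, h8⟩ := hR _ (Set.mem_insert _ _)
      cases h4.symm.trans h7
      refine ⟨H l f, ?_, .field h5, .field h6 h5 h8⟩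
      -- Consistency with the recorded origin makes the fresh value the content of the field.
      exact congrArg some (hδ ν (.read tₑ f) _ (by simp) (by simp [Origin.val, h4]))
  | fieldMissing _ _ _ _ _ ih => exact (hR _ (Set.mem_insert _ _)).elim

theorem SPCEvalList.sound {P : Program} {Ψ : Loc → Option StructName} {Δ : TyEnv} {V : SValuation}
    {σ : SState} {H : Heap} {α : Set Perm} {ρ : Env} (hH : HeapTy P Ψ H) (hρ : EnvTy Ψ Δ ρ)
    (hσ : ValueSim V σ H α ρ) (hg : σ.g.val V = some (.bool true)) {U : Set ℕ} {es : List Expr}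
    {ts : List SExpr} {R : Set Check} {δ : Trace} (h : SPCEvalList σ U es ts R δ)
    (hδ : δ.Consistent H V) (hR : ∀ r ∈ R, r.Holds P V H α) {params : List (Var × Ty)}
    (hT : ArgsTy P Δ es params) :
    ∃ vs, SVals V ts vs ∧ List.Forall₂ (Eval H ρ) es vs ∧ ∀ e ∈ es, Frm H α ρ e := by
  induction h generalizing params with
  | nil => exact ⟨[], .nil, .nil, by simp⟩
  | cons h _ ih =>
    cases hT with
    | cons hT1 hT2 =>
      obtain ⟨v, h1, h2, h3⟩ := h.sound hH hρ hσ hg hδ.left (fun r hr => hR r (.inl hr)) hT1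
      obtain ⟨vs, h4, h5, h6⟩ := ih hδ.right (fun r hr => hR r (.inr hr)) hT2
      refine ⟨v :: vs, .cons h1 h4, .cons h2 h5, fun e he => ?_⟩
      rcases List.mem_cons.1 he with rfl | he
      · exact h3
      · exact h6 e he

/-- The path condition of the resulting state records which operand decided a connective, so its
truth forces the run-time evaluation into the same branch. Path conditions of intermediate states
follow, since they only get stronger. -/
theorem SEval.sound {P : Program} {Ψ : Loc → Option StructName} {Δ : TyEnv} {V : SValuation}
    {H : Heap} {α : Set Perm} {ρ : Env} (hH : HeapTy P Ψ H) (hρ : EnvTy Ψ Δ ρ) {U : Set ℕ}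
    {σ σ' : SState} {e : Expr} {t : SExpr} {R : Set Check} {δ : Trace}
    (h : SEval U σ e t σ' R δ) (hσ : ValueSim V σ H α ρ)
    (hg : σ'.g.val V = some (.bool true)) (hδ : δ.Consistent H V)
    (hR : ∀ r ∈ R, r.Holds P V H α) {T : Ty} (hT : ExprTy P Δ e T) :
    ValueSim V σ' H α ρ ∧ ∃ v, t.val V = some v ∧ Eval H ρ e v := by
  have left : ∀ {R₁ R₂ : Set Check}, (∀ r ∈ R₁ ∪ R₂, r.Holds P V H α) →
    ∀ r ∈ R₁, r.Holds P V H α := fun h r hr => h r (.inl hr)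
  have right : ∀ {R₁ R₂ : Set Check}, (∀ r ∈ R₁ ∪ R₂, r.Holds P V H α) →
    ∀ r ∈ R₂, r.Holds P V H α := fun h r hr => h r (.inr hr)
  induction h generalizing T with
  | lit => exact ⟨hσ, _, rfl, .lit _⟩
  | var h =>
    obtain ⟨v, h1, h2⟩ := hσ.env _ _ h
    exact ⟨hσ, v, h1, .var h2⟩
  | orA _ ih =>
    cases hT with
    | or hT1 hT2 =>
      obtain ⟨hg, ht⟩ := SExpr.val_and.1 hg
      obtain ⟨h1, v, h2, h3⟩ := ih hσ hg hδ hR hT1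
      cases h2.symm.trans ht
      exact ⟨⟨h1.field, h1.optimistic, h1.env⟩, _, h2, .orA h3⟩
  | andA _ ih =>
    cases hT with
    | and hT1 hT2 =>
      obtain ⟨hg, ht⟩ := SExpr.val_and.1 hg
      obtain ⟨h1, v, h2, h3⟩ := ih hσ hg hδ hR hT1
      cases h2.symm.trans (SExpr.val_not.1 ht)
      exact ⟨⟨h1.field, h1.optimistic, h1.env⟩, _, h2, .andA h3⟩
  | orB _ h' ih1 ih2 =>
    cases hT with
    | or hT1 hT2 =>
      -- Evaluation of the second operand retains the assumption made about the first.
      obtain ⟨hg', ht⟩ := SExpr.val_and.1 (h'.extends.path V hg)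
      obtain ⟨h1, v, h2, h3⟩ := ih1 hσ hg' hδ.left (left hR) hT1
      cases h2.symm.trans (SExpr.val_not.1 ht)
      obtain ⟨h4, w, h5, h6⟩ := ih2 ⟨h1.field, h1.optimistic, h1.env⟩ hg hδ.right (right hR) hT2
      exact ⟨h4, w, h5, .orB h3 h6⟩
  | andB _ h' ih1 ih2 =>
    cases hT with
    | and hT1 hT2 =>
      obtain ⟨hg', ht⟩ := SExpr.val_and.1 (h'.extends.path V hg)
      obtain ⟨h1, v, h2, h3⟩ := ih1 hσ hg' hδ.left (left hR) hT1
      cases h2.symm.trans ht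
      obtain ⟨h4, w, h5, h6⟩ := ih2 ⟨h1.field, h1.optimistic, h1.env⟩ hg hδ.right (right hR) hT2
      exact ⟨h4, w, h5, .andB h3 h6⟩
  | op _ h' ih1 ih2 =>
    obtain ⟨T₁, T₂, hT1, hT2, hop⟩ := hT.op_eval
    obtain ⟨h1, v₁, h2, h3⟩ := ih1 hσ (h'.extends.path V hg) hδ.left (left hR) hT1
    obtain ⟨h4, v₂, h5, h6⟩ := ih2 h1 hg hδ.right (right hR) hT2
    obtain ⟨v, hv, _⟩ := hop Ψ v₁ v₂ (h3.vty hH hρ hT1) (h6.vty hH hρ hT2)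
    exact ⟨h4, v, by simp [SExpr.val, h2, h5, hv], .op h3 h6 hv⟩
  | not _ ih =>
    cases hT with
    | not hT =>
      obtain ⟨h1, v, h2, h3⟩ := ih hσ hg hδ hR hT
      exact ⟨h1, v.neg, by simp [SExpr.val, h2], .not h3⟩
  | field _ h2 h3 ih =>
    cases hT with
    | field hT =>
      obtain ⟨h1, v, h4, h5⟩ := ih hσ hg hδ hR hT
      obtain ⟨l, rfl, h7, h8⟩ := (h1.field _ h3).lookup hg h2 h4
      exact ⟨h1, _, h7, .field h5⟩
  | fieldOptimistic _ _ h3 h2 ih =>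
    cases hT with
    | field hT =>
      obtain ⟨h1, v, h4, h5⟩ := ih hσ hg hδ hR hT
      obtain ⟨l, rfl, h7, h8⟩ := (h1.optimistic _ h3).lookup hg h2 h4
      exact ⟨h1, _, h7, .field h5⟩
  | @fieldImprecise U σ e f tₑ σ' R δ ν _ _ _ _ _ ih =>
    cases hT with
    | field hT =>
      obtain ⟨h1, v, h4, h5⟩ := ih hσ hg hδ.left (fun r hr => hR r (.inr hr)) hT
      obtain ⟨l, h7, h8⟩ := hR _ (Set.mem_insert _ _)
      cases h4.symm.trans h7
      have h9 : V ν = H l f := hδ ν (.read tₑ f) _ (by simp) (by simp [Origin.val, h4])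
      refine ⟨⟨h1.field, ?_, h1.env⟩, H l f, congrArg some h9, .field h5⟩
      rintro c (rfl | hc)
      · exact ⟨l, h4, congrArg some h9, h8⟩
      · exact h1.optimistic c hc
  | fieldFailure => exact (hR _ rfl).elim

theorem SEvalList.sound {P : Program} {Ψ : Loc → Option StructName} {Δ : TyEnv} {V : SValuation}
    {H : Heap} {α : Set Perm} {ρ : Env} (hH : HeapTy P Ψ H) (hρ : EnvTy Ψ Δ ρ) {U : Set ℕ}
    {σ σ' : SState} {es : List Expr} {ts : List SExpr} {R : Set Check} {δ : Trace}
    (h : SEvalList U σ es ts σ' R δ) (hσ : ValueSim V σ H α ρ)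
    (hg : σ'.g.val V = some (.bool true)) (hδ : δ.Consistent H V)
    (hR : ∀ r ∈ R, r.Holds P V H α) {params : List (Var × Ty)} (hT : ArgsTy P Δ es params) :
    ValueSim V σ' H α ρ ∧ ∃ vs, SVals V ts vs ∧ List.Forall₂ (Eval H ρ) es vs := by
  induction h generalizing params with
  | nil => exact ⟨hσ, [], .nil, .nil⟩
  | cons h h' ih =>
    cases hT with
    | cons hT1 hT2 =>
      obtain ⟨h1, v, h2, h3⟩ := h.sound hH hρ hσ (h'.extends.path V hg) hδ.left
        (fun r hr => hR r (.inl hr)) hT1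
      obtain ⟨h4, vs, h5, h6⟩ := ih h1 hg hδ.right (fun r hr => hR r (.inr hr)) hT2
      exact ⟨h4, v :: vs, .cons h2 h5, .cons h3 h6⟩

theorem SimState.extends {P : Program} {V : SValuation} {σ σ' : SState} {H : Heap} {α : Set Perm}
    {ρ : Env} (h : SimState P V σ H α ρ) (hσ : σ.Extends σ') (h' : ValueSim V σ' H α ρ)
    (hg : σ'.g.val V = some (.bool true)) : SimState P V σ' H α ρ :=
  ⟨h'.field, fun p ts hc => h.pred p ts (hσ.chunk ▸ hc),
    fun h₁ hh₁ h₂ hh₂ => h.disjoint h₁ (hσ.chunk ▸ hh₁) h₂ (hσ.chunk ▸ hh₂),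
    h'.optimistic, h'.env, hg⟩

/-! ## Soundness of consumption -/

theorem SImplies.eq_symm {g t t' : SExpr} (h : SImplies g (.eq t t')) : SImplies g (.eq t' t) := by
  intro V v hg hv
  cases h1 : t.val V with
  | none => simp [SExpr.val, h1] at hv
  | some a =>
    cases h2 : t'.val V with
    | none => simp [SExpr.val, h2] at hv
    | some b =>
      rw [SExpr.val_eq h2 h1, h.eq_val hg h1 h2] at hv
      simpa using hv.symm

/-- A field chunk that is kept by an imprecise state has another field or object. -/
theorem disjoint_of_not_alias {P : Program} {V : SValuation} {σ : SState} {H : Heap}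
    (hi : σ.imp = true) (hg : σ.g.val V = some (.bool true)) {t : SExpr} {f : FieldName} {l : Loc}
    (ht : t.val V = some (.loc l)) {c : FChunk} (hc : ¬ Alias σ t f c.t c.f) :
    Disjoint (vfoot P V H (.field c.t c.f)) {(l, f)} := by
  rw [Set.disjoint_singleton_right]
  rintro ⟨h1, h2⟩
  refine hc ⟨h2, fun h => by simp [hi] at h, fun _ => ⟨V, SExpr.val_and.2 ⟨hg, ?_⟩⟩⟩
  rw [SExpr.val_eq ht h1]
  simp

/-- This ensures that the very chunk that justifies a consumption is among those removed. In an
imprecise state aliasing means satisfiability, for which the present valuation is a witness. -/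
theorem alias_of_implies {V : SValuation} {σ : SState} (hg : σ.g.val V = some (.bool true))
    {t t' : SExpr} {f : FieldName} {v : Value} (ht : t.val V = some v) (ht' : t'.val V = some v)
    (h : SImplies σ.g (.eq t' t)) : Alias σ t f t' f := by
  refine ⟨rfl, fun _ => h.eq_symm, fun _ => ⟨V, SExpr.val_and.2 ⟨hg, ?_⟩⟩⟩
  rw [SExpr.val_eq ht ht']
  simp

/-- What consumption of a formula guarantees: the formula holds in its permissions, which are
owned, and which are disjoint from those of the remaining chunks; if no permission was checked at
run time, they are permissions of the chunks at the start. -/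
structure ConsumeSpec (P : Program) (V : SValuation) (H : Heap) (α : Set Perm) (ρ : Env)
    (σ : SState) (φ : Formula) (σ' : SState) (R : Set Check) (Θ : Set SPerm) : Prop where
  holds : Assert P H (φ.permFoot P H ρ) ρ ⟨false, φ⟩
  framed : EFrm P H α ρ φ
  owned : φ.permFoot P H ρ ⊆ α
  consumed : φ.permFoot P H ρ ⊆ vfootSet P V H Θ
  disjoint : ∀ θ ∈ σ'.perms, Disjoint (vfoot P V H θ) (φ.permFoot P H ρ)
  static : (∀ θ, Check.perm θ ∉ R) → φ.permFoot P H ρ ⊆ vfootSet P V H σ.perms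

theorem Formula.permFoot_acc {P : Program} {H : Heap} {ρ : Env} {e : Expr} {f : FieldName}
    {l : Loc} (he : Eval H ρ e (.loc l)) : (Formula.acc e f).permFoot P H ρ = {(l, f)} := by
  ext ⟨l', f'⟩
  constructor
  · rintro ⟨h1, h2⟩
    cases he.det h1
    cases h2
    rfl
  · rintro ⟨⟩
    exact ⟨he, rfl⟩

theorem ConsumeSpec.acc {P : Program} {V : SValuation} {H : Heap} {α : Set Perm} {ρ : Env}
    {σ σ' : SState} {e : Expr} {f : FieldName} {t : SExpr} {l : Loc} {R : Set Check}
    (he : Eval H ρ e (.loc l)) (hF : Frm H α ρ e) (ht : t.val V = some (.loc l))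
    (hα : (l, f) ∈ α) (hd : ∀ θ ∈ σ'.perms, Disjoint (vfoot P V H θ) {(l, f)})
    (hs : (∀ θ, Check.perm θ ∉ R) → (l, f) ∈ vfootSet P V H σ.perms) :
    ConsumeSpec P V H α ρ σ (.acc e f) σ' R {.field t f} := by
  have h := Formula.permFoot_acc (P := P) (f := f) he
  refine ⟨.acc he ⟨he, rfl⟩, .acc hF, ?_, ?_, ?_, ?_⟩ <;> rw [h]
  · exact Set.singleton_subset_iff.2 hα
  · exact Set.singleton_subset_iff.2 ⟨_, rfl, ht, rfl⟩
  · exact hd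
  · exact fun h => Set.singleton_subset_iff.2 (hs h)

theorem Formula.permFoot_pred {P : Program} {H : Heap} {ρ : Env} {p : PredName} {es : List Expr}
    {d : PredDecl} {vs : List Value} (hd : P.preds p = some d)
    (hes : List.Forall₂ (Eval H ρ) es vs) :
    (Formula.pred p es).permFoot P H ρ = efoot P H (mkEnv d.vars vs) d.body := by
  ext a
  constructor
  · rintro ⟨d', vs', h1, h2, h3⟩
    cases hd.symm.trans h1
    cases Eval.det_list hes h2
    exact h3
  · exact fun h => ⟨d, vs, hd, hes, h⟩

theorem vfoot_pred {P : Program} {V : SValuation} {H : Heap} {p : PredName} {ts : List SExpr}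
    {d : PredDecl} {vs : List Value} (hd : P.preds p = some d) (hts : SVals V ts vs) :
    vfoot P V H (.pred p ts) = efoot P H (mkEnv d.vars vs) d.body := by
  ext a
  constructor
  · rintro ⟨d', vs', h1, h2, h3⟩
    cases hd.symm.trans h1
    cases hts.unique h2
    exact h3
  · exact fun h => ⟨d, vs, hd, hts, h⟩

theorem ConsumeSpec.pred {P : Program} (hP : P.PredSpecs) {V : SValuation} {H : Heap}
    {α : Set Perm} {ρ : Env} {σ σ' : SState} {p : PredName} {es : List Expr} {ts : List SExpr}
    {d : PredDecl} {vs : List Value} {R : Set Check} (hd : P.preds p = some d)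
    (hes : List.Forall₂ (Eval H ρ) es vs) (hF : ∀ e ∈ es, Frm H α ρ e) (hts : SVals V ts vs)
    (hA : Assert P H α (mkEnv d.vars vs) d.body)
    (hdis : ∀ θ ∈ σ'.perms, Disjoint (vfoot P V H θ) (vfoot P V H (.pred p ts)))
    (hs : (∀ θ, Check.perm θ ∉ R) →
      vfoot P V H (.pred p ts) ⊆ vfootSet P V H σ.perms) :
    ConsumeSpec P V H α ρ σ (.pred p es) σ' R {.pred p ts} := by
  have h := Formula.permFoot_pred hd hes
  have h' := vfoot_pred (H := H) hd hts
  have hspec := hP p d hd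
  -- Correspondence or the check gives validity of the body in all of `α`; it can be cut down to the
  -- exact footprint, which is what the instance demands.
  refine ⟨.pred hd hes (hA.restrict fun a _ ha => h ▸ ha), .pred hd hF hes (hA.efrm hP hspec),
    ?_, ?_, ?_, ?_⟩
  · rw [h]; exact hA.efoot_subset hP hspec
  · rw [h, ← h']; exact fun a ha => ⟨_, rfl, ha⟩
  · rw [h, ← h']; exact hdis
  · rw [h, ← h']; exact hs

theorem SVals.eq_of_implies {V : SValuation} {g : SExpr} {ts ts' : List SExpr}
    {vs vs' : List Value} (h : SImpliesEqs g ts ts') (hg : g.val V = some (.bool true))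
    (hts : SVals V ts vs) (hts' : SVals V ts' vs') : vs = vs' := by
  induction h generalizing vs vs' with
  | nil => cases hts; cases hts'; rfl
  | cons h _ ih =>
    cases hts with
    | cons h1 h2 =>
      cases hts' with
      | cons h3 h4 => rw [h.eq_val hg h1 h3, ih h2 h4]

/-- Everything but `hd` is inherited from the conjuncts. Chunks remaining after the second
consumption were also present after the first, so they avoid both parts; and permissions taken
statically by the second conjunct belong to chunks already present at the start. -/
theorem ConsumeSpec.sep {P : Program} {V : SValuation} {H : Heap} {α : Set Perm} {ρ : Env}
    {σ σ₁ σ₂ : SState} {φ₁ φ₂ : Formula} {R₁ R₂ R : Set Check} {Θ₁ Θ₂ : Set SPerm}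
    (h₁ : ConsumeSpec P V H α ρ σ φ₁ σ₁ R₁ Θ₁) (h₂ : ConsumeSpec P V H α ρ σ₁ φ₂ σ₂ R₂ Θ₂)
    (hs₁ : σ.Shrinks σ₁) (hs₂ : σ₁.Shrinks σ₂) (hR : R₁ ∪ R₂ ⊆ R)
    (hd : Disjoint (φ₁.permFoot P H ρ) (φ₂.permFoot P H ρ)) :
    ConsumeSpec P V H α ρ σ (.sep φ₁ φ₂) σ₂ R (Θ₁ ∪ Θ₂) := by
  have mono : ∀ {σ σ' : SState}, σ.Shrinks σ' → σ'.perms ⊆ σ.perms := by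
    rintro σ σ' h θ (⟨c, hc, rfl⟩ | ⟨c, hc, rfl⟩)
    · exact .inl ⟨c, h.chunk hc, rfl⟩
    · exact .inr ⟨c, h.optimistic hc, rfl⟩
  refine ⟨.sep h₁.holds h₂.holds subset_rfl (Set.disjoint_iff_inter_eq_empty.1 hd),
    .sep h₁.framed h₂.framed, Set.union_subset h₁.owned h₂.owned, ?_, ?_, ?_⟩
  · rintro a (ha | ha)
    · obtain ⟨θ, hθ, h⟩ := h₁.consumed ha
      exact ⟨θ, .inl hθ, h⟩
    · obtain ⟨θ, hθ, h⟩ := h₂.consumed ha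
      exact ⟨θ, .inr hθ, h⟩
  · exact fun θ hθ => Set.disjoint_union_right.2
      ⟨h₁.disjoint θ (mono hs₂ hθ), h₂.disjoint θ hθ⟩
  · intro hno
    refine Set.union_subset (h₁.static fun θ hθ => hno θ (hR (.inl hθ))) fun a ha => ?_
    obtain ⟨θ, hθ, h⟩ := h₂.static (fun θ hθ => hno θ (hR (.inr hθ))) ha
    exact ⟨θ, mono hs₁ hθ, h⟩

/-- Expressions are evaluated in `σE`, which keeps the chunks removed so far, because a later
conjunct may read fields whose permissions are already consumed. Only its path condition follows
that of the shrinking state. The bookkeeping in `ConsumeSpec` exists for the separating conjunction,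
whose parts must be shown disjoint although they are consumed one after the other. -/
theorem SConsumeF.sound {P : Program} (hP : P.PredSpecs) {Ψ : Loc → Option StructName}
    {Δ : TyEnv} {V : SValuation} {H : Heap} {α : Set Perm} {ρ : Env} (hH : HeapTy P Ψ H)
    (hρ : EnvTy Ψ Δ ρ) {U : Set ℕ} {σ σE σ' : SState} {φ : Formula} {R : Set Check}
    {Θ : Set SPerm} {δ : Trace} (h : SConsumeF U σ σE φ σ' R Θ δ) (hσ : SimState P V σ H α ρ)
    (hO : σ.OptOK) (hE : ValueSim V σE H α ρ) (hgE : σE.g = σ.g)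
    (hg' : σ'.g.val V = some (.bool true)) (hδ : δ.Consistent H V)
    (hR : ∀ r ∈ R, r.Holds P V H α) (hT : FormulaTy P Δ φ) :
    ConsumeSpec P V H α ρ σ φ σ' R Θ := by
  have left : ∀ {R₁ R₂ : Set Check}, (∀ r ∈ R₁ ∪ R₂, r.Holds P V H α) →
    ∀ r ∈ R₁, r.Holds P V H α := fun h r hr => h r (.inl hr)
  have right : ∀ {R₁ R₂ : Set Check}, (∀ r ∈ R₁ ∪ R₂, r.Holds P V H α) →
    ∀ r ∈ R₂, r.Holds P V H α := fun h r hr => h r (.inr hr)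
  have emp : ∀ {σ σ' : SState} {e : Expr} {R : Set Check}, Eval H ρ e (.bool true) →
      Frm H α ρ e → ConsumeSpec P V H α ρ σ (.expr e) σ' R ∅ := fun he hF =>
    ⟨.value he, .expr hF, Set.empty_subset _, Set.empty_subset _,
      fun _ _ => Set.disjoint_empty _, fun _ => Set.empty_subset _⟩
  -- After a removal in an imprecise state, no remaining field possibly coincides.
  have rem : ∀ {σ : SState} {t : SExpr} {f : FieldName} {l : Loc}, σ.imp = true →
      σ.g.val V = some (.bool true) → t.val V = some (.loc l) →
      ∀ θ ∈ SState.perms { σ with H := remFH σ.H σ t f, O := remF σ.O σ t f },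
        Disjoint (vfoot P V H θ) {(l, f)} := by
    rintro σ t f l hi hg ht θ (⟨c, ⟨c, rfl, _, hc⟩, rfl⟩ | ⟨c, hc, rfl⟩)
    · exact disjoint_of_not_alias hi hg ht hc
    · exact disjoint_of_not_alias hi hg ht hc.2
  induction h with
  | value h1 h2 =>
    obtain ⟨v, h3, h4, h5⟩ := h1.sound hH hρ hE (hgE ▸ hg') hδ hR hT
    cases h2 V v hg' h3
    exact emp h4 h5
  | @valueImprecise U σ σE e t R δ _ h1 h2 =>
    obtain ⟨hg, ht⟩ := SExpr.val_and.1 hg'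
    obtain ⟨v, h3, h4, h5⟩ := h1.sound hH hρ hE (hgE ▸ hg) hδ (fun r hr => hR r (.inr hr)) hT
    cases h3.symm.trans ht
    exact emp h4 h5
  | valueFailure | predFailure | accFailure => exact (hR _ rfl).elim
  | @pred U σ σE p es ts ts' R δ h1 h2 h3 =>
    obtain ⟨d, hd, hT⟩ := hT
    obtain ⟨vs, h4, h5, h6⟩ := h1.sound hH hρ hE (hgE ▸ hg') hδ hR hT
    obtain ⟨d', ws, hd', h7, h8⟩ := hσ.pred _ _ h3
    cases hd.symm.trans hd'
    cases h4.eq_of_implies h2 hg' h7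
    have hfoot : vfoot P V H (.pred p ts) = vfoot P V H (.pred p ts') :=
      (vfoot_pred hd h4).trans (vfoot_pred hd h7).symm
    refine .pred hP hd h5 h6 h4 h8 ?_ fun _ a ha => ⟨_, .inl ⟨_, h3, rfl⟩, hfoot ▸ ha⟩
    rintro θ (⟨c, ⟨hc, hne⟩, rfl⟩ | ⟨c, hc, _⟩)
    · rw [hfoot]
      exact Set.disjoint_iff_inter_eq_empty.2 (hσ.disjoint c hc _ h3 hne)
    · exact hc.elim
  | @predImprecise U σ σE p es ts R δ _ h1 _ =>
    obtain ⟨d, hd, hT⟩ := hT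
    obtain ⟨vs, h4, h5, h6⟩ := h1.sound hH hρ hE (hgE ▸ hg') hδ (fun r hr => hR r (.inr hr)) hT
    obtain ⟨d', ws, hd', h7, h8⟩ := hR _ (Set.mem_insert _ _)
    cases hd.symm.trans hd'
    cases h4.unique h7
    refine .pred hP hd h5 h6 h4 h8 ?_ fun hno => (hno _ (Set.mem_insert _ _)).elim
    rintro θ (⟨c, hc, _⟩ | ⟨c, hc, _⟩) <;> exact hc.elim
  | @acc U σ σE e f tₑ tₑ' t R δ h1 h2 h3 =>
    obtain ⟨T, hT⟩ := hT
    cases hT with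
    | field hT =>
      obtain ⟨v, h4, h5, h6⟩ := h1.sound hH hρ hE (hgE ▸ hg') hδ hR hT
      obtain ⟨l, h7, h8, h9⟩ := hσ.field _ h3
      cases h2.eq_val hg' h7 h4
      have hfoot : vfoot P V H (.field tₑ' f) = {(l, f)} := by
        ext ⟨l', f'⟩
        constructor
        · rintro ⟨h10, h11⟩
          cases h7.symm.trans h10
          cases h11
          rfl
        · rintro ⟨⟩
          exact ⟨h7, rfl⟩
      refine .acc h5 h6 h4 h9 ?_ fun _ => ⟨_, .inl ⟨_, h3, rfl⟩, h7, rfl⟩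
      -- Chunks of the precise heap are separated by correspondence, whether or not the state can
      -- tell that they do not alias. So predicate chunks can be kept here.
      have hne : ∀ c ∈ σ.H, c ≠ Chunk.field ⟨f, tₑ', t⟩ →
          Disjoint (vfoot P V H c.perm) {(l, f)} := fun c hc hne => by
        rw [← hfoot]
        exact Set.disjoint_iff_inter_eq_empty.2 (hσ.disjoint c hc _ h3 hne)
      rintro θ (⟨c, ⟨c, rfl, hc, hna⟩ | ⟨p, ts, rfl, hc⟩, rfl⟩ | ⟨c, ⟨hc, hna⟩, rfl⟩)
      · refine hne _ hc ?_
        rintro ⟨⟩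
        -- The consumed chunk is recognised as an alias, so it cannot be among the kept ones.
        exact hna (alias_of_implies hg' h4 h7 h2)
      · exact hne _ hc (by rintro ⟨⟩)
      -- Optimistic chunks may overlap with precise ones. They exist only in imprecise states, where
      -- every possible alias is removed.
      · cases hi : σ.imp with
        | true => exact disjoint_of_not_alias hi hg' h4 hna
        | false => rw [hO hi] at hc; exact hc.elim
  | @accOptimistic U σ σE e f tₑ tₑ' t R δ h1 h2 _ h3 =>
    obtain ⟨T, hT⟩ := hT
    cases hT with
    | field hT =>
      obtain ⟨v, h4, h5, h6⟩ := h1.sound hH hρ hE (hgE ▸ hg') hδ hR hT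
      obtain ⟨l, h7, h8, h9⟩ := hσ.optimistic _ h3
      cases h2.eq_val hg' h7 h4
      -- Having an optimistic chunk at all shows that the state is imprecise.
      have hi : σ.imp = true := by
        cases hi : σ.imp with
        | true => rfl
        | false => rw [hO hi] at h3; exact h3.elim
      exact .acc h5 h6 h4 h9 (rem hi hg' h4) fun _ => ⟨_, .inr ⟨_, h3, rfl⟩, h7, rfl⟩
  | @accImprecise U σ σE e f tₑ R δ hi h1 _ _ =>
    obtain ⟨T, hT⟩ := hT
    cases hT with
    | field hT =>
      obtain ⟨v, h4, h5, h6⟩ := h1.sound hH hρ hE (hgE ▸ hg') hδ (fun r hr => hR r (.inr hr)) hT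
      obtain ⟨l, h7, h9⟩ := hR _ (Set.mem_insert _ _)
      cases h4.symm.trans h7
      exact .acc h5 h6 h4 h9 (rem hi hg' h4) fun hno => (hno _ (Set.mem_insert _ _)).elim
  | @sep U σ σE φ₁ φ₂ σ₁ σ₂ R₁ R₂ Θ₁ Θ₂ δ₁ δ₂ h1 h2 hno ih1 ih2 =>
    have hg1 := h2.shrinks.1.path V hg'
    have s1 := ih1 hσ hO hE hgE hg1 hδ.left (left hR) hT.1
    have s2 := ih2 (hσ.shrinks h1.shrinks.1 hg1) (h1.optOK hO)
      ⟨hE.field, hE.optimistic, hE.env⟩ rfl hg' hδ.right (right hR) hT.2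
    refine s1.sep s2 h1.shrinks.1 h2.shrinks.1 subset_rfl ?_
    rw [Set.disjoint_left]
    intro a ha1 ha2
    -- Without a permission check, the second conjunct draws on chunks left by the first, and these
    -- avoid the permissions of the first.
    obtain ⟨θ, hθ, ha⟩ := s2.static (fun θ hθ => hno θ (.inr hθ)) ha2
    exact Set.disjoint_left.1 (s1.disjoint θ hθ) ha ha1
  | @sepImprecise U σ σE φ₁ φ₂ σ₁ σ₂ R₁ R₂ Θ₁ Θ₂ δ₁ δ₂ h1 h2 _ ih1 ih2 =>
    have hg1 := h2.shrinks.1.path V hg'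
    have hR' : ∀ r ∈ R₁ ∪ R₂, r.Holds P V H α := fun r hr => hR r (.inr hr)
    have s1 := ih1 hσ hO hE hgE hg1 hδ.left (left hR') hT.1
    have s2 := ih2 (hσ.shrinks h1.shrinks.1 hg1) (h1.optOK hO)
      ⟨hE.field, hE.optimistic, hE.env⟩ rfl hg' hδ.right (right hR') hT.2
    refine s1.sep s2 h1.shrinks.1 h2.shrinks.1 (Set.subset_insert _ _) ?_
    -- With a permission check, the separation check compares the consumed symbolic permissions,
    -- which cover the demanded ones.
    exact (Set.disjoint_iff_inter_eq_empty.2 (hR _ (Set.mem_insert _ _))).mono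
      s1.consumed s2.consumed
  | @iteA U σ σE e φ₁ φ₂ t R σ' R' Θ δ₁ δ₂ h1 h2 ih =>
    obtain ⟨hg, ht⟩ := SExpr.val_and.1 (h2.shrinks.1.path V hg')
    obtain ⟨v, h3, h4, h5⟩ := h1.sound hH hρ hE (hgE ▸ hg) hδ.left (left hR) hT.1
    cases h3.symm.trans ht
    have s := ih (hσ.setPath (SExpr.val_and.2 ⟨hg, ht⟩)) hO ⟨hE.field, hE.optimistic, hE.env⟩ rfl
      hg' hδ.right (right hR) hT.2.1
    have hfoot : (Formula.ite e φ₁ φ₂).permFoot P H ρ = φ₁.permFoot P H ρ := by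
      ext a
      refine ⟨?_, fun h => .inl ⟨h4, h⟩⟩
      rintro (⟨_, h⟩ | ⟨h, _⟩)
      · exact h
      · cases h4.det h
    exact ⟨.iteA h4 (hfoot ▸ s.holds), .iteA h4 h5 s.framed, hfoot ▸ s.owned, hfoot ▸ s.consumed,
      hfoot ▸ s.disjoint, fun hno => hfoot ▸ s.static fun θ hθ => hno θ (.inr hθ)⟩
  | @iteB U σ σE e φ₁ φ₂ t R σ' R' Θ δ₁ δ₂ h1 h2 ih =>
    obtain ⟨hg, ht⟩ := SExpr.val_and.1 (h2.shrinks.1.path V hg')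
    obtain ⟨v, h3, h4, h5⟩ := h1.sound hH hρ hE (hgE ▸ hg) hδ.left (left hR) hT.1
    cases h3.symm.trans (SExpr.val_not.1 ht)
    have s := ih (hσ.setPath (SExpr.val_and.2 ⟨hg, ht⟩)) hO ⟨hE.field, hE.optimistic, hE.env⟩ rfl
      hg' hδ.right (right hR) hT.2.2
    have hfoot : (Formula.ite e φ₁ φ₂).permFoot P H ρ = φ₂.permFoot P H ρ := by
      ext a
      refine ⟨?_, fun h => .inr ⟨h4, h⟩⟩
      rintro (⟨h, _⟩ | ⟨_, h⟩)
      · cases h4.det h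
      · exact h
    exact ⟨.iteB h4 (hfoot ▸ s.holds), .iteB h4 h5 s.framed, hfoot ▸ s.owned, hfoot ▸ s.consumed,
      hfoot ▸ s.disjoint, fun hno => hfoot ▸ s.static fun θ hθ => hno θ (.inr hθ)⟩

/-- Soundness of the consumption of a specification. -/
theorem SConsume.sound {P : Program} (hP : P.PredSpecs) {Ψ : Loc → Option StructName}
    {Δ : TyEnv} {V : SValuation} {H : Heap} {α : Set Perm} {ρ : Env} (hH : HeapTy P Ψ H)
    (hρ : EnvTy Ψ Δ ρ) {U : Set ℕ} {σ σ' : SState} {φ : GFormula} {R : Set Check} {δ : Trace}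
    (h : SConsume U σ φ σ' R δ) (hσ : SimState P V σ H α ρ) (hO : σ.OptOK)
    (hg' : σ'.g.val V = some (.bool true)) (hδ : δ.Consistent H V)
    (hR : ∀ r ∈ R, r.Holds P V H α) (hT : FormulaTy P Δ φ.body) (hφ : Specification P φ) :
    Assert P H α ρ φ ∧ ∀ θ ∈ σ'.perms, Disjoint (vfoot P V H θ) (efoot P H ρ φ) := by
  cases h with
  | precise h =>
    have s := h.sound hP hH hρ hσ hO hσ.valueSim rfl hg' hδ hR hT
    -- The formula is valid in just the permissions that it demands and is self-framed, so its reads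
    -- lie there too: its exact footprint is contained in those permissions.
    exact ⟨s.holds.mono s.owned, fun θ hθ =>
      (s.disjoint θ hθ).mono_right (s.holds.efoot_subset hP hφ)⟩
  | imprecise h =>
    have s := h.sound hP hH hρ hσ hO ⟨hσ.field, hσ.optimistic, hσ.env⟩ rfl hg' hδ hR hT
    refine ⟨.imprecise (s.holds.mono s.owned) s.framed, ?_⟩
    rintro θ (⟨c, hc, _⟩ | ⟨c, hc, _⟩) <;> exact hc.elim

theorem SConsume.simState {P : Program} {V : SValuation} {H : Heap} {α : Set Perm} {ρ : Env}
    {U : Set ℕ} {σ σ' : SState} {φ : GFormula} {R : Set Check} {δ : Trace}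
    (h : SConsume U σ φ σ' R δ) (hσ : SimState P V σ H α ρ)
    (hg' : σ'.g.val V = some (.bool true)) : SimState P V σ' H α ρ :=
  hσ.shrinks h.shrinks hg'

/-! ## Existence of evaluations and productions -/

theorem ValueSim.congr {V V' : SValuation} {σ : SState} {H : Heap} {α : Set Perm} {ρ : Env}
    {U : Set ℕ} (h : ValueSim V σ H α ρ) (hσ : σ.Scoped U) (hV : Set.EqOn V V' U) :
    ValueSim V' σ H α ρ where
  field c hc := (h.field c hc).congr (hV.mono (hσ.chunk _ hc))
  optimistic c hc := (h.optimistic c hc).congr (hV.mono (hσ.optimistic _ hc))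
  env x t hx := by
    rw [← SExpr.val_congr (hV.mono (hσ.env x t hx))]
    exact h.env x t hx

theorem Set.EqOn.update_of_notMem {V : SValuation} {U : Set ℕ} {ν : ℕ} (hν : ν ∉ U) (v : Value) :
    Set.EqOn V (Function.update V ν v) U := fun μ hμ =>
  (Function.update_of_ne (by rintro rfl; exact hν hμ) _ _).symm

/-- A well-typed expression can be evaluated, in such a way that the valuation extends to its fresh
values, and gives to the result the value of the expression, provided that it has one. -/
theorem SPCEval.exists {P : Program} {Ψ : Loc → Option StructName} {Δ : TyEnv} {σ : SState}
    {H : Heap} {α : Set Perm} {ρ : Env} (hH : HeapTy P Ψ H) {e : Expr} {V : SValuation}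
    (hσ : ValueSim V σ H α ρ) (hρ : EnvTy Ψ Δ ρ) (hg : σ.g.val V = some (.bool true)) {U : Set ℕ}
    (hU : U.Finite) (hsc : σ.Scoped U) {T : Ty} (hT : ExprTy P Δ e T) (hfv : e.fv ⊆ σ.dom) :
    ∃ t R δ V', SPCEval σ U e t R δ ∧ Set.EqOn V V' U ∧
      ∃ v, t.val V' = some v ∧ VTy Ψ v T ∧ ∀ w, Eval H ρ e w → w = v := by
  have two : ∀ {e₁ e₂ : Expr} {T₁ T₂ : Ty} {V : SValuation} {U : Set ℕ}, U.Finite →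
      σ.Scoped U → ValueSim V σ H α ρ → σ.g.val V = some (.bool true) →
      (∃ t R δ V', SPCEval σ U e₁ t R δ ∧ Set.EqOn V V' U ∧
        ∃ v, t.val V' = some v ∧ VTy Ψ v T₁ ∧ ∀ w, Eval H ρ e₁ w → w = v) →
      (∀ {V : SValuation}, ValueSim V σ H α ρ → σ.g.val V = some (.bool true) →
        ∀ {U : Set ℕ}, U.Finite → σ.Scoped U →
        ∃ t R δ V', SPCEval σ U e₂ t R δ ∧ Set.EqOn V V' U ∧
          ∃ v, t.val V' = some v ∧ VTy Ψ v T₂ ∧ ∀ w, Eval H ρ e₂ w → w = v) →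
      ∃ t₁ R₁ δ₁ t₂ R₂ δ₂ V', SPCEval σ U e₁ t₁ R₁ δ₁ ∧
        SPCEval σ (U ∪ δ₁.names) e₂ t₂ R₂ δ₂ ∧ Set.EqOn V V' U ∧
        (∃ v, t₁.val V' = some v ∧ VTy Ψ v T₁ ∧ ∀ w, Eval H ρ e₁ w → w = v) ∧
        ∃ v, t₂.val V' = some v ∧ VTy Ψ v T₂ ∧ ∀ w, Eval H ρ e₂ w → w = v := by
    rintro e₁ e₂ T₁ T₂ V U hU hsc hσ hg ⟨t₁, R₁, δ₁, V₁, h1, h2, v₁, h3, h4⟩ ih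
    obtain ⟨t₂, R₂, δ₂, V₂, h5, h6, h7⟩ := ih (hσ.congr hsc h2)
      (SExpr.val_congr (h2.mono hsc.path) ▸ hg) (hU.union δ₁.names_finite)
      (hsc.mono Set.subset_union_left)
    refine ⟨t₁, R₁, δ₁, t₂, R₂, δ₂, V₂, h1, h5, h2.trans (h6.mono Set.subset_union_left),
      ⟨v₁, ?_, h4⟩, h7⟩
    rw [← SExpr.val_congr (h6.mono (h1.scope hsc).2)]
    exact h3
  induction e generalizing V U T with
  | lit l =>
    refine ⟨.lit l, ∅, [], V, .lit, fun _ _ => rfl, .lit l, rfl, (Eval.lit l).vty hH hρ hT, ?_⟩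
    rintro w ⟨⟩
    rfl
  | var x =>
    cases hT with
    | var hT =>
      obtain ⟨t, ht⟩ := Option.ne_none_iff_exists'.1 (hfv (Set.mem_singleton x))
      obtain ⟨v, h1, h2⟩ := hσ.env x t ht
      exact ⟨t, ∅, [], V, .var ht, fun _ _ => rfl, v, h1, hρ x v T h2 hT,
        fun w hw => hw.det (.var h2)⟩
  | field e f ih =>
    cases hT with
    | @field _ S fs _ _ hT hS hf =>
      obtain ⟨t, R, δ, V', h1, h2, v, h3, h4, h5⟩ := ih hσ hg hU hsc hT hfv
      have hσ' := hσ.congr hsc h2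
      have hg' : σ.g.val V' = some (.bool true) := SExpr.val_congr (h2.mono hsc.path) ▸ hg
      have hw : ∀ l, v = .loc l → ∀ w, Eval H ρ (.field e f) w → w = H l f := by
        rintro l rfl w hw
        cases hw with
        | field hw => cases h5 _ hw; rfl
      by_cases hInH : σ.InH t f
      · obtain ⟨t', u, h6, h7⟩ := hInH
        obtain ⟨l, rfl, h8, h9⟩ := (hσ'.field _ h6).lookup hg' h7 h3
        exact ⟨u, R, δ, V', .field h1 h7 h6, h2, H l f, h8, hH.field hS hf h4, hw l rfl⟩
      · by_cases hInO : σ.InO t f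
        · obtain ⟨t', u, h6, h7⟩ := hInO
          obtain ⟨l, rfl, h8, h9⟩ := (hσ'.optimistic _ h6).lookup hg' h7 h3
          exact ⟨u, R, δ, V', .fieldOptimistic h1 hInH h7 h6, h2, H l f, h8,
            hH.field hS hf h4, hw l rfl⟩
        · obtain ⟨ν, hν⟩ := (hU.union δ.names_finite).exists_notMem
          -- The receiver may be null, since an operand that the run-time evaluation skips is
          -- evaluated all the same. The read then has no value to match, and any value of the right
          -- type will do; the default one is taken.
          obtain ⟨x, hx, hx'⟩ : ∃ x, VTy Ψ x T ∧ ∀ w, Eval H ρ (.field e f) w → w = x := by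
            cases v with
            | loc l => exact ⟨H l f, hH.field hS hf h4, hw l rfl⟩
            | lit l =>
              refine ⟨_, VTy.default Ψ T, fun w hw => ?_⟩
              cases hw with | field hw => cases h5 _ hw
          -- A missing permission does no harm: the evaluation exists with a failing check, and no
          -- check is claimed to hold.
          obtain ⟨R', h6⟩ : ∃ R', SPCEval σ U (.field e f) (.sv ν) R'
              (δ ++ [(ν, .read t f)]) := by
            cases hi : σ.imp with
            | true => exact ⟨_, .fieldImprecise hi h1 hInH hInO hν⟩
            | false => exact ⟨_, .fieldMissing hi h1 hInH hInO hν⟩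
          refine ⟨_, R', _, Function.update V' ν x, h6, h2.trans ?_, x, ?_, hx, hx'⟩
          · exact (Set.EqOn.update_of_notMem hν x).mono Set.subset_union_left
          · simp [SExpr.val]
  | op o e₁ e₂ ih1 ih2 =>
    obtain ⟨T₁, T₂, hT1, hT2, hop⟩ := hT.op_eval
    obtain ⟨t₁, R₁, δ₁, t₂, R₂, δ₂, V', h1, h2, h3, ⟨v₁, h4, h5, h6⟩, v₂, h7, h8, h9⟩ :=
      two hU hsc hσ hg (ih1 hσ hg hU hsc hT1 (Set.subset_union_left.trans hfv))
        fun hσ hg _ hU hsc => ih2 hσ hg hU hsc hT2 (Set.subset_union_right.trans hfv)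
    obtain ⟨v, hv, hv'⟩ := hop Ψ v₁ v₂ h5 h8
    refine ⟨_, _, _, V', .op h1 h2, h3, v, by simp [SExpr.val, h4, h7, hv], hv', fun w hw => ?_⟩
    cases hw with
    | op hw1 hw2 hw =>
      rw [h6 _ hw1, h9 _ hw2, hv] at hw
      exact (Option.some.inj hw).symm
  | or e₁ e₂ ih1 ih2 =>
    cases hT with
    | or hT1 hT2 =>
      obtain ⟨t₁, R₁, δ₁, t₂, R₂, δ₂, V', h1, h2, h3, ⟨v₁, h4, h5, h6⟩, v₂, h7, h8, h9⟩ :=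
        two hU hsc hσ hg (ih1 hσ hg hU hsc hT1 (Set.subset_union_left.trans hfv))
          fun hσ hg _ hU hsc => ih2 hσ hg hU hsc hT2 (Set.subset_union_right.trans hfv)
      obtain ⟨b₁, rfl⟩ := h5.exists_bool
      obtain ⟨b₂, rfl⟩ := h8.exists_bool
      refine ⟨_, _, _, V', .or h1 h2, h3, .bool (b₁ || b₂), ?_, .bool _, fun w hw => ?_⟩
      · cases b₁ <;> cases b₂ <;> simp [SExpr.val, h4, h7]
      · cases hw with
        | orA hw => cases h6 _ hw; rfl
        | orB hw hw' => cases h6 _ hw; cases h9 _ hw'; rfl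
  | and e₁ e₂ ih1 ih2 =>
    cases hT with
    | and hT1 hT2 =>
      obtain ⟨t₁, R₁, δ₁, t₂, R₂, δ₂, V', h1, h2, h3, ⟨v₁, h4, h5, h6⟩, v₂, h7, h8, h9⟩ :=
        two hU hsc hσ hg (ih1 hσ hg hU hsc hT1 (Set.subset_union_left.trans hfv))
          fun hσ hg _ hU hsc => ih2 hσ hg hU hsc hT2 (Set.subset_union_right.trans hfv)
      obtain ⟨b₁, rfl⟩ := h5.exists_bool
      obtain ⟨b₂, rfl⟩ := h8.exists_bool
      refine ⟨_, _, _, V', .and h1 h2, h3, .bool (b₁ && b₂), ?_, .bool _, fun w hw => ?_⟩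
      · cases b₁ <;> cases b₂ <;> simp [SExpr.val, h4, h7]
      · cases hw with
        | andA hw => cases h6 _ hw; rfl
        | andB hw hw' => cases h6 _ hw; cases h9 _ hw'; rfl
  | not e ih =>
    cases hT with
    | not hT =>
      obtain ⟨t, R, δ, V', h1, h2, v, h3, h4, h5⟩ := ih hσ hg hU hsc hT hfv
      refine ⟨_, R, δ, V', .not h1, h2, v.neg, by simp [SExpr.val, h3], VTy.neg _ _, ?_⟩
      intro w hw
      cases hw with | not hw => rw [h5 _ hw]

theorem SPCEvalList.exists {P : Program} {Ψ : Loc → Option StructName} {Δ : TyEnv} {σ : SState}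
    {H : Heap} {α : Set Perm} {ρ : Env} (hH : HeapTy P Ψ H) {es : List Expr} {V : SValuation}
    (hσ : ValueSim V σ H α ρ) (hρ : EnvTy Ψ Δ ρ) (hg : σ.g.val V = some (.bool true)) {U : Set ℕ}
    (hU : U.Finite) (hsc : σ.Scoped U) {params : List (Var × Ty)} (hT : ArgsTy P Δ es params)
    (hfv : argsFv es ⊆ σ.dom) :
    ∃ ts R δ V', SPCEvalList σ U es ts R δ ∧ Set.EqOn V V' U ∧
      ∃ vs, SVals V' ts vs ∧ ∀ ws, List.Forall₂ (Eval H ρ) es ws → ws = vs := by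
  induction es generalizing V U params with
  | nil => exact ⟨[], ∅, [], V, .nil, fun _ _ => rfl, [], .nil, fun ws hw => by cases hw; rfl⟩
  | cons e es ih =>
    cases hT with
    | cons hT1 hT2 =>
      obtain ⟨t, R, δ, V₁, h1, h2, v, h3, h4, h5⟩ := SPCEval.exists hH hσ hρ hg hU hsc hT1
        fun x hx => hfv ⟨e, by simp, hx⟩
      obtain ⟨ts, R', δ', V₂, h6, h7, vs, h8, h9⟩ := ih (hσ.congr hsc h2)
        (SExpr.val_congr (h2.mono hsc.path) ▸ hg) (hU.union δ.names_finite)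
        (hsc.mono Set.subset_union_left) hT2 fun x ⟨e', he, hx⟩ => hfv ⟨e', by simp [he], hx⟩
      refine ⟨t :: ts, _, _, V₂, .cons h1 h6, h2.trans (h7.mono Set.subset_union_left),
        v :: vs, .cons ?_ h8, ?_⟩
      · rw [← SExpr.val_congr (h7.mono (h1.scope hsc).2)]
        exact h3
      · intro ws hw
        cases hw with | cons hw1 hw2 => rw [h5 _ hw1, h9 _ hw2]

/-- Production follows the validity derivation: it takes the branch of a conditional that is valid,
and gives a new field chunk the content of the heap. The last conclusion confines the footprints of
new chunks to `α`. It is what makes the induction pass a separating conjunction. -/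
theorem SProduceF.exists {P : Program} (hP : P.PredSpecs) {Ψ : Loc → Option StructName}
    {Δ : TyEnv} {H : Heap} {α β : Set Perm} {ρ : Env} (hH : HeapTy P Ψ H) (hρ : EnvTy Ψ Δ ρ)
    {φ : Formula} {V : SValuation} {σ : SState} (hσ : SimState P V σ H β ρ) {U : Set ℕ}
    (hU : U.Finite) (hsc : σ.Scoped U) (hA : Assert P H α ρ ⟨false, φ⟩) (hα : α ⊆ β)
    (hd : ∀ c ∈ σ.H, Disjoint (vfoot P V H c.perm) α) (hT : FormulaTy P Δ φ)
    (hfv : φ.fv ⊆ σ.dom) :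
    ∃ σ' δ V', SProduceF U σ φ σ' δ ∧ Set.EqOn V V' U ∧ SimState P V' σ' H β ρ ∧
      ∀ c ∈ σ'.H, c ∈ σ.H ∨ vfoot P V' H c.perm ⊆ α := by
  have keep : ∀ {σ : SState} {V V' : SValuation} {U : Set ℕ} {α : Set Perm}, σ.Scoped U →
      Set.EqOn V V' U → (∀ c ∈ σ.H, Disjoint (vfoot P V H c.perm) α) →
      ∀ c ∈ σ.H, Disjoint (vfoot P V' H c.perm) α := by
    intro σ V V' U α hsc hV hd c hc
    rw [← vfoot_congr (hV.mono (c.perm_svals.trans (hsc.chunk c hc)))]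
    exact hd c hc
  induction φ generalizing V σ U α with
  | expr e =>
    cases hA with
    | value he =>
      obtain ⟨t, R, δ, V', h1, h2, v, h3, h4, h5⟩ :=
        SPCEval.exists hH hσ.valueSim hρ hσ.path hU hsc hT hfv
      cases h5 _ he
      have h6 := hσ.congr hsc h2
      exact ⟨_, δ, V', .expr h1, h2, h6.setPath (SExpr.val_and.2 ⟨h6.path, h3⟩),
        fun c hc => .inl hc⟩
  | pred p es =>
    cases hA with
    | @pred _ _ _ _ d vs hp hes hA =>
      obtain ⟨d', hd', hT⟩ := hT
      cases hp.symm.trans hd'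
      obtain ⟨ts, R, δ, V', h1, h2, vs', h3, h4⟩ :=
        SPCEvalList.exists hH hσ.valueSim hρ hσ.path hU hsc hT hfv
      cases h4 _ hes
      have h5 : vfoot P V' H (.pred p ts) ⊆ α := by
        rw [vfoot_pred hp h3]
        exact hA.efoot_subset hP (hP p d hp)
      refine ⟨_, δ, V', .pred h1, h2, (hσ.congr hsc h2).insert ?_ ?_ ?_, ?_⟩
      · rintro c' ⟨⟩
      · rintro p' ts' ⟨⟩
        exact ⟨d, vs, hp, h3, hA.mono hα⟩
      · exact fun c hc => (keep hsc h2 hd c hc).mono_right h5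
      · rintro c (rfl | hc)
        · exact .inr h5
        · exact .inl hc
  | acc e f =>
    cases hA with
    | @acc _ _ _ _ l he hl =>
      obtain ⟨T, hT⟩ := hT
      cases hT with
      | field hT =>
        obtain ⟨t, R, δ, V', h1, h2, v, h3, h4, h5⟩ :=
          SPCEval.exists hH hσ.valueSim hρ hσ.path hU hsc hT hfv
        cases h5 _ he
        obtain ⟨ν, hν⟩ := (hU.union δ.names_finite).exists_notMem
        have h6 := Set.EqOn.update_of_notMem (V := V') hν (H l f)
        have h7 := h2.trans (h6.mono Set.subset_union_left)
        have h8 : t.val (Function.update V' ν (H l f)) = some (.loc l) := by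
          rw [← SExpr.val_congr (h6.mono (h1.scope hsc).2)]
          exact h3
        have h9 : vfoot P (Function.update V' ν (H l f)) H (.field t f) ⊆ α := by
          rintro ⟨l', f'⟩ ⟨h9, h10⟩
          cases h8.symm.trans h9
          cases h10
          exact hl
        refine ⟨_, _, _, .acc h1 hν, h7, (hσ.congr hsc h7).insert ?_ ?_ ?_, ?_⟩
        · rintro c' ⟨⟩
          exact ⟨l, h8, by simp [SExpr.val], hα hl⟩
        · rintro p' ts' ⟨⟩
        · exact fun c hc => (keep hsc h7 hd c hc).mono_right h9
        · rintro c (rfl | hc)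
          · exact .inr h9
          · exact .inl hc
  | sep φ₁ φ₂ ih1 ih2 =>
    cases hA with
    | @sep _ α₁ α₂ _ _ _ hA1 hA2 hsub hdis =>
      have hsub1 := Set.subset_union_left.trans hsub
      have hsub2 := Set.subset_union_right.trans hsub
      obtain ⟨σ₁, δ₁, V₁, h1, h2, h3, h4⟩ := ih1 hσ hU hsc hA1 (hsub1.trans hα)
        (fun c hc => (hd c hc).mono_right hsub1) hT.1 (Set.subset_union_left.trans hfv)
      obtain ⟨h5, h6⟩ := h1.scope hsc
      -- A chunk present after the first conjunct either is old, hence disjoint from all of `α`, or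
      -- lies within `α₁`; in both cases it avoids `α₂`.
      obtain ⟨σ₂, δ₂, V₂, h7, h8, h9, h10⟩ := ih2 h3 (hU.union δ₁.names_finite) h6 hA2
        (hsub2.trans hα) (fun c hc => by
          rcases h4 c hc with hc | hc
          · exact (keep hsc h2 hd c hc).mono_right hsub2
          · exact (Set.disjoint_iff_inter_eq_empty.2 hdis).mono_left hc)
        hT.2 (by
          intro x hx
          change σ₁.γ x ≠ none
          rw [h1.props.1]
          exact hfv (.inr hx))
      refine ⟨σ₂, _, V₂, .sep h1 h7, h2.trans (h8.mono Set.subset_union_left), h9,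
        fun c hc => ?_⟩
      rcases h10 c hc with hc | hc
      · rcases h4 c hc with hc' | hc'
        · exact .inl hc'
        · right
          rw [← vfoot_congr (h8.mono (c.perm_svals.trans (h6.chunk c hc)))]
          exact hc'.trans hsub1
      · exact .inr (hc.trans hsub2)
  | ite e φ₁ φ₂ ih1 ih2 =>
    obtain ⟨t, R, δ, V', h1, h2, v, h3, h4, h5⟩ :=
      SPCEval.exists hH hσ.valueSim hρ hσ.path hU hsc hT.1
        ((Set.subset_union_left.trans Set.subset_union_left).trans hfv)
    have h6 := hσ.congr hsc h2
    have h7 := h1.scope hsc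
    cases hA with
    | iteA he hA =>
      cases h5 _ he
      obtain ⟨σ₂, δ₂, V₂, h8, h9, h10, h11⟩ := ih1 (h6.setPath (SExpr.val_and.2 ⟨h6.path, h3⟩))
        (hU.union δ.names_finite) ((hsc.mono Set.subset_union_left).and h7.2) hA hα
        (keep (σ := σ) hsc h2 hd) hT.2.1
        ((Set.subset_union_right.trans Set.subset_union_left).trans hfv)
      exact ⟨σ₂, _, V₂, .iteA h1 h8, h2.trans (h9.mono Set.subset_union_left), h10, h11⟩
    | iteB he hA =>
      cases h5 _ he
      obtain ⟨σ₂, δ₂, V₂, h8, h9, h10, h11⟩ := ih2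
        (h6.setPath (SExpr.val_and.2 ⟨h6.path, SExpr.val_not.2 h3⟩))
        (hU.union δ.names_finite) ((hsc.mono Set.subset_union_left).and (t := .not _) h7.2) hA hα
        (keep (σ := σ) hsc h2 hd) hT.2.2 (Set.subset_union_right.trans hfv)
      exact ⟨σ₂, _, V₂, .iteB h1 h8, h2.trans (h9.mono Set.subset_union_left), h10, h11⟩

/-- A valid formula can be produced, if its permissions are disjoint from those of the chunks. -/
theorem SProduce.exists {P : Program} (hP : P.PredSpecs) {Ψ : Loc → Option StructName}
    {Δ : TyEnv} {H : Heap} {α β : Set Perm} {ρ : Env} (hH : HeapTy P Ψ H) (hρ : EnvTy Ψ Δ ρ)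
    {φ : GFormula} {V : SValuation} {σ : SState} (hσ : SimState P V σ H β ρ) {U : Set ℕ}
    (hU : U.Finite) (hsc : σ.Scoped U) (hA : Assert P H α ρ φ) (hα : α ⊆ β)
    (hd : ∀ c ∈ σ.H, Disjoint (vfoot P V H c.perm) α) (hT : FormulaTy P Δ φ.body)
    (hfv : φ.body.fv ⊆ σ.dom) :
    ∃ σ' δ V', SProduce U σ φ σ' δ ∧ Set.EqOn V V' U ∧ SimState P V' σ' H β ρ := by
  obtain ⟨imp, φ⟩ := φ
  cases imp with
  | false =>
    obtain ⟨σ', δ, V', h1, h2, h3, _⟩ := SProduceF.exists hP hH hρ hσ hU hsc hA hα hd hT hfv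
    exact ⟨σ', δ, V', .precise h1, h2, h3⟩
  | true =>
    cases hA with
    | imprecise hA =>
      obtain ⟨σ', δ, V', h1, h2, h3, _⟩ := SProduceF.exists hP (σ := { σ with imp := true }) hH hρ
        ⟨hσ.field, hσ.pred, hσ.disjoint, hσ.optimistic, hσ.env, hσ.path⟩ hU
        ⟨hsc.path, hsc.chunk, hsc.optimistic, hsc.env⟩ hA hα hd hT hfv
      exact ⟨σ', δ, V', .imprecise h1, h2, h3⟩

/-- The modified variables can be replaced by fresh values that stand for new run-time values. -/
theorem Havoc.exists {ρ : Env} {xs : List Var} {γ : SEnv} {V : SValuation} {U : Set ℕ}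
    (hU : U.Finite) (hγ : ∀ x t, γ x = some t → t.svals ⊆ U)
    (h₁ : ∀ x t, γ x = some t → ∃ v, ρ x = some v)
    (h₂ : ∀ x t, x ∉ xs → γ x = some t → ∃ v, t.val V = some v ∧ ρ x = some v) :
    ∃ γ' δ V', Havoc U γ xs γ' δ ∧ Set.EqOn V V' U ∧
      ∀ x t, γ' x = some t → ∃ v, t.val V' = some v ∧ ρ x = some v := by
  induction xs generalizing γ V U with
  | nil => exact ⟨γ, [], V, .nil, fun _ _ => rfl, fun x t => h₂ x t (by simp)⟩
  | cons y ys ih =>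
    cases hy : γ y with
    | none =>
      obtain ⟨γ', δ, V', h3, h4, h5⟩ := ih hU hγ h₁ fun x t hx ht => by
        refine h₂ x t ?_ ht
        rintro (_ | ⟨_, h⟩)
        · rw [hy] at ht; cases ht
        · exact hx h
      exact ⟨γ', δ, V', .undef hy h3, h4, h5⟩
    | some u =>
      obtain ⟨v, hv⟩ := h₁ y u hy
      obtain ⟨ν, hν⟩ := hU.exists_notMem
      have hV := Set.EqOn.update_of_notMem (V := V) hν v
      obtain ⟨γ', δ, V', h3, h4, h5⟩ := ih (γ := Function.update γ y (some (.sv ν)))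
        (V := Function.update V ν v) (hU.insert ν)
        (SEnv.update_svals (fun x t hx => (hγ x t hx).trans (Set.subset_insert _ _))
          (Set.singleton_subset_iff.2 (Set.mem_insert _ _)))
        (fun x t hx => by
          by_cases hxy : x = y
          · exact ⟨v, hxy ▸ hv⟩
          · rw [Function.update_of_ne hxy] at hx
            exact h₁ x t hx)
        -- A variable outside of `ys` is either unmodified or is `y`, whose fresh value already
        -- stands for its new content.
        (fun x t hx ht => by
          by_cases hxy : x = y
          · subst hxy
            rw [Function.update_self] at ht
            cases ht
            exact ⟨v, by simp [SExpr.val], hv⟩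
          · rw [Function.update_of_ne hxy] at ht
            rw [← SExpr.val_congr (hV.mono (hγ x t ht))]
            exact h₂ x t (by simp [hxy, hx]) ht)
      exact ⟨γ', _, V', .cons hy hν h3, hV.trans (h4.mono (Set.subset_insert _ _)), h5⟩

/-- After a specification is consumed, the remaining chunks correspond to the permissions that are
not handed over. -/
theorem SConsume.sound_diff_foot {P : Program} (hP : P.PredSpecs) {Ψ : Loc → Option StructName}
    {Δ : TyEnv} {V : SValuation} {H : Heap} {α : Set Perm} {ρ : Env} (hH : HeapTy P Ψ H)
    (hρ : EnvTy Ψ Δ ρ) {U : Set ℕ} {σ σ' : SState} {φ : GFormula} {R : Set Check} {δ : Trace}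
    (h : SConsume U σ φ σ' R δ) (hσ : SimState P V σ H α ρ) (hO : σ.OptOK)
    (hg' : σ'.g.val V = some (.bool true)) (hδ : δ.Consistent H V)
    (hR : ∀ r ∈ R, r.Holds P V H α) (hT : FormulaTy P Δ φ.body) (hφ : Specification P φ) :
    SimState P V σ' H
      (α \ foot P H (α \ vfootSet P V H (remPerms P σ' φ)) ρ φ) ρ := by
  have h1 := h.simState hσ hg'
  refine h1.restrict fun θ hθ a ha => ⟨h1.vfoot_subset hP hθ ha, fun hf => ?_⟩
  unfold foot at hf
  -- If the specification is completely precise, only its exact footprint is handed over, and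
  -- consumption separated this from the remaining chunks. Otherwise the exclusion frame has
  -- withheld the footprints of these chunks.
  split_ifs at hf with hcp
  · exact Set.disjoint_left.1 ((h.sound hP hH hρ hσ hO hg' hδ hR hT hφ).2 θ hθ) ha hf
  · exact hf.2 ⟨θ, ⟨hcp, hθ⟩, ha⟩

/-! ## Partially validated stacks -/

theorem PartialValid.heap {P : Program} (hP : P.PredSpecs) {H H' : Heap} {S : Stack} {Sg : VState}
    {V : SValuation} (h : PartialValid P H S Sg V) (hH : ∀ fr ∈ S, H.AgreeOn H' fr.α) :
    PartialValid P H' S Sg V := by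
  induction h with
  | nil => exact .nil
  | call h1 _ h3 h4 h5 h6 h7 ih =>
    exact .call h1 (ih fun fr hfr => hH fr (List.mem_cons_of_mem _ hfr)) h3 h4 h5 h6
      (h7.heap hP (hH _ List.mem_cons_self))
  | loop _ h3 h4 h5 ih =>
    exact .loop (ih fun fr hfr => hH fr (List.mem_cons_of_mem _ hfr)) h3 h4
      (h5.heap hP (hH _ List.mem_cons_self))

/-- Partial validity depends on the verification state above only through its post-condition and
the values of variables that are not modified. -/
theorem PartialValid.replace {P : Program} {Ψ : Loc → Option StructName} {Δ : TyEnv} {H : Heap}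
    {fr : Frame} {S : Stack} {σ σ' : SState} {s s' : Stmt} {φ : GFormula} {V V' : SValuation}
    (h : PartialValid P H S (.run σ s φ) V) (hS : StackOK P Ψ Δ (fr :: S))
    (hγ : ∀ x t v, x ∉ fr.s.modified → σ.γ x = some t → t.val V = some v →
      ∃ t', σ'.γ x = some t' ∧ t'.val V' = some v) :
    PartialValid P H S (.run σ' s' φ) V' := by
  cases h with
  | nil => exact .nil
  | call h1 h2 h3 h4 h5 h6 h7 =>
    cases hS with
    | call _ hm _ _ _ hx =>
      cases h1.symm.trans hm
      refine .call h1 h2 h3 h4 ?_ h6 h7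
      refine ((List.forall₂_and_left (p := fun x => x ∈ _) _ _).2 ⟨fun x hx => hx, h5⟩).imp ?_
      rintro x t ⟨hxd, tₓ, v, h8, h9, h10⟩
      obtain ⟨t', h11, h12⟩ := hγ x tₓ v (fun hxm => hx x hxm hxd) h8 h9
      exact ⟨t', v, h11, h12, h10⟩
  | loop h1 h2 h3 h4 => exact .loop h1 h2 h3 h4

theorem PartialValid.setVal {P : Program} {H : Heap} {S : Stack} {σ : SState} {s s' : Stmt}
    {φ : GFormula} {V V' : SValuation} (h : PartialValid P H S (.run σ s φ) V)
    (hV : Set.EqOn V V' σ.svals) : PartialValid P H S (.run σ s' φ) V' := by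
  cases h with
  | nil => exact .nil
  | call h1 h2 h3 h4 h5 h6 h7 =>
    refine .call h1 h2 h3 h4 (h5.imp ?_) h6 h7
    rintro x t ⟨tₓ, v, h8, h9, h10⟩
    exact ⟨tₓ, v, h8, SExpr.val_congr (hV.mono (σ.scoped_svals.env x tₓ h8)) ▸ h9, h10⟩
  | loop h1 h2 h3 h4 => exact .loop h1 h2 h3 h4

theorem ValidState.run {P : Program} {Sg : VState} {σ : SState} {s : Stmt} {φ : GFormula}
    {V : SValuation} {H : Heap} {α : Set Perm} {ρ : Env} {S : Stack}
    (hr : VTrans P Sg (.run σ s φ)) (hsim : SimState P V σ H α ρ)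
    (hpv : PartialValid P H S (.run σ s φ) V) : ValidState P (.run H (⟨α, ρ, s⟩ :: S)) := by
  refine ⟨_, V, .inr ⟨_, hr⟩, ⟨rfl, hsim⟩, ?_⟩
  rintro _ _ _ ⟨⟩
  exact hpv

/-- With this, the corresponding valuation agrees with the given one on the verification state and
is consistent with all fresh values of the guard. -/
theorem Guard.fresh {P : Program} {σ σ' : SState} {s : Stmt} {φ : GFormula} {R : Set Check}
    {Θ : Set SPerm} {δ : Trace} (h : Guard P (.run σ s φ) σ' R Θ δ) : δ.Fresh σ.svals := by
  have hσ := σ.scoped_svals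
  cases h with
  | seq | alloc => trivial
  | assign h | ite h => exact (h.scope hσ).1
  | assert h | finish h => exact (h.scope hσ).1
  | assignField he hc =>
    obtain ⟨h1, _, h2⟩ := he.scope hσ
    exact h1.append (hc.scope h2).1
  | call _ he hc | foldPred _ he hc =>
    obtain ⟨h1, h2, h3⟩ := he.scope hσ
    exact h1.append (hc.scope (h3.setEnv (mkEnv_svals h2))).1
  | unfoldPred he hc =>
    obtain ⟨h1, h2, h3⟩ := he.scope hσ
    exact h1.append (hc.scope h3).1
  | @loop σ e ψ b s φ σ' R δ₁ γ' δ₂ σ'' δ₃ t R' δ₄ hc hh hp he =>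
    obtain ⟨h1, h2⟩ := hc.scope hσ
    obtain ⟨h3, h4⟩ := hh.scope h2.env
    obtain ⟨h5, h6⟩ := hp.scope ((h2.mono Set.subset_union_left).setEnv h4)
    have h7 := (he.scope h6).1
    have h8 := h1.append h3
    have e1 : σ.svals ∪ Trace.names (δ₁ ++ δ₂) = σ.svals ∪ δ₁.names ∪ δ₂.names := by
      rw [Trace.names_append, Set.union_assoc]
    have h9 := h8.append (e1 ▸ h5)
    refine h9.append ?_
    rw [Trace.names_append, ← Set.union_assoc, e1]
    exact h7

theorem SVals.mkEnv {V : SValuation} {ts : List SExpr} {vs : List Value} (h : SVals V ts vs)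
    {xs : List Var} {x : Var} {t : SExpr} (hx : mkEnv xs ts x = some t) :
    ∃ v, t.val V = some v ∧ GradualC0.mkEnv xs vs x = some v := by
  obtain ⟨v, h1, h2⟩ := mkEnv_forall₂ h hx
  exact ⟨v, h2, h1⟩

/-- A method is verified for arbitrary parameters, named here by the first natural numbers, and this
valuation instantiates them with the actual arguments. Its value beyond the list is never used. -/
theorem sVals_range (vs : List Value) :
    SVals (fun i => vs[i]?.getD (.lit .null)) ((List.range vs.length).map SExpr.sv) vs := by
  refine List.forall₂_iff_get.2 ⟨by simp, fun i h₁ h₂ => ?_⟩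
  simp [SExpr.val, List.getElem?_eq_getElem h₂]

theorem ExprTy.fv {P : Program} {Δ : TyEnv} {e : Expr} {T : Ty} (h : ExprTy P Δ e T) {x : Var}
    (hx : x ∈ e.fv) : Δ x ≠ none := by
  induction h with
  | int | char | bool | null => cases hx
  | var h => cases hx; simp [h]
  | field _ _ _ ih => exact ih hx
  | not _ ih => exact ih hx
  | arith _ _ _ ih1 ih2 | order _ _ _ ih1 ih2 | equality _ _ _ ih1 ih2 | or _ _ ih1 ih2
  | and _ _ ih1 ih2 => exact hx.elim ih1 ih2

theorem ArgsTy.fv {P : Program} {Δ : TyEnv} {es : List Expr} {params : List (Var × Ty)}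
    (h : ArgsTy P Δ es params) {x : Var} (hx : x ∈ argsFv es) : Δ x ≠ none := by
  obtain ⟨e, he, hx⟩ := hx
  induction h with
  | nil => cases he
  | cons h _ ih =>
    rcases List.mem_cons.1 he with rfl | he
    · exact h.fv hx
    · exact ih he

theorem FormulaTy.fv {P : Program} {Δ : TyEnv} {φ : Formula} (h : FormulaTy P Δ φ) {x : Var}
    (hx : x ∈ φ.fv) : Δ x ≠ none := by
  induction φ with
  | expr e => exact ExprTy.fv h hx
  | pred p es => obtain ⟨d, _, h⟩ := h; exact h.fv hx
  | acc e f =>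
    obtain ⟨T, h⟩ := h
    exact ExprTy.fv h (e := .field e f) hx
  | sep φ₁ φ₂ ih1 ih2 => exact hx.elim (ih1 h.1) (ih2 h.2)
  | ite e φ₁ φ₂ ih1 ih2 =>
    rcases hx with (hx | hx) | hx
    · exact h.1.fv hx
    · exact ih1 h.2.1 hx
    · exact ih2 h.2.2 hx

/-! ## Preservation for the single execution steps -/

/-- The common situation of the execution steps: a validated state with its invariants. -/
structure StepContext (P : Program) (V : SValuation) (σ : SState) (s : Stmt) (φ : GFormula)
    (H : Heap) (α : Set Perm) (ρ : Env) (S : Stack) : Prop where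
  wf : P.WellFormed
  reachable : VReachable P (.run σ s φ)
  sim : SimState P V σ H α ρ
  partialValid : PartialValid P H S (.run σ s φ) V
  inv : ExecInv P H (⟨α, ρ, s⟩ :: S)

section

variable {P : Program} {V : SValuation} {σ : SState} {φ : GFormula} {H : Heap} {α : Set Perm}
  {ρ : Env} {S : Stack}

theorem StepContext.verifInv {s : Stmt} (h : StepContext P V σ s φ H α ρ S) : VerifInv σ s :=
  h.reachable.inv h.wf

/-- A step of symbolic execution whose state corresponds to the new run-time state. -/
theorem ValidState.step {s s' : Stmt} (hr : VReachable P (.run σ s φ))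
    (hpv : PartialValid P H S (.run σ s φ) V) {Ψ : Loc → Option StructName} {Δ : TyEnv}
    {α₀ : Set Perm} {ρ₀ : Env} (hS : StackOK P Ψ Δ (⟨α₀, ρ₀, s⟩ :: S)) {σ' : SState}
    (hs : SExec P σ s s' σ') {V' : SValuation} {α' : Set Perm} {ρ' : Env}
    (hsim : SimState P V' σ' H α' ρ') (hγ : ∀ x ∉ s.modified, σ'.γ x = σ.γ x)
    (hV : Set.EqOn V V' σ.svals) : ValidState P (.run H (⟨α', ρ', s'⟩ :: S)) := by
  obtain ⟨Sg, hr⟩ := hr.resolve_left nofun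
  refine .run (.step hr hs) hsim (hpv.replace hS fun x t v hx ht hv => ?_)
  exact ⟨t, (hγ x hx).trans ht, SExpr.val_congr (hV.mono (σ.scoped_svals.env x t ht)) ▸ hv⟩

/-- The frames below are affected only through the heap, so it suffices that the heap is unchanged
where they own permissions. The default argument covers steps that leave the heap alone. -/
theorem StepContext.valid {s s' : Stmt} (h : StepContext P V σ s φ H α ρ S) {σ' : SState}
    (hs : SExec P σ s s' σ') {V' : SValuation} {H' : Heap} {α' : Set Perm} {ρ' : Env}
    (hsim : SimState P V' σ' H' α' ρ') (hγ : ∀ x ∉ s.modified, σ'.γ x = σ.γ x)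
    (hV : Set.EqOn V V' σ.svals) (hH : ∀ fr ∈ S, H.AgreeOn H' fr.α := by exact fun _ _ _ _ _ => rfl) :
    ValidState P (.run H' (⟨α', ρ', s'⟩ :: S)) := by
  obtain ⟨Ψ, Δ, _, hS⟩ := h.inv.typed
  exact .step h.reachable (h.partialValid.heap h.wf.predSpecs hH) hS hs hsim hγ hV

theorem SState.update_of_not_modified {γ γ' : SEnv} {x y : Var} {t : Option SExpr} {s : Stmt}
    (hx : x ∉ y :: s.modified) (h : γ' x = γ x) : Function.update γ' y t x = γ x := by
  rw [Function.update_of_ne (by rintro rfl; simp at hx), h]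

theorem env_update {γ : SEnv} {y : Var} {u : SExpr} {v : Value}
    (h : ∀ x t, γ x = some t → ∃ v, t.val V = some v ∧ ρ x = some v) (hu : u.val V = some v)
    (x : Var) (t : SExpr) (hx : Function.update γ y (some u) x = some t) :
    ∃ w, t.val V = some w ∧ Function.update ρ y (some v) x = some w := by
  by_cases hxy : x = y
  · subst hxy
    rw [Function.update_self] at hx
    cases hx
    exact ⟨v, hu, Function.update_self _ _ _⟩
  · rw [Function.update_of_ne hxy] at hx ⊢
    exact h x t hx

/-- From here on `V` is already the corresponding valuation of the guard. The evaluation in the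
guard is the one used by the symbolic step, so here nothing is left to construct. -/
theorem StepContext.assign {x : Var} {e : Expr} {s : Stmt} {v : Value}
    (h : StepContext P V σ (.seq (.assign x e) s) φ H α ρ S) (hv : Eval H ρ e v) {σ' : SState}
    {t : SExpr} {R : Set Check} {δ : Trace} (he : SEval σ.svals σ e t σ' R δ)
    (hδ : δ.Consistent H V) (hg : σ'.g.val V = some (.bool true))
    (hR : ∀ r ∈ R, r.Holds P V H α) :
    ValidState P (.run H (⟨α, Function.update ρ x (some v), s⟩ :: S)) := by
  obtain ⟨Ψ, Δ, hH, hS⟩ := h.inv.typed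
  have hf := hS.frame
  obtain ⟨⟨T, hx, hT⟩, hs⟩ := hf.stmt
  obtain ⟨h1, v', h2, h3⟩ := he.sound hH hf.env h.sim.valueSim hg hδ hR hT
  cases hv.det h3
  exact h.valid (.assign he)
    ((h.sim.extends he.extends h1 hg).setEnv (env_update h.sim.env h2))
    (fun y hy => SState.update_of_not_modified hy rfl) fun _ _ => rfl

/-- The guard leaves the branch open; the run-time value of the condition selects the symbolic rule,
and makes the new conjunct of the path condition true. -/
theorem StepContext.ite {e : Expr} {s₁ s₂ s : Stmt} {b : Bool}
    (h : StepContext P V σ (.seq (.ite e s₁ s₂) s) φ H α ρ S) (hv : Eval H ρ e (.bool b))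
    {σ' : SState} {t : SExpr} {R : Set Check} {δ : Trace} (he : SEval σ.svals σ e t σ' R δ)
    (hδ : δ.Consistent H V) (hg : σ'.g.val V = some (.bool true))
    (hR : ∀ r ∈ R, r.Holds P V H α) :
    ValidState P (.run H (⟨α, ρ, (bif b then s₁ else s₂).append s⟩ :: S)) := by
  obtain ⟨Ψ, Δ, hH, hS⟩ := h.inv.typed
  have hf := hS.frame
  obtain ⟨h1, v', h2, h3⟩ := he.sound hH hf.env h.sim.valueSim hg hδ hR hf.stmt.1.1
  cases hv.det h3
  have h4 := h.sim.extends he.extends h1 hg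
  cases b with
  | true =>
    exact h.valid (.iteA he) (h4.setPath (SExpr.val_and.2 ⟨hg, h2⟩))
      (fun x _ => congrFun he.extends.env x) fun _ _ => rfl
  | false =>
    exact h.valid (.iteB he) (h4.setPath (SExpr.val_and.2 ⟨hg, SExpr.val_not.2 h2⟩))
      (fun x _ => congrFun he.extends.env x) fun _ _ => rfl

/-- The execution step itself provides validity, so soundness of consumption is not needed.
Imprecise consumption empties the heaps, so the formula can be produced with all permissions; of the
result only the path condition is kept. -/
theorem StepContext.assert {ψ : GFormula} {s : Stmt}
    (h : StepContext P V σ (.seq (.assert ψ) s) φ H α ρ S)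
    (hA : Assert P H α ρ ⟨true, ψ.body⟩) {σ' : SState} {R : Set Check} {δ : Trace}
    (hc : SConsume σ.svals σ ⟨true, ψ.body⟩ σ' R δ) (hg : σ'.g.val V = some (.bool true)) :
    ValidState P (.run H (⟨α, ρ, s⟩ :: S)) := by
  obtain ⟨Ψ, Δ, hH, hS⟩ := h.inv.typed
  have hf := hS.frame
  have h1 := hc.simState h.sim hg
  obtain ⟨h2, h3⟩ := hc.scope σ.scoped_svals
  obtain ⟨σ'', δ', V', h4, h5, h6⟩ := SProduce.exists h.wf.predSpecs hH hf.env h1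
    (h.verifInv.finite.union δ.names_finite) h3 hA subset_rfl
    (by cases hc; exact fun c hc => hc.elim) hf.stmt.1
    (by rw [SState.dom, hc.shrinks.env]; exact h.verifInv.init.1)
  have h7 := h5.mono Set.subset_union_left
  exact h.valid (.assert hc h4) ((h.sim.congr σ.scoped_svals h7).setPath h6.path)
    (fun _ _ => rfl) h7

/-- The body is consumed in the environment of the arguments. Its exact footprint is also that of
the new predicate chunk, so soundness of consumption yields both validity and separation of this
chunk. -/
theorem StepContext.foldPred {p : PredName} {es : List Expr} {s : Stmt}
    (h : StepContext P V σ (.seq (.foldPred p es) s) φ H α ρ S) {d : PredDecl}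
    (hd : P.preds p = some d) {σ₁ σ₂ : SState} {ts : List SExpr} {R₁ R₂ : Set Check}
    {δ₁ δ₂ : Trace} (he : SEvalList σ.svals σ es ts σ₁ R₁ δ₁)
    (hc : SConsume (σ.svals ∪ δ₁.names) { σ₁ with γ := mkEnv d.vars ts } d.body σ₂ R₂ δ₂)
    (hδ : Trace.Consistent H V (δ₁ ++ δ₂)) (hg : σ₂.g.val V = some (.bool true))
    (hR : ∀ r ∈ R₁ ∪ R₂, r.Holds P V H α) : ValidState P (.run H (⟨α, ρ, s⟩ :: S)) := by
  obtain ⟨Ψ, Δ, hH, hS⟩ := h.inv.typed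
  have hf := hS.frame
  obtain ⟨d', hd', hT⟩ := hf.stmt.1
  cases hd.symm.trans hd'
  have hg1 : σ₁.g.val V = some (.bool true) := hc.shrinks.path V hg
  obtain ⟨h1, vs, h2, h3⟩ := he.sound hH hf.env h.sim.valueSim hg1 hδ.left
    (fun r hr => hR r (.inl hr)) hT
  have h4 := (h.sim.extends he.extends h1 hg1).setEnv (ρ' := mkEnv d.vars vs)
    fun x t hx => h2.mkEnv hx
  have hρ := EnvTy.params (Eval.list_vty hH hf.env h3 hT)
  have hwd := h.wf.preds p d hd
  obtain ⟨h5, h6⟩ := hc.sound h.wf.predSpecs hH hρ h4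
    (show σ₁.OptOK from h.verifInv.optOK.extends he.extends) hg hδ.right
    (fun r hr => hR r (.inr hr)) hwd.typed hwd.spec
  have h7 := (hc.simState h4 hg).insert (c := .pred p ts) (by rintro _ ⟨⟩)
    (by rintro _ _ ⟨⟩; exact ⟨d, vs, hd, h2, h5⟩)
    fun c hc => by
      rw [show Chunk.perm (.pred p ts) = .pred p ts from rfl, vfoot_pred hd h2]
      exact h6 _ (.inl ⟨c, hc, rfl⟩)
  exact h.valid (.foldPred hd he hc) (h7.setEnv h.sim.env) (fun _ _ => rfl) fun _ _ => rfl

/-- Consuming the instance shows that its body is valid in the demanded permissions, which the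
remaining chunks avoid. So the body can be produced in their place. -/
theorem StepContext.unfoldPred {p : PredName} {es : List Expr} {s : Stmt}
    (h : StepContext P V σ (.seq (.unfoldPred p es) s) φ H α ρ S) {σ₁ σ₂ : SState}
    {ts : List SExpr} {R₁ R₂ : Set Check} {δ₁ δ₂ : Trace}
    (he : SEvalList σ.svals σ es ts σ₁ R₁ δ₁)
    (hc : SConsume (σ.svals ∪ δ₁.names) σ₁ ⟨false, .pred p es⟩ σ₂ R₂ δ₂)
    (hδ : Trace.Consistent H V (δ₁ ++ δ₂)) (hg : σ₂.g.val V = some (.bool true))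
    (hR : ∀ r ∈ R₁ ∪ R₂, r.Holds P V H α) : ValidState P (.run H (⟨α, ρ, s⟩ :: S)) := by
  obtain ⟨Ψ, Δ, hH, hS⟩ := h.inv.typed
  have hf := hS.frame
  obtain ⟨d, hd, hT⟩ := hf.stmt.1
  have hg1 : σ₁.g.val V = some (.bool true) := hc.shrinks.path V hg
  obtain ⟨h1, vs, h2, h3⟩ := he.sound hH hf.env h.sim.valueSim hg1 hδ.left
    (fun r hr => hR r (.inl hr)) hT
  have h4 := h.sim.extends he.extends h1 hg1
  have h5 := hc.simState h4 hg
  have hρ := EnvTy.params (Eval.list_vty hH hf.env h3 hT)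
  have hwd := h.wf.preds p d hd
  obtain ⟨s1, s2, s3⟩ := he.scope σ.scoped_svals
  obtain ⟨s4, s5⟩ := hc.scope s3
  -- The full account of consumption is needed: validity in all of `α` would not suffice, because
  -- production requires permissions disjoint from the remaining chunks.
  obtain ⟨Θ, spec⟩ : ∃ Θ, ConsumeSpec P V H α ρ σ₁ (.pred p es) σ₂ R₂ Θ := by
    cases hc with
    | precise hc =>
      exact ⟨_, hc.sound h.wf.predSpecs hH hf.env h4
        (h.verifInv.optOK.extends he.extends) h4.valueSim rfl hg hδ.right
        (fun r hr => hR r (.inr hr)) ⟨d, hd, hT⟩⟩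
  have hA := spec.holds
  cases hA with
  | pred hd' hes hA =>
    cases hd.symm.trans hd'
    cases Eval.det_list h3 hes
    obtain ⟨σ₃, δ₃, V', h6, h7, h8⟩ := SProduce.exists h.wf.predSpecs hH hρ
      (h5.setEnv (ρ' := mkEnv d.vars vs) fun x t hx => h2.mkEnv hx)
      ((h.verifInv.finite.union δ₁.names_finite).union δ₂.names_finite)
      (s5.setEnv (mkEnv_svals fun t ht => (s2 t ht).trans Set.subset_union_left)) hA spec.owned
      (fun c hc => spec.disjoint _ (.inl ⟨c, hc, rfl⟩)) hwd.typed
      (fun x hx => by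
        obtain ⟨T, hx⟩ := Option.ne_none_iff_exists'.1 (hwd.typed.fv hx)
        obtain ⟨t, ht⟩ := mkEnv_isSome
          (by rw [h2.length_eq, ← h3.length_eq, hT.length_eq, List.length_map])
          (mkEnv_mem hx)
        exact Option.ne_none_iff_exists'.2 ⟨t, ht⟩)
    have h9 : Set.EqOn V V' σ.svals := h7.mono fun _ h => .inl (.inl h)
    exact h.valid (.unfoldPred hd he hc h6)
      (h8.setEnv (h.sim.congr σ.scoped_svals h9).env) (fun _ _ => rfl) h9

theorem StepContext.seq {s : Stmt} (h : StepContext P V σ (.seq .skip s) φ H α ρ S) :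
    ValidState P (.run H (⟨α, ρ, s⟩ :: S)) :=
  h.valid .seq h.sim (fun _ _ => rfl) fun _ _ => rfl

/-! ### Steps that change the heap, and steps that push or pop a frame -/

theorem Heap.agreeOn_set {l : Loc} {f : FieldName} {v : Value} {β : Set Perm} (h : (l, f) ∉ β) :
    H.AgreeOn (H.set l f v) β := by
  intro l' f' ha
  unfold Heap.set
  rw [if_neg]
  rintro ⟨rfl, rfl⟩
  exact h ha

theorem Heap.agreeOn_init {l : Loc} {fs : List (FieldName × Ty)} {β : Set Perm}
    (h : ∀ f, (l, f) ∉ β) : H.AgreeOn (H.init l fs) β := by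
  intro l' f' ha
  unfold Heap.init
  rw [if_neg]
  rintro rfl
  exact h f' ha

/-- After consumption of the accessibility predicate no remaining chunk involves the assigned field,
so the state corresponds to the permissions without it, and there the update is invisible. The
frames below do not own the field because the top frame does. -/
theorem StepContext.assignField {x : Var} {f : FieldName} {e : Expr} {s : Stmt} {l : Loc}
    {v : Value} (h : StepContext P V σ (.seq (.assignField x f e) s) φ H α ρ S)
    (hx : Eval H ρ (.var x) (.loc l)) (hv : Eval H ρ e v)
    (hA : Assert P H α ρ ⟨false, .acc (.var x) f⟩) {t : SExpr} {σ' σ'' : SState}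
    {R R' : Set Check} {δ δ' : Trace} (he : SEval σ.svals σ e t σ' R δ)
    (hc : SConsume (σ.svals ∪ δ.names) σ' ⟨false, .acc (.var x) f⟩ σ'' R' δ')
    (hδ : Trace.Consistent H V (δ ++ δ')) (hg : σ''.g.val V = some (.bool true))
    (hR : ∀ r ∈ R ∪ R', r.Holds P V H α) :
    ValidState P (.run (H.set l f v) (⟨α, ρ, s⟩ :: S)) := by
  have hP := h.wf.predSpecs
  obtain ⟨Ψ, Δ, hH, hS⟩ := h.inv.typed
  have hf := hS.frame
  obtain ⟨⟨T, hT₀, hT⟩, hs⟩ := hf.stmt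
  have hg1 : σ'.g.val V = some (.bool true) := hc.shrinks.path V hg
  obtain ⟨h1, v', h2, h3⟩ := he.sound hH hf.env h.sim.valueSim hg1 hδ.left
    (fun r hr => hR r (.inl hr)) hT
  cases hv.det h3
  have h4 := h.sim.extends he.extends h1 hg1
  -- The accessibility predicate is self-framed, since evaluating a variable reads no field.
  have h5 := (hc.sound hP hH hf.env h4 (h.verifInv.optOK.extends he.extends) hg hδ.right
    (fun r hr => hR r (.inr hr)) ⟨T, hT₀⟩
    (.inr fun _ _ _ _ => .acc (.var x))).2
  have hlf : (l, f) ∈ α := by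
    cases hA with
    | acc h6 h7 => cases hx.det h6; exact h7
  have h6 : SimState P V σ'' (H.set l f v) (α \ {(l, f)}) ρ := by
    refine ((hc.simState h4 hg).restrict (β := α \ {(l, f)}) fun θ hθ a ha =>
      ⟨(hc.simState h4 hg).vfoot_subset hP hθ ha, ?_⟩).heap hP (Heap.agreeOn_set fun h => h.2 rfl)
    rintro rfl
    exact Set.disjoint_left.1 (h5 θ hθ) ha (EFoot.acc hx)
  have hγ : σ''.γ = σ.γ := hc.shrinks.env.trans he.extends.env
  obtain ⟨tₓ, hx'⟩ := Option.ne_none_iff_exists'.1 (h.verifInv.init.1.1 : σ.γ x ≠ none)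
  have htx : tₓ.val V = some (.loc l) := by
    obtain ⟨w, h7, h8⟩ := h.sim.env x tₓ hx'
    cases hx with
    | var hx => rw [h7, ← h8, hx]
  refine h.valid (.assignField he hc (hγ ▸ hx')) ((h6.mono hP Set.sdiff_subset).insert ?_ ?_ ?_)
    (fun y _ => congrFun hγ y) (fun _ _ => rfl) fun fr hfr => Heap.agreeOn_set fun hfr' =>
      Set.disjoint_left.1 ((List.pairwise_cons.1 h.inv.disjoint).1 fr hfr) hlf hfr'
  · rintro c ⟨⟩
    exact ⟨l, htx, by simp [Heap.set, h2], hlf⟩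
  · rintro p ts ⟨⟩
  · intro c hc
    refine Set.disjoint_of_subset_left (h6.vfoot_subset hP (.inl ⟨c, hc, rfl⟩)) ?_
    rw [Set.disjoint_left]
    rintro ⟨l', f'⟩ ⟨_, h7⟩ ⟨h8, h9⟩
    cases htx.symm.trans h8
    cases h9
    exact h7 rfl

/-- No frame owns a field of the fresh location, so its initialisation is invisible to all old
chunks. The symbolic value for it does not come from the guard; the valuation is extended here. -/
theorem StepContext.alloc {x : Var} {St : StructName} {s : Stmt} {l : Loc}
    {fs : List (FieldName × Ty)} (h : StepContext P V σ (.seq (.alloc x St) s) φ H α ρ S)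
    (hl : FreshLoc H (⟨α, ρ, .seq (.alloc x St) s⟩ :: S) l) (hSt : P.structs St = some fs) :
    ValidState P (.run (H.init l fs) (⟨α ∪ {a | a.1 = l ∧ a.2 ∈ fs.map Prod.fst},
      Function.update ρ x (some (.loc l)), s⟩ :: S)) := by
  have hP := h.wf.predSpecs
  obtain ⟨ν, hν⟩ := h.verifInv.finite.exists_notMem
  have hV := Set.EqOn.update_of_notMem (V := V) hν (.loc l)
  have hνl : (SExpr.sv ν).val (Function.update V ν (.loc l)) = some (.loc l) := by
    simp [SExpr.val]
  generalize Function.update V ν (.loc l) = V' at hV hνl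
  have hl₀ := (hl.2 _ List.mem_cons_self).1
  have h1 : SimState P V' σ (H.init l fs) α ρ :=
    (h.sim.congr σ.scoped_svals hV).heap hP (Heap.agreeOn_init hl₀)
  have h2 := h1.mono hP (β := α ∪ {a | a.1 = l ∧ a.2 ∈ fs.map Prod.fst}) Set.subset_union_left
  have hold : ∀ c ∈ σ.H, ∀ g : FieldName,
      vfoot P V' (H.init l fs) c.perm ∩ vfoot P V' (H.init l fs) (.field (.sv ν) g) = ∅ := by
    refine fun c hc g => Set.disjoint_iff_inter_eq_empty.1 (Set.disjoint_left.2 ?_)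
    rintro ⟨l', f'⟩ h3 ⟨h4, _⟩
    cases hνl.symm.trans h4
    exact hl₀ f' (h1.vfoot_subset hP (.inl ⟨c, hc, rfl⟩) h3)
  refine h.valid (.alloc hν hSt) ⟨?_, ?_, ?_, h2.optimistic, env_update h1.env hνl, h2.path⟩
    (fun y hy => SState.update_of_not_modified hy rfl) hV fun fr hfr =>
      Heap.agreeOn_init (hl.2 fr (List.mem_cons_of_mem _ hfr)).1
  · rintro c (hc | ⟨fT, hf, hc⟩)
    · exact h2.field c hc
    · cases hc
      refine ⟨l, hνl, ?_, .inr ⟨rfl, List.mem_map_of_mem hf⟩⟩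
      simp [Heap.init, SExpr.val, lookup_of_nodup (h.wf.structs _ _ hSt) (T := fT.2) hf]
  · rintro p ts (hc | ⟨fT, hf, hc⟩)
    · exact h2.pred p ts hc
    · cases hc
  · rintro c₁ (hc₁ | ⟨fT₁, hf₁, rfl⟩) c₂ (hc₂ | ⟨fT₂, hf₂, rfl⟩) hne
    · exact h2.disjoint c₁ hc₁ c₂ hc₂ hne
    · exact hold c₁ hc₁ _
    · rw [Set.inter_comm]
      exact hold c₂ hc₂ _
    · refine Set.disjoint_iff_inter_eq_empty.1 (Set.disjoint_left.2 ?_)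
      rintro ⟨l', f'⟩ ⟨_, h4⟩ ⟨_, h5⟩
      -- Two new chunks with a common footprint have the same field name, and a struct declares each
      -- field once, so they coincide.
      cases List.inj_on_of_nodup_map (h.wf.structs _ _ hSt) hf₁ hf₂ (h4.symm.trans h5)
      exact hne rfl

/-- The caller's frame is justified by the guard: its consumed state corresponds to the permissions
that are not handed over. The callee starts an independent verification with its own valuation,
obtained by producing the pre-condition in the permissions that are handed over. -/
theorem StepContext.callEnter {y : Var} {m : MethodName} {es : List Expr} {s : Stmt}
    {d : MethodDecl} {vs : List Value} (h : StepContext P V σ (.seq (.call y m es) s) φ H α ρ S)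
    (hm : P.methods m = some d) (hes : List.Forall₂ (Eval H ρ) es vs) {ts : List SExpr}
    {σ₁ σ₂ : SState} {R₁ R₂ : Set Check} {δ₁ δ₂ : Trace}
    (he : SEvalList σ.svals σ es ts σ₁ R₁ δ₁)
    (hc : SConsume (σ.svals ∪ δ₁.names) { σ₁ with γ := mkEnv d.vars ts } d.pre σ₂ R₂ δ₂)
    (hδ : Trace.Consistent H V (δ₁ ++ δ₂)) (hg : σ₂.g.val V = some (.bool true))
    (hR : ∀ r ∈ R₁ ∪ R₂, r.Holds P V H α) {α₀ α' : Set Perm}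
    (hα₀ : α₀ = α \ vfootSet P V H (remPerms P σ₂ d.pre))
    (hA : Assert P H α₀ (mkEnv d.vars vs) d.pre) (hα' : α' = foot P H α₀ (mkEnv d.vars vs) d.pre) :
    ValidState P (.run H (⟨α', mkEnv d.vars vs, d.body.append .skip⟩ ::
      ⟨α \ α', ρ, .seq (.call y m es) s⟩ :: S)) := by
  have hP := h.wf.predSpecs
  obtain ⟨Ψ, Δ, hH, hS⟩ := h.inv.typed
  have hf := hS.frame
  obtain ⟨⟨d', hd', hT, hy⟩, hs⟩ := hf.stmt
  cases hm.symm.trans hd'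
  have hg1 : σ₁.g.val V = some (.bool true) := hc.shrinks.path V hg
  obtain ⟨h1, vs', h2, h3⟩ := he.sound hH hf.env h.sim.valueSim hg1 hδ.left
    (fun r hr => hR r (.inl hr)) hT
  cases Eval.det_list hes h3
  have h4 := (h.sim.extends he.extends h1 hg1).setEnv (ρ' := mkEnv d.vars vs)
    fun x t hx => h2.mkEnv hx
  have hρ := EnvTy.params (Eval.list_vty hH hf.env h3 hT)
  have hwd := h.wf.methods m d hm
  -- Consumption took place in the environment of the parameters; afterwards the environment of the
  -- caller is restored.
  have h5 := (hc.sound_diff_foot hP hH hρ h4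
    (show σ₁.OptOK from h.verifInv.optOK.extends he.extends) hg hδ.right
    (fun r hr => hR r (.inr hr)) hwd.pre_typed hwd.pre_spec).setEnv h.sim.env
  rw [← hα₀, ← hα'] at h5
  have hlen : vs.length = d.vars.length := by
    rw [← hes.length_eq, hT.length_eq, List.length_map]
  have h6 := sVals_range vs
  have h7 : SimState P _ (SState.empty (mkEnv d.vars ((List.range vs.length).map SExpr.sv))) H α'
      (mkEnv d.vars vs) :=
    ⟨nofun, nofun, nofun, nofun, fun x t hx => h6.mkEnv hx, rfl⟩
  obtain ⟨σ', δ', V', h8, h9, h10⟩ := SProduce.exists hP hH hρ h7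
    (U := {ν | ν ∈ List.range vs.length}) (List.finite_toSet _)
    ⟨Set.empty_subset _, nofun, nofun, mkEnv_svals fun t ht => by
      obtain ⟨ν, hν, rfl⟩ := List.mem_map.1 ht
      exact Set.singleton_subset_iff.2 hν⟩ (hα' ▸ hA.foot) subset_rfl nofun hwd.pre_typed
    fun x hx => by
      obtain ⟨t, ht⟩ := mkEnv_isSome (as := (List.range vs.length).map SExpr.sv)
        (by simpa using hlen) (hwd.pre_fv x hx)
      exact Option.ne_none_iff_exists'.2 ⟨t, ht⟩
  refine .run (.method hm List.nodup_range (by simpa using hlen) h8) h10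
    (.call hm h.partialValid h.reachable he ?_ hc h5)
  -- Both valuations give the argument values to the parameters, which links the callee to the
  -- stored call.
  refine (mkEnv_nodup (h2.length_eq.trans hlen) hwd.nodup).imp fun x t ht => ?_
  obtain ⟨v, h11, h12⟩ := h2.mkEnv ht
  obtain ⟨tₓ, h13, h14⟩ := mkEnv_forall₂ h6.flip h12
  obtain ⟨w, h15, h16⟩ := h10.env x tₓ ((congrFun h8.props.1 x).trans h13)
  cases h16.symm.trans h12
  exact ⟨tₓ, v, (congrFun h8.props.1 x).trans h13, h15, h11⟩

theorem exists_sVals {V : SValuation} {ρ : Env} {xs : List Var} {ts : List SExpr}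
    (h : List.Forall₂ (fun x t => ∃ v, ρ x = some v ∧ t.val V = some v) xs ts) :
    ∃ vs, List.Forall₂ (fun x v => ρ x = some v) xs vs ∧ SVals V ts vs := by
  induction h with
  | nil => exact ⟨[], .nil, .nil⟩
  | cons h _ ih =>
    obtain ⟨v, h1, h2⟩ := h
    obtain ⟨vs, h3, h4⟩ := ih
    exact ⟨v :: vs, .cons h1 h3, .cons h2 h4⟩

/-- The stack remembers the caller's state after consumption of the pre-condition. The symbolic call
is completed from there by producing the post-condition, whose validity the execution step asserts,
so the guard plays no role. Parameters are never assigned, so the final environment of the callee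
still holds the arguments. -/
theorem StepContext.callExit {y : Var} {m : MethodName} {es : List Expr} {s : Stmt}
    {d : MethodDecl} {v : Value} {α' : Set Perm} {ρ' : Env}
    (h : StepContext P V σ .skip φ H α' ρ' (⟨α, ρ, .seq (.call y m es) s⟩ :: S))
    (hm : P.methods m = some d) (hA : Assert P H α' ρ' d.post) (hv : ρ' .result = some v) :
    ValidState P (.run H (⟨α ∪ foot P H α' ρ' d.post, Function.update ρ y (some v), s⟩ :: S)) := by
  have hP := h.wf.predSpecs
  have hwd := h.wf.methods m d hm
  obtain ⟨⟨Ψ, Δ, hH, hS⟩, hdisj⟩ := h.inv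
  have hdisj := (List.pairwise_cons.1 hdisj).1 _ List.mem_cons_self
  cases hS with
  | call hS hm' hf hΔ hΔr hmod =>
  cases hm.symm.trans hm'
  have hpv := h.partialValid
  generalize hSg : VState.run σ .skip φ = Sg at hpv
  cases hpv with
  | @call _ _ _ _ _ _ _ _ _ _ d' σ₀ φ₀ W ts σ₁ R₁ δ₁ σ' R₂ δ₂ hm' hpv hr he hargs hc hsim =>
  cases hSg
  cases hm.symm.trans hm'
  -- The callee's parameters carry the values of the caller's symbolic arguments, by the link in the
  -- partially validated stack.
  obtain ⟨vs, hvs, hts⟩ : ∃ vs, List.Forall₂ (fun x v => ρ' x = some v) d.vars vs ∧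
      SVals W ts vs := by
    refine exists_sVals (hargs.imp ?_)
    rintro x t ⟨tₓ, v, h1, h2, h3⟩
    obtain ⟨w, h4, h5⟩ := h.sim.env x tₓ h1
    cases h4.symm.trans h2
    exact ⟨v, h5, h3⟩
  have hfin : (σ₀.svals ∪ δ₁.names ∪ δ₂.names).Finite :=
    ((hr.inv h.wf).finite.union δ₁.names_finite).union δ₂.names_finite
  obtain ⟨ν, hν⟩ := hfin.exists_notMem
  have hW := Set.EqOn.update_of_notMem (V := W) hν v
  have hνv : (SExpr.sv ν).val (Function.update W ν v) = some v := by simp [SExpr.val]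
  generalize Function.update W ν v = W' at hW hνv
  obtain ⟨_, hsc₁, hsc₂⟩ := he.scope σ₀.scoped_svals
  have hsc := (hc.scope (hsc₂.setEnv (mkEnv_svals hsc₁))).2
  have hsc₀ : ∀ x t, σ₀.γ x = some t → t.svals ⊆ σ₀.svals ∪ δ₁.names ∪ δ₂.names :=
    fun x t hx _ ha => .inl (.inl (σ₀.scoped_svals.env x t hx ha))
  have hsim' := hsim.congr (hsc.setEnv hsc₀) hW
  have h1 : ∀ x t, mkEnv d.vars ts x = some t →
      ∃ v, t.val W' = some v ∧ mkEnv d.vars vs x = some v := by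
    intro x t hx
    obtain ⟨w, h2, h3⟩ := hts.mkEnv hx
    exact ⟨w, SExpr.val_congr
      (hW.mono ((mkEnv_svals hsc₁ x t hx).trans Set.subset_union_left)) ▸ h2, h3⟩
  have hρ : EnvTy Ψ (Function.update (paramTys d.params) .result (some d.ret))
      (Function.update (mkEnv d.vars vs) .result (some v)) := by
    intro x w T hx hT
    by_cases hxr : x = .result
    · subst hxr
      rw [Function.update_self] at hx hT
      cases hx
      cases hT
      exact hf.env _ _ _ hv hΔr
    · rw [Function.update_of_ne hxr] at hx hT
      exact hf.env _ _ _ (mkEnv_of_forall₂ hvs hx) ((hΔ x (mkEnv_mem hx)).trans hT)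
  have hsub := hA.foot_subset hP hwd.post_spec
  -- The callee's local variables can be forgotten, as the post-condition mentions only parameters
  -- and `result`.
  have hA' := hA.foot.env (ρ' := Function.update (mkEnv d.vars vs) .result (some v))
    fun x hx => by
      by_cases hxr : x = .result
      · subst hxr
        rw [Function.update_self, hv]
      · rw [Function.update_of_ne hxr]
        obtain ⟨w, hw⟩ := mkEnv_isSome hvs.length_eq.symm ((hwd.post_fv x hx).resolve_right hxr)
        rw [hw, mkEnv_of_forall₂ hvs hw]
  obtain ⟨σ₃, δ₃, W'', h2, h3, h4⟩ := SProduce.exists hP hH hρ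
    ((hsim'.mono hP Set.subset_union_left).setEnv (env_update h1 hνv)) (hfin.insert ν)
    ((hsc.mono (Set.subset_insert _ _)).setEnv (SEnv.update_svals
      (fun x t hx => (mkEnv_svals hsc₁ x t hx).trans
        (Set.subset_union_left.trans (Set.subset_insert _ _)))
      (Set.singleton_subset_iff.2 (Set.mem_insert _ _))))
    hA' (β := α ∪ foot P H α' ρ' d.post) Set.subset_union_right
    -- The caller's remaining chunks lie in its own permissions and the returned ones belonged to
    -- the callee, so disjointness of the frames separates them.
    (fun c hc => (hdisj.mono hsub (hsim'.vfoot_subset hP (.inl ⟨c, hc, rfl⟩))).symm)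
    hwd.post_typed fun x hx => by
      change Function.update (mkEnv d.vars ts) .result _ x ≠ none
      by_cases hxr : x = .result
      · subst hxr
        simp
      · rw [Function.update_of_ne hxr]
        obtain ⟨t, ht⟩ := mkEnv_isSome hargs.length_eq.symm
          ((hwd.post_fv x hx).resolve_right hxr)
        simp [ht]
  refine .step hr hpv hS (.call hm he hc hν h2) (h4.setEnv (env_update ?_ ?_))
    (fun x hx => SState.update_of_not_modified hx rfl)
    ((hW.mono fun _ h => .inl (.inl h)).trans (h3.mono fun _ h => .inr (.inl (.inl h))))
  · intro x t hx
    rw [← SExpr.val_congr (h3.mono ((hsc₀ x t hx).trans (Set.subset_insert _ _)))]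
    exact hsim'.env x t hx
  · rw [← SExpr.val_congr (h3.mono (Set.singleton_subset_iff.2 (Set.mem_insert _ _)))]
    exact hνv

/-- The modified variables are replaced by fresh values for a new environment, and then a formula
that is valid there is produced. -/
theorem SProduce.exists_havoc (hP : P.PredSpecs) {Ψ : Loc → Option StructName} {Δ : TyEnv}
    {α' : Set Perm} {ρ' : Env} (hH : HeapTy P Ψ H) (hρ' : EnvTy Ψ Δ ρ')
    (hσ : SimState P V σ H α ρ) {U : Set ℕ} (hU : U.Finite) (hsc : σ.Scoped U) {xs : List Var}
    (hdom : ∀ x, ρ x ≠ none → ρ' x ≠ none) (heq : ∀ x ∉ xs, ρ' x = ρ x)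
    (hA : Assert P H α' ρ' φ) (hα : Disjoint α α') (hT : FormulaTy P Δ φ.body)
    (hfv : φ.body.fv ⊆ σ.dom) :
    ∃ γ' δ₁ σ' δ₂ V', Havoc U σ.γ xs γ' δ₁ ∧
      SProduce (U ∪ δ₁.names) { σ with γ := γ' } φ σ' δ₂ ∧ Set.EqOn V V' U ∧
      SimState P V' σ' H (α ∪ α') ρ' ∧ σ'.dom = σ.dom ∧
      σ'.Scoped (U ∪ δ₁.names ∪ δ₂.names) ∧ ∀ x ∉ xs, σ'.γ x = σ.γ x := by
  obtain ⟨γ', δ₁, V₁, h1, h2, h3⟩ := Havoc.exists (xs := xs) (ρ := ρ') hU hsc.env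
    (fun x t hx => by
      obtain ⟨v, _, h⟩ := hσ.env x t hx
      exact (Option.ne_none_iff_exists'.1 (hdom x (by simp [h]))))
    fun x t hxs hx => by
      obtain ⟨v, h, h'⟩ := hσ.env x t hx
      exact ⟨v, h, (heq x hxs).trans h'⟩
  have h4 := hσ.congr hsc h2
  obtain ⟨h5, h6⟩ := h1.scope hsc.env
  have hsc' := (hsc.mono (U' := U ∪ δ₁.names) Set.subset_union_left).setEnv h6
  have hdom' : SState.dom { σ with γ := γ' } = σ.dom :=
    Set.ext fun x => not_congr (h1.eq_none x)
  obtain ⟨σ', δ₂, V', h7, h8, h9⟩ := SProduce.exists hP hH hρ'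
    ((h4.mono hP Set.subset_union_left).setEnv h3) (hU.union δ₁.names_finite) hsc' hA
    (β := α ∪ α') Set.subset_union_right
    (fun c hc => hα.mono_left (h4.vfoot_subset hP (.inl ⟨c, hc, rfl⟩))) hT (hdom' ▸ hfv)
  have hγ : σ'.γ = γ' := h7.props.1
  refine ⟨γ', δ₁, σ', δ₂, V', h1, h7, h2.trans (h8.mono Set.subset_union_left), h9, ?_,
    (h7.scope hsc').2, fun x hx => (congrFun hγ x).trans (h1.eq_of_not_mem hx)⟩
  rw [← hdom', SState.dom, hγ]
  rfl

/-- As for a call, the consumed state of the guard justifies the frame left behind. The body is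
verified from a separate state, where the modified variables get fresh symbols; on entry these stand
for the current values. -/
theorem StepContext.loopEnter {e : Expr} {ψ : GFormula} {b s : Stmt}
    (h : StepContext P V σ (.seq (.loop e ψ b) s) φ H α ρ S) (he : Eval H ρ e (.bool true))
    {σ₁ : SState} {R : Set Check} {δ : Trace} (hc : SConsume σ.svals σ ψ σ₁ R δ)
    (hδ : δ.Consistent H V) (hg : σ₁.g.val V = some (.bool true))
    (hR : ∀ r ∈ R, r.Holds P V H α) {α₀ α' : Set Perm}
    (hα₀ : α₀ = α \ vfootSet P V H (remPerms P σ₁ ψ))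
    (hA : Assert P H α₀ ρ ψ) (hα' : α' = foot P H α₀ ρ ψ) :
    ValidState P (.run H (⟨α', ρ, b.append .skip⟩ ::
      ⟨α \ α', ρ, .seq (.loop e ψ b) s⟩ :: S)) := by
  have hP := h.wf.predSpecs
  obtain ⟨Ψ, Δ, hH, hS⟩ := h.inv.typed
  have hf := hS.frame
  obtain ⟨⟨hTe, hT, hb⟩, hs⟩ := hf.stmt
  have h1 := hc.sound_diff_foot hP hH hf.env h.sim h.verifInv.optOK hg hδ hR hT
    (hf.spec _ (.inl (Set.mem_insert _ _)))
  rw [← hα₀, ← hα'] at h1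
  -- The body starts without chunks, so it corresponds to no permissions at all, and production then
  -- adds exactly the handed-over ones.
  have hsim : SimState P V ⟨false, σ.g, ∅, ∅, σ.γ⟩ H ∅ ρ :=
    ⟨nofun, nofun, nofun, nofun, h.sim.env, h.sim.path⟩
  obtain ⟨hfe, hfφ, _⟩ := h.verifInv.init.1
  obtain ⟨γ', δ₁, σ₀', δ₂, V₁, h2, h3, h4, h5, h6, h7, h8⟩ :=
    SProduce.exists_havoc (xs := b.modified) hP hH hf.env hsim h.verifInv.finite
      ⟨σ.scoped_svals.path, nofun, nofun, σ.scoped_svals.env⟩ (fun _ h => h) (fun _ _ => rfl)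
      (hα' ▸ hA.foot) (Set.empty_disjoint _) hT hfφ
  rw [Set.empty_union] at h5
  obtain ⟨t, R', δ₃, V₂, h9, h10, v, h11, _, h12⟩ := SPCEval.exists hH h5.valueSim hf.env h5.path
    ((h.verifInv.finite.union δ₁.names_finite).union δ₂.names_finite) h7 hTe (h6 ▸ hfe)
  cases h12 _ he
  have h13 := h5.congr h7 h10
  obtain ⟨Sg, hr⟩ := h.reachable.resolve_left nofun
  exact .run (.loopBody hr h2 h3 h9) (h13.setPath (SExpr.val_and.2 ⟨h13.path, h11⟩))
    (.loop h.partialValid h.reachable hc h1)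

/-- The invariant is consumed and produced again at once in an unchanged run-time state, so
replacing the modified variables only renames their values. The guard evaluates the condition too,
but its derivation is not reused: production is redone with values chosen for the actual state. -/
theorem StepContext.loopSkip {e : Expr} {ψ : GFormula} {b s : Stmt}
    (h : StepContext P V σ (.seq (.loop e ψ b) s) φ H α ρ S) (he : Eval H ρ e (.bool false))
    {σ₁ : SState} {R : Set Check} {δ : Trace} (hc : SConsume σ.svals σ ψ σ₁ R δ)
    (hδ : δ.Consistent H V) (hg : σ₁.g.val V = some (.bool true))
    (hR : ∀ r ∈ R, r.Holds P V H α)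
    (hA : Assert P H (α \ vfootSet P V H (remPerms P σ₁ ψ)) ρ ψ) :
    ValidState P (.run H (⟨α, ρ, s⟩ :: S)) := by
  have hP := h.wf.predSpecs
  obtain ⟨Ψ, Δ, hH, hS⟩ := h.inv.typed
  have hf := hS.frame
  obtain ⟨⟨hTe, hT, hb⟩, hs⟩ := hf.stmt
  have hspec := hf.spec _ (.inl (Set.mem_insert _ _))
  have h1 := hc.sound_diff_foot hP hH hf.env h.sim h.verifInv.optOK hg hδ hR hT hspec
  have hγ : σ₁.γ = σ.γ := hc.shrinks.env
  have hdom : σ₁.dom = σ.dom := by rw [SState.dom, hγ]; rfl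
  obtain ⟨hfe, hfφ, _⟩ := h.verifInv.init.1
  have hfin := h.verifInv.finite.union δ.names_finite
  obtain ⟨γ', δ₁, σ₂, δ₂, V₁, h2, h3, h4, h5, h6, h7, h8⟩ :=
    SProduce.exists_havoc (xs := b.modified) hP hH hf.env h1 hfin (hc.scope σ.scoped_svals).2
      (fun _ h => h) (fun _ _ => rfl) hA.foot disjoint_sdiff_self_left hT (hdom ▸ hfφ)
  -- What is withheld and what the invariant takes together are all permissions of the frame.
  rw [Set.sdiff_union_of_subset ((hA.foot_subset hP hspec).trans Set.sdiff_subset)] at h5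
  obtain ⟨t, R', δ₃, V₂, h9, h10, v, h11, _, h12⟩ := SPCEval.exists hH h5.valueSim hf.env h5.path
    ((hfin.union δ₁.names_finite).union δ₂.names_finite) h7 hTe (h6 ▸ hdom ▸ hfe)
  cases h12 _ he
  have h13 := h5.congr h7 h10
  refine h.valid (.loopSkip hc h2 h3 h9)
    (h13.setPath (SExpr.val_and.2 ⟨h13.path, SExpr.val_not.2 h11⟩)) (fun x hx => ?_)
    ((h4.mono Set.subset_union_left).trans (h10.mono fun _ h => .inl (.inl (.inl h))))
  refine (h8 x fun hx' => hx ?_).trans (congrFun hγ x)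
  simp [Stmt.modified, hx']

/-- The state remembered for the loop head is its consumed state. The body can only have changed the
modified variables, so fresh symbols for these account for the new environment, and the invariant is
produced with the permissions returned by the body. -/
theorem StepContext.loopFinish {e : Expr} {ψ : GFormula} {b s : Stmt} {α' : Set Perm} {ρ' : Env}
    (h : StepContext P V σ .skip φ H α' ρ' (⟨α, ρ, .seq (.loop e ψ b) s⟩ :: S))
    (hA : Assert P H α' ρ' ψ) :
    ValidState P (.run H (⟨α ∪ foot P H α' ρ' ψ, ρ', .seq (.loop e ψ b) s⟩ :: S)) := by
  have hP := h.wf.predSpecs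
  obtain ⟨⟨Ψ, Δ, hH, hS⟩, hdisj⟩ := h.inv
  have hdisj := (List.pairwise_cons.1 hdisj).1 _ List.mem_cons_self
  cases hS with
  | loop hS hf _ heq hdom =>
  have hf₀ := hS.frame
  obtain ⟨⟨hTe, hT, hb⟩, hs⟩ := hf₀.stmt
  have hspec := hf₀.spec _ (.inl (Set.mem_insert _ _))
  have hpv := h.partialValid
  generalize hSg : VState.run σ .skip φ = Sg at hpv
  cases hpv with
  | @loop _ _ _ _ _ _ _ _ _ _ σ₀ φ₀ W σ' R δ hpv hr hc hsim =>
  cases hSg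
  have hγ : σ'.γ = σ₀.γ := hc.shrinks.env
  have hinv := hr.inv h.wf
  obtain ⟨γ', δ₁, σ₂, δ₂, W', h2, h3, h4, h5, h6, h7, h8⟩ :=
    SProduce.exists_havoc (xs := b.modified) hP hH hf.env hsim (hinv.finite.union δ.names_finite)
      (hc.scope σ₀.scoped_svals).2 hdom heq hA.foot
      (hdisj.mono_left (hA.foot_subset hP hspec)).symm hT
      (by rw [SState.dom, hγ]; exact hinv.init.1.2.1)
  obtain ⟨Sg, hr'⟩ := hr.resolve_left nofun
  refine .run (.loop hr' hc h2 h3) h5 (hpv.replace hS fun x t v hx ht hv => ⟨t, ?_, ?_⟩)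
  · refine (h8 x fun hx' => hx ?_).trans ((congrFun hγ x).trans ht)
    simp [Stmt.modified, hx']
  · rw [← SExpr.val_congr (h4.mono ((σ₀.scoped_svals.env x t ht).trans Set.subset_union_left))]
    exact hv

theorem StepContext.setVal {s : Stmt} (h : StepContext P V σ s φ H α ρ S) {V' : SValuation}
    (hV : Set.EqOn V V' σ.svals) : StepContext P V' σ s φ H α ρ S :=
  ⟨h.wf, h.reachable, h.sim.congr σ.scoped_svals hV, h.partialValid.setVal hV, h.inv⟩

/-- Preservation for the execution steps of a running program. -/
theorem StepContext.preservation {s : Stmt} (h : StepContext P V σ s φ H α ρ S) {σ' : SState}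
    {R : Set Check} {Θ : Set SPerm} {δ : Trace} (hguard : Guard P (.run σ s φ) σ' R Θ δ)
    (hδ : δ.Consistent H V) (hg : σ'.g.val V = some (.bool true))
    (hR : ∀ r ∈ R, r.Holds P V H α) {H' : Heap} {S' : Stack}
    (hstep : DStep P (vfootSet P V H Θ) H (⟨α, ρ, s⟩ :: S) H' S') :
    ValidState P (.run H' S') := by
  cases hstep with
  | seq => exact h.seq
  | assign hv =>
    cases hguard with
    | assign he => exact h.assign hv he hδ hg hR
  | assignField hx hv hA =>
    cases hguard with
    | assignField he hc => exact h.assignField hx hv hA he hc hδ hg hR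
  | alloc hl hSt => exact h.alloc hl hSt
  | callEnter hm hes _ hA hα' =>
    cases hguard with
    | call hm' he hc =>
      cases hm.symm.trans hm'
      exact h.callEnter hm hes he hc hδ hg hR rfl hA hα'
  | callExit hm hA hv => exact h.callExit hm hA hv
  | assert hA =>
    cases hguard with
    | assert hc => exact h.assert hA hc hg
  | iteA hv =>
    cases hguard with
    | ite he => exact h.ite hv he hδ hg hR
  | iteB hv =>
    cases hguard with
    | ite he => exact h.ite hv he hδ hg hR
  | loopEnter hv _ hA hα' =>
    cases hguard with
    | loop hc _ hp _ =>
      -- The guard's path condition is taken after production, and it implies the one after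
      -- consumption.
      exact h.loopEnter hv hc hδ.left.left.left (hp.props.2.2.2 V hg) (fun r hr => hR r (.inl hr))
        rfl hA hα'
  | loopSkip hv _ hA =>
    cases hguard with
    | loop hc _ hp _ =>
      exact h.loopSkip hv hc hδ.left.left.left (hp.props.2.2.2 V hg) (fun r hr => hR r (.inl hr))
        hA
  | loopFinish hA => exact h.loopFinish hA
  | foldPred =>
    cases hguard with
    | foldPred hd he hc => exact h.foldPred hd he hc hδ hg hR
  | unfoldPred =>
    cases hguard with
    | unfoldPred he hc => exact h.unfoldPred he hc hδ hg hR

end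

end GradualC0

open GradualC0
/-- Preservation. -/
theorem theorem3 (P : Program) (hP : P.WellFormed)
    (Γ Γ' : DState) (Sg : VState) (V : SValuation)
    (hvalid : Validated P Γ Sg V)
    (σ : SState) (R : Set Check) (Θ : Set SPerm) (δ : Trace)
    (hguard : Guard P Sg σ R Θ δ)
    (V' : SValuation) (hV' : V' = δ.extend Γ.heap V)
    (hpath : σ.g.val V' = some (.bool true))
    (hchecks : ∀ r ∈ R, r.Holds P V' Γ.heap Γ.perms)
    (hstep : DTrans P (vfootSet P V' Γ.heap Θ) Γ Γ') :
    ValidState P Γ' := by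
  obtain ⟨hr, hcor, hpv⟩ := hvalid
  cases hstep with
  | init =>
    exact .run (V := V) .init ⟨nofun, nofun, nofun, nofun, nofun, rfl⟩ .nil
  | @step X₀ Γ₀ _ H S H' S' htr hs =>
    have hinv := htr.execInv hP _ _ rfl
    rcases S with _ | ⟨⟨α, ρ, s⟩, S⟩
    · cases hs
    cases Sg with
    | init => exact hcor.elim
    | final => exact hcor.elim
    | run σ₀ s₀ φ =>
      obtain ⟨rfl, hsim⟩ := hcor
      -- The old state remains validated under the corresponding valuation, which may therefore
      -- replace `V` from the outset.
      obtain ⟨hV, hδ⟩ := hguard.fresh.extend (H := H) V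
      change V' = δ.extend H V at hV'
      rw [← hV'] at hV hδ
      have h : StepContext P V σ₀ s₀ φ H α ρ S := ⟨hP, hr, hsim, hpv _ _ _ rfl, hinv⟩
      exact (h.setVal hV).preservation hguard hδ hpath hchecks hs
  | final =>
    cases Sg with
    | init => exact hcor.elim
    | final => exact hcor.elim
    | run σ₀ s₀ φ =>
      obtain ⟨rfl, hsim⟩ := hcor
      cases hguard with
      | finish hc =>
        obtain ⟨Sg, hr⟩ := hr.resolve_left nofun
        -- The final verification state only requires that the post-condition can be consumed, which
        -- the guard derivation shows.
        exact ⟨.final, V, .inr ⟨_, .final hr hc⟩, trivial, nofun⟩
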